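/- All C*-algebras are unital. An \emph{operator system} is a complex $*$-vector space $\mathcal S$ with a matrix ordering $\{M_n(\mathcal S)^+\}_{n\ge 1}$ (proper cones of hermitian matrices with $X^*M_n(\mathcal S)^+X\subseteq M_m(\mathcal S)^+$ for all scalar $n\times m$ matrices $X$) and an Archimedean matrix order unit $e$; C*-algebras are operator systems in the canonical way. An \emph{inclusion} $\mathcal S\subseteq\mathcal S_1$ of operator systems is a unital linear map that is a complete order isomorphism onto its range. An operator system $\mathcal R$ is \emph{injective} if, for every inclusion $\mathcal X\subseteq\mathcal Y$ of operator systems, every completely positive map $\mathcal X\to\mathcal R$ extends to a completely positive map $\mathcal Y\to\mathcal R$; a C*-algebra is injective if it is so as an operator system. Every operator system $\mathcal S$ has an \emph{injective envelope} $I(\mathcal S)$, that is, a minimal injective operator system containing $\mathcal S$ (no proper operator subsystem of $I(\mathcal S)$ that contains $\mathcal S$ is injective). If $\mathcal S$ is included in a C*-algebra $\mathcal A$, then $\mathcal S''$ denotes the double commutant of $\mathcal S$ in $\mathcal A$; a map into $\mathcal S''$ defined on an operator system containing $\mathcal S$ \emph{fixes} $\mathcal S$ if it sends each $x\in\mathcal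 S$ to $x$. Tensor products of operator systems $\mathcal S,\mathcal T$ with units $e_1,e_2$, all on the algebraic tensor product $\mathcal S\otimes\mathcal T$: (max) $u\in M_n(\mathcal S\otimes_{\max}\mathcal T)^+$ iff for every $r>0$ there are $k,m$, $P\in M_k(\mathcal S)^+$, $Q\in M_m(\mathcal T)^+$ and a scalar $km\times n$ matrix $X$ with $r(e_1\otimes e_2)_n+u=X^*(P\otimes Q)X$, where $(e_1\otimes e_2)_n$ is the $n\times n$ diagonal matrix with diagonal entries $e_1\otimes e_2$; (c) $u\in M_n(\mathcal S\otimes_{c}\mathcal T)^+$ iff $(\phi\cdot\psi)^{(n)}(u)\ge 0$ for every Hilbert space $H$ and all completely positive maps $\phi:\mathcal S\to\mathcal B(H)$, $\psi:\mathcal T\to\mathcal B(H)$ with commuting ranges, where $(\phi\cdot\psi)(x\otimes y)=\phi(x)\psi(y)$; (el) $M_n(\mathcal S\otimes_{el}\mathcal T)^+=M_n(\mathcal S\otimes\mathcal T)\cap M_n(I(\mathcal S)\otimes_{\max}\mathcal T)^+$. $\mathcal S$ is \emph{$(el,c)$-nuclear} if for every operator system $\mathcal T$ the identity of $\mathcal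 S\otimes\mathcal T$ is a complete order isomorphism between $\mathcal S\otimes_{el}\mathcal T$ and $\mathcal S\otimes_c\mathcal T$. \textbf{Theorem.} Let $\mathcal S$ be an operator system. The following properties are equivalent: (1) $\mathcal S$ has the double commutant expectation property: for every inclusion $\mathcal S\subseteq\mathcal B(H)$, $H$ a Hilbert space, there is a completely positive map $\varphi:\mathcal B(H)\to\mathcal S''$ fixing $\mathcal S$; (2) for every inclusion $\mathcal S\subseteq\mathcal B(H)$ there is a completely positive map $\varphi:I(\mathcal S)\to\mathcal S''$ fixing $\mathcal S$; (3) there is an injective C*-algebra $\mathcal B$ with $\mathcal S\subseteq\mathcal B$ such that for every inclusion $\mathcal S\subseteq\mathcal B(H)$ there is a completely positive map $\varphi:\mathcal B\to\mathcal S''$ fixing $\mathcal S$, where $\mathcal S''$ is computed in $\mathcal B(H)$; (4) for every injective C*-algebra $\mathcal A$ with $\mathcal S\subseteq\mathcal A$ there is a completely positive map $\varphi:\mathcal A\to\mathcal S''$ fixing $\mathcal S$, where $\mathcal S''$ is computed in $\mathcal A$; (5) $\mathcal S$ is $(el,c)$-nuclear. -/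

import Mathlib

open scoped TensorProduct

universe u

noncomputable section

/-- For a scalar matrix `X` and a square matrix `M` over a complex vector space, the matrix
`X* M X`. -/
def scalarConj {ι κ V : Type*} [Fintype ι] [AddCommGroup V] [Module ℂ V]
    (X : Matrix ι κ ℂ) (M : Matrix ι ι V) : Matrix κ κ V :=
  Matrix.of fun i j => ∑ k, ∑ l, (star (X k i) * X l j) • M k l

/-- An (abstract) operator system structure on a complex `*`-vector space `V`: a matrix ordering
`cone n ⊆ M_n(V)_h` together with an Archimedean matrix order unit `unit`. (For `n = 0` the space
`M_0(V)` is a single point and the axioms force `cone 0` to be everything.) -/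
class OperatorSystem (V : Type*) [AddCommGroup V] [Module ℂ V] [StarAddMonoid V]
    [StarModule ℂ V] where
  cone : (n : ℕ) → Set (Matrix (Fin n) (Fin n) V)
  unit : V
  isHermitian_of_mem : ∀ {n : ℕ} {M : Matrix (Fin n) (Fin n) V}, M ∈ cone n → M.IsHermitian
  zero_mem : ∀ n : ℕ, (0 : Matrix (Fin n) (Fin n) V) ∈ cone n
  add_mem : ∀ {n : ℕ} {M N : Matrix (Fin n) (Fin n) V}, M ∈ cone n → N ∈ cone n → M + N ∈ cone n
  smul_mem : ∀ {n : ℕ} {M : Matrix (Fin n) (Fin n) V} (r : ℝ), 0 ≤ r → M ∈ cone n →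
    (r : ℂ) • M ∈ cone n
  eq_zero_of_mem_of_neg_mem : ∀ {n : ℕ} {M : Matrix (Fin n) (Fin n) V}, M ∈ cone n →
    -M ∈ cone n → M = 0
  conj_mem : ∀ {n m : ℕ} {M : Matrix (Fin n) (Fin n) V} (X : Matrix (Fin n) (Fin m) ℂ),
    M ∈ cone n → scalarConj X M ∈ cone m
  star_unit : star unit = unit
  order_unit : ∀ {n : ℕ} (M : Matrix (Fin n) (Fin n) V), M.IsHermitian →
    ∃ r : ℝ, 0 < r ∧ (r : ℂ) • Matrix.diagonal (fun _ => unit) - M ∈ cone n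
  archimedean : ∀ {n : ℕ} (M : Matrix (Fin n) (Fin n) V),
    (∀ r : ℝ, 0 < r → (r : ℂ) • Matrix.diagonal (fun _ => unit) + M ∈ cone n) → M ∈ cone n

section CStar

theorem exists_star_mul_self_of_nonneg {B : Type*} [CStarAlgebra B] [PartialOrder B]
    [StarOrderedRing B] {b : B} (hb : 0 ≤ b) : ∃ c, b = star c * c :=
  CStarAlgebra.nonneg_iff_eq_star_mul_self.mp hb

theorem exists_smul_one_sub_nonneg {B : Type*} [CStarAlgebra B] [PartialOrder B]
    [StarOrderedRing B] {b : B} (hb : IsSelfAdjoint b) :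
    ∃ r : ℝ, 0 < r ∧ 0 ≤ (r : ℂ) • (1 : B) - b := by
  refine ⟨‖b‖ + 1, by positivity, ?_⟩
  have h1 : b ≤ algebraMap ℝ B ‖b‖ := hb.le_algebraMap_norm_self
  have h2 : algebraMap ℝ B ‖b‖ ≤ algebraMap ℝ B (‖b‖ + 1) := algebraMap_mono B (by linarith)
  have h3 : ((‖b‖ + 1 : ℝ) : ℂ) • (1 : B) = algebraMap ℝ B (‖b‖ + 1) := by
    rw [Algebra.algebraMap_eq_smul_one, Complex.coe_smul]
  rw [h3]
  exact sub_nonneg.mpr (h1.trans h2)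

theorem nonneg_of_forall_smul_one_add_nonneg {B : Type*} [CStarAlgebra B] [PartialOrder B]
    [StarOrderedRing B] {b : B} (hb : ∀ r : ℝ, 0 < r → 0 ≤ (r : ℂ) • (1 : B) + b) : 0 ≤ b := by
  have hc : Filter.Tendsto (fun r : ℝ => (r : ℂ) • (1 : B) + b) (nhdsWithin 0 (Set.Ioi 0))
      (nhds (((0 : ℝ) : ℂ) • (1 : B) + b)) :=
    (Continuous.tendsto (by fun_prop) 0).mono_left nhdsWithin_le_nhds
  have := ge_of_tendsto hc (Filter.eventually_of_mem self_mem_nhdsWithin fun r hr => hb r hr)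
  simpa using this

variable {A : Type*} [CStarAlgebra A] [PartialOrder A] [StarOrderedRing A]

/-- Positivity in the C*-algebra `M_n(A)` is preserved by `M ↦ X* M X` for rectangular scalar
matrices `X`. -/
theorem scalarConj_nonneg {n m : ℕ} (X : Matrix (Fin n) (Fin m) ℂ) (M : Matrix (Fin n) (Fin n) A)
    (hM : 0 ≤ CStarMatrix.ofMatrix M) : 0 ≤ CStarMatrix.ofMatrix (scalarConj X M) := by
  rcases m with _ | m
  · have h : CStarMatrix.ofMatrix (scalarConj X M) = 0 := by
      ext i; exact i.elim0
    rw [h]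
  obtain ⟨N, hN⟩ := exists_star_mul_self_of_nonneg hM
  let P : Fin n → CStarMatrix (Fin (m + 1)) (Fin (m + 1)) A := fun k =>
    CStarMatrix.ofMatrix (Matrix.of fun i j => if i = 0 then ∑ l, X l j • N k l else 0)
  have key : CStarMatrix.ofMatrix (scalarConj X M) = ∑ k, star (P k) * P k := by
    ext i j
    have h1 : ∀ a b, M a b = ∑ k, star (N k a) * N k b := fun a b => by
      have := congrFun (congrFun hN a) b
      simpa [CStarMatrix.mul_apply, CStarMatrix.star_apply] using this
    have h2 : (∑ k, star (P k) * P k) i j = ∑ k, (star (P k) * P k) i j := by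
      rw [← CStarMatrix.ofMatrix.apply_symm_apply (∑ k, star (P k) * P k)]
      exact Matrix.sum_apply i j Finset.univ (fun k => CStarMatrix.ofMatrix.symm (star (P k) * P k))
    rw [h2]
    have h3 : ∀ k, (star (P k) * P k) i j
        = star (∑ l, X l i • N k l) * (∑ l, X l j • N k l) := fun k => by
      simp [CStarMatrix.mul_apply, CStarMatrix.star_apply, P]
    simp only [h3, CStarMatrix.ofMatrix_apply, scalarConj, Matrix.of_apply, h1, star_sum, star_smul,
      Finset.sum_mul_sum, smul_mul_smul_comm, Finset.smul_sum]
    calc _ = ∑ a, ∑ k, ∑ b, (star (X a i) * X b j) • (star (N k a) * N k b) :=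
          Finset.sum_congr rfl fun a _ => Finset.sum_comm
      _ = _ := Finset.sum_comm
  rw [key]
  exact Finset.sum_nonneg fun k _ => star_mul_self_nonneg _

/-- A unital C*-algebra is an operator system: `M_n(A)⁺` is the positive cone of the C*-algebra
`M_n(A)`, and the order unit is `1`. -/
instance CStarAlgebra.toOperatorSystem : OperatorSystem A where
  cone n := {M | 0 ≤ CStarMatrix.ofMatrix M}
  unit := 1
  isHermitian_of_mem {n M} h := by
    have h' : IsSelfAdjoint (CStarMatrix.ofMatrix M) := IsSelfAdjoint.of_nonneg h
    exact h'
  zero_mem n := le_refl (0 : CStarMatrix (Fin n) (Fin n) A)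
  add_mem {n M N} hM hN := add_nonneg (α := CStarMatrix (Fin n) (Fin n) A) hM hN
  smul_mem {n M} r hr hM := by
    have h : 0 ≤ r • CStarMatrix.ofMatrix M := smul_nonneg hr hM
    have e : CStarMatrix.ofMatrix ((r : ℂ) • M) = r • CStarMatrix.ofMatrix M := by
      ext i j; exact Complex.coe_smul r (M i j)
    simpa [e] using h
  eq_zero_of_mem_of_neg_mem {n M} h1 h2 := by
    have h2' : 0 ≤ -CStarMatrix.ofMatrix M := h2
    exact le_antisymm (α := CStarMatrix (Fin n) (Fin n) A) (neg_nonneg.mp h2') h1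
  conj_mem X h := scalarConj_nonneg X _ h
  star_unit := star_one A
  order_unit {n} M hM := by
    obtain ⟨r, hr, h⟩ := exists_smul_one_sub_nonneg (b := CStarMatrix.ofMatrix M) hM
    exact ⟨r, hr, h⟩
  archimedean {n} M hM := by
    exact nonneg_of_forall_smul_one_add_nonneg (b := CStarMatrix.ofMatrix M) hM

end CStar

section Maps

variable {S T : Type*}
  [AddCommGroup S] [Module ℂ S] [StarAddMonoid S] [StarModule ℂ S] [OperatorSystem S]
  [AddCommGroup T] [Module ℂ T] [StarAddMonoid T] [StarModule ℂ T] [OperatorSystem T]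

/-- `φ` is completely positive: all its amplifications `φ^{(n)}` are positive. -/
def IsCompletelyPositive (φ : S →ₗ[ℂ] T) : Prop :=
  ∀ (n : ℕ) (M : Matrix (Fin n) (Fin n) S),
    M ∈ OperatorSystem.cone n → M.map φ ∈ OperatorSystem.cone n

/-- `φ` is an inclusion of operator systems: it is unital and a complete order isomorphism onto
its range. -/
structure IsInclusion (φ : S →ₗ[ℂ] T) : Prop where
  injective : Function.Injective φ
  map_unit : φ OperatorSystem.unit = OperatorSystem.unit
  mem_cone_iff : ∀ (n : ℕ) (M : Matrix (Fin n) (Fin n) S),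
    M.map φ ∈ OperatorSystem.cone n ↔ M ∈ OperatorSystem.cone n

end Maps

/-- `R` is injective: for every inclusion `X ⊆ Y` of operator systems, every completely positive
map `X → R` extends to a completely positive map `Y → R`. -/
def IsInjectiveSystem (R : Type u) [AddCommGroup R] [Module ℂ R] [StarAddMonoid R]
    [StarModule ℂ R] [OperatorSystem R] : Prop :=
  ∀ (X Y : Type u)
    [AddCommGroup X] [Module ℂ X] [StarAddMonoid X] [StarModule ℂ X] [OperatorSystem X]
    [AddCommGroup Y] [Module ℂ Y] [StarAddMonoid Y] [StarModule ℂ Y] [OperatorSystem Y]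
    (j : X →ₗ[ℂ] Y) (f : X →ₗ[ℂ] R), IsInclusion j → IsCompletelyPositive f →
    ∃ g : Y →ₗ[ℂ] R, IsCompletelyPositive g ∧ ∀ x, g (j x) = f x

section Objects

variable {S E : Type u}
  [AddCommGroup S] [Module ℂ S] [StarAddMonoid S] [StarModule ℂ S] [OperatorSystem S]
  [AddCommGroup E] [Module ℂ E] [StarAddMonoid E] [StarModule ℂ E] [OperatorSystem E]

/-- `(E, κ)` is an injective envelope `I(S)` of `S`: a minimal injective operator system
containing `S`, i.e. every injective operator system `W` with `S ⊆ W ⊆ E` is all of `E`. -/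
structure IsInjectiveEnvelope (κ : S →ₗ[ℂ] E) : Prop where
  isInclusion : IsInclusion κ
  isInjective : IsInjectiveSystem E
  minimal : ∀ (W : Type u) [AddCommGroup W] [Module ℂ W] [StarAddMonoid W] [StarModule ℂ W]
    [OperatorSystem W] (f : S →ₗ[ℂ] W) (g : W →ₗ[ℂ] E), IsInjectiveSystem W → IsInclusion f →
    IsInclusion g → g ∘ₗ f = κ → Function.Surjective g

end Objects

section Tensor

variable (S T : Type u)
  [AddCommGroup S] [Module ℂ S] [StarAddMonoid S] [StarModule ℂ S] [OperatorSystem S]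
  [AddCommGroup T] [Module ℂ T] [StarAddMonoid T] [StarModule ℂ T] [OperatorSystem T]

/-- The elements `X* (P ⊗ Q) X` of `M_n(S ⊗ T)`, with `P ∈ M_k(S)⁺`, `Q ∈ M_m(T)⁺` and `X` a
scalar `km × n` matrix. -/
def preMaxCone (n : ℕ) : Set (Matrix (Fin n) (Fin n) (S ⊗[ℂ] T)) :=
  {u | ∃ (k m : ℕ) (P : Matrix (Fin k) (Fin k) S) (Q : Matrix (Fin m) (Fin m) T)
    (X : Matrix (Fin k × Fin m) (Fin n) ℂ),
    P ∈ OperatorSystem.cone k ∧ Q ∈ OperatorSystem.cone m ∧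
      u = scalarConj X (Matrix.kroneckerMap (fun s t => s ⊗ₜ[ℂ] t) P Q)}

/-- The cone `M_n(S ⊗_max T)⁺` of the maximal tensor product: the Archimedeanization of
`preMaxCone`. -/
def maxCone (n : ℕ) : Set (Matrix (Fin n) (Fin n) (S ⊗[ℂ] T)) :=
  {u | ∀ r : ℝ, 0 < r →
    (r : ℂ) • Matrix.diagonal (fun _ => (OperatorSystem.unit : S) ⊗ₜ[ℂ] (OperatorSystem.unit : T))
      + u ∈ preMaxCone S T n}

/-- The cone `M_n(S ⊗_c T)⁺` of the commuting tensor product: those `u` that are sent to positive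
operators by `(φ · ψ)^{(n)}`, `(φ · ψ)(x ⊗ y) = φ(x) ψ(y)`, for all completely positive maps
`φ : S → B(H)` and `ψ : T → B(H)` with commuting ranges. -/
def commCone (n : ℕ) : Set (Matrix (Fin n) (Fin n) (S ⊗[ℂ] T)) :=
  {u | ∀ (H : Type u) [NormedAddCommGroup H] [InnerProductSpace ℂ H] [CompleteSpace H]
    (φ : S →ₗ[ℂ] (H →L[ℂ] H)) (ψ : T →ₗ[ℂ] (H →L[ℂ] H)),
    IsCompletelyPositive φ → IsCompletelyPositive ψ → (∀ x y, Commute (φ x) (ψ y)) →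
    u.map (TensorProduct.lift ((LinearMap.mul ℂ (H →L[ℂ] H)).compl₁₂ φ ψ)) ∈
      (OperatorSystem.cone n : Set (Matrix (Fin n) (Fin n) (H →L[ℂ] H)))}

variable {S} {E : Type u}
  [AddCommGroup E] [Module ℂ E] [StarAddMonoid E] [StarModule ℂ E] [OperatorSystem E]

/-- For an injective envelope `κ : S → E = I(S)`, the cone `M_n(S ⊗_el T)⁺`, given by the inclusion
`S ⊗_el T ⊆ I(S) ⊗_max T`. -/
def elCone (κ : S →ₗ[ℂ] E) (n : ℕ) : Set (Matrix (Fin n) (Fin n) (S ⊗[ℂ] T)) :=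
  {u | u.map (TensorProduct.map κ (LinearMap.id : T →ₗ[ℂ] T)) ∈ maxCone E T n}

/-- `S` is `(el, c)`-nuclear (for the injective envelope `κ : S → I(S)`): for every operator system
`T` the identity of `S ⊗ T` is a complete order isomorphism from `S ⊗_el T` to `S ⊗_c T`. -/
def IsElCommNuclear (κ : S →ₗ[ℂ] E) : Prop :=
  ∀ (T : Type u) [AddCommGroup T] [Module ℂ T] [StarAddMonoid T] [StarModule ℂ T]
    [OperatorSystem T] (n : ℕ), elCone T κ n = commCone S T n

end Tensor

section Commutant

variable {S E : Type u}
  [AddCommGroup S] [Module ℂ S] [StarAddMonoid S] [StarModule ℂ S] [OperatorSystem S]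
  [AddCommGroup E] [Module ℂ E] [StarAddMonoid E] [StarModule ℂ E] [OperatorSystem E]
  {A : Type u} [CStarAlgebra A] [PartialOrder A] [StarOrderedRing A]

/-- For inclusions `κ : S → E` and `ι : S → A` into an operator system and a C*-algebra, there is a
completely positive map `E → S''` fixing `S`, where the double commutant `S''` of `S` is taken
in `A`. -/
def HasDoubleCommutantExpectation (κ : S →ₗ[ℂ] E) (ι : S →ₗ[ℂ] A) : Prop :=
  ∃ φ : E →ₗ[ℂ] A, IsCompletelyPositive φ ∧
    (∀ a, φ a ∈ Set.centralizer (Set.centralizer (Set.range ι))) ∧ ∀ x, φ (κ x) = ι x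

variable (S) in
/-- The double commutant expectation property (DCEP) of an operator system `S`. -/
def HasDCEP : Prop :=
  ∀ (H : Type u) [NormedAddCommGroup H] [InnerProductSpace ℂ H] [CompleteSpace H]
    (ι : S →ₗ[ℂ] (H →L[ℂ] H)), IsInclusion ι → HasDoubleCommutantExpectation ι ι

end Commutant

end

-- Properties (1), (2) and (3) ask for the same expectation with different domains: `B(H)`, `I(S)`,
-- or some injective C*-algebra. All of these are injective, so the embedding of `S` into one
-- extends completely positively to any other system containing `S`. Precomposing with that
-- extension transports the expectation (`HasDoubleCommutantExpectation.of_isInjectiveSystem`).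
-- Property (4) contains (1) because `B(H)` is injective. Conversely, represent the injective
-- C*-algebra `A` faithfully on `K`. A completely positive retraction of `B(K)` onto `A` is an
-- `A`-bimodule map (`retraction_mul`), so it carries the double commutant in `B(K)` into the one in
-- `A`.
--
-- For (5), one inclusion of cones always holds: `c`-positive elements are `el`-positive. If the
-- image of `u` in `B(K) ⊗ T` were not max-positive, a positive functional would separate it.
-- Dilating that functional gives a representation of `B(K)` and a completely positive map of `T`
-- with commuting ranges, and these detect that `u` is not `c`-positive. A completely positive map
-- `B(K) → I(S)` over `S` then finishes (`commCone_subset_elCone`).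
--
-- (2) gives the other inclusion: a commuting pair is a compression of a commuting pair whose first
-- member is an inclusion (`exists_isInclusion_dilation`). The expectation extends that member to
-- `I(S)` without leaving the commutant of the second, and commuting pairs are positive on the
-- maximal tensor product.
--
-- (5) gives (2) by taking `T = S'`. The product map on `S ⊗ S'` is positive for the order inherited
-- from `I(S) ⊗_max S'`, so it extends to some `Ψ` on that space. A multiplicative domain argument
-- makes `Ψ` an `S'`-bimodule map, so `a ↦ Ψ (a ⊗ 1)` takes values in `S''`.
--
-- Two tools carry all this. `IsMatrixOrder.exists_dilation` is a joint GNS and Stinespring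
-- construction. `IsMatrixOrder.exists_extension` is Arveson's theorem for matrix orders that may be
-- neither proper nor Archimedean. That generality serves `preMaxCone`, and also the existence of
-- `I(S)`: a Zorn-maximal matrix order on `B(H)` inducing the given order on `S` yields a map whose
-- averaged powers force it to be idempotent, and its range is the envelope.

universe v w

open scoped ComplexOrder

set_option linter.unusedSectionVars false

noncomputable section

/-! ### Matrix orders without properness, and positive kernels -/

section MatrixOrder

variable {V : Type*} [AddCommGroup V] [Module ℂ V]

theorem scalarConj_apply {ι κ : Type*} [Fintype ι] (X : Matrix ι κ ℂ) (M : Matrix ι ι V) (i j : κ) :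
    scalarConj X M i j = ∑ k, ∑ l, (star (X k i) * X l j) • M k l := rfl

theorem scalarConj_smul {ι κ : Type*} [Fintype ι] (X : Matrix ι κ ℂ) (c : ℂ) (M : Matrix ι ι V) :
    scalarConj X (c • M) = c • scalarConj X M := by
  ext i j
  simp only [scalarConj_apply, Matrix.smul_apply, Finset.smul_sum]
  exact Finset.sum_congr rfl fun k _ => Finset.sum_congr rfl fun l _ => smul_comm _ _ _

theorem scalarConj_map {ι κ W : Type*} [Fintype ι] [AddCommGroup W] [Module ℂ W]
    (X : Matrix ι κ ℂ) (M : Matrix ι ι V) (f : V →ₗ[ℂ] W) :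
    (scalarConj X M).map f = scalarConj X (M.map f) := by
  ext i j
  simp [scalarConj_apply]

theorem scalarConj_scalarConj {ι κ μ : Type*} [Fintype ι] [Fintype κ]
    (X : Matrix ι κ ℂ) (Y : Matrix κ μ ℂ) (M : Matrix ι ι V) :
    scalarConj Y (scalarConj X M) = scalarConj (X * Y) M := by
  ext i j
  simp only [scalarConj_apply, Matrix.mul_apply, star_sum, Finset.sum_mul_sum, Finset.sum_smul,
    Finset.smul_sum, smul_smul]
  calc ∑ a, ∑ b, ∑ k, ∑ l, (star (Y a i) * Y b j * (star (X k a) * X l b)) • M k l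
      = ∑ a, ∑ k, ∑ b, ∑ l, (star (Y a i) * Y b j * (star (X k a) * X l b)) • M k l :=
        Finset.sum_congr rfl fun a _ => Finset.sum_comm
    _ = ∑ k, ∑ a, ∑ b, ∑ l, (star (Y a i) * Y b j * (star (X k a) * X l b)) • M k l :=
        Finset.sum_comm
    _ = ∑ k, ∑ a, ∑ l, ∑ b, (star (Y a i) * Y b j * (star (X k a) * X l b)) • M k l :=
        Finset.sum_congr rfl fun k _ => Finset.sum_congr rfl fun a _ => Finset.sum_comm
    _ = ∑ k, ∑ l, ∑ a, ∑ b, (star (Y a i) * Y b j * (star (X k a) * X l b)) • M k l :=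
        Finset.sum_congr rfl fun k _ => Finset.sum_comm
    _ = _ := by
        refine Finset.sum_congr rfl fun k _ => Finset.sum_congr rfl fun l _ =>
          Finset.sum_congr rfl fun a _ => Finset.sum_congr rfl fun b _ => ?_
        congr 1
        simp only [star_mul']
        ring

theorem submatrix_eq_scalarConj {ι κ : Type*} [Fintype ι] [DecidableEq ι] (f : κ → ι)
    (M : Matrix ι ι V) :
    M.submatrix f f = scalarConj (Matrix.of fun i j => if f j = i then (1 : ℂ) else 0) M := by
  ext i j
  simp [scalarConj_apply, apply_ite]

variable [StarAddMonoid V] [StarModule ℂ V]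

/-- A matrix ordering on a complex `*`-vector space together with a matrix order unit `e`; neither
properness of the cones nor the Archimedean property is required. -/
structure IsMatrixOrder (e : V) (C : (n : ℕ) → Set (Matrix (Fin n) (Fin n) V)) : Prop where
  isHermitian : ∀ {n : ℕ} {M : Matrix (Fin n) (Fin n) V}, M ∈ C n → M.IsHermitian
  zero_mem : ∀ n : ℕ, (0 : Matrix (Fin n) (Fin n) V) ∈ C n
  add_mem : ∀ {n : ℕ} {M N : Matrix (Fin n) (Fin n) V}, M ∈ C n → N ∈ C n → M + N ∈ C n
  smul_mem : ∀ {n : ℕ} {M : Matrix (Fin n) (Fin n) V} (r : ℝ), 0 ≤ r → M ∈ C n →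
    (r : ℂ) • M ∈ C n
  conj_mem : ∀ {n m : ℕ} {M : Matrix (Fin n) (Fin n) V} (X : Matrix (Fin n) (Fin m) ℂ),
    M ∈ C n → scalarConj X M ∈ C m
  exists_bound : ∀ y : V, ∃ r : ℝ, 0 < r ∧ !![(r : ℂ) • e, y; star y, (r : ℂ) • e] ∈ C 2

/-- A matrix over an arbitrary index type is positive if all its finite square submatrices
(with repetitions allowed) are. -/
def PosOn (C : (n : ℕ) → Set (Matrix (Fin n) (Fin n) V)) {ι : Type*} (M : Matrix ι ι V) : Prop :=
  ∀ (n : ℕ) (f : Fin n → ι), M.submatrix f f ∈ C n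

theorem OperatorSystem.isMatrixOrder (V : Type*) [AddCommGroup V] [Module ℂ V] [StarAddMonoid V]
    [StarModule ℂ V] [OperatorSystem V] :
    IsMatrixOrder (OperatorSystem.unit : V) OperatorSystem.cone where
  isHermitian := OperatorSystem.isHermitian_of_mem
  zero_mem := OperatorSystem.zero_mem
  add_mem := OperatorSystem.add_mem
  smul_mem := OperatorSystem.smul_mem
  conj_mem := OperatorSystem.conj_mem
  exists_bound y := by
    obtain ⟨r, hr, h⟩ := OperatorSystem.order_unit (!![0, -y; -star y, 0] : Matrix (Fin 2) (Fin 2) V)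
      (by ext i j; fin_cases i <;> fin_cases j <;> simp)
    refine ⟨r, hr, ?_⟩
    convert h using 1
    ext i j; fin_cases i <;> fin_cases j <;> simp

namespace IsMatrixOrder

variable {e : V} {C : (n : ℕ) → Set (Matrix (Fin n) (Fin n) V)} (hC : IsMatrixOrder e C)
include hC

theorem posOn_iff {n : ℕ} {M : Matrix (Fin n) (Fin n) V} : PosOn C M ↔ M ∈ C n := by
  refine ⟨fun h => h n id, fun h m f => ?_⟩
  rw [submatrix_eq_scalarConj]
  exact hC.conj_mem _ h

theorem posOn_of_equiv {ι : Type*} {n : ℕ} (f : Fin n ≃ ι) {M : Matrix ι ι V}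
    (h : M.submatrix f f ∈ C n) : PosOn C M := by
  intro m g
  have := hC.posOn_iff.mpr h m (f.symm ∘ g)
  convert this using 1
  ext i j; simp

theorem posOn_zero {ι : Type*} : PosOn C (0 : Matrix ι ι V) := fun n _ => hC.zero_mem n

theorem posOn_add {ι : Type*} {M N : Matrix ι ι V} (hM : PosOn C M) (hN : PosOn C N) :
    PosOn C (M + N) := fun n f => hC.add_mem (hM n f) (hN n f)

theorem posOn_sum {ι α : Type*} {M : α → Matrix ι ι V} (s : Finset α)
    (hM : ∀ a ∈ s, PosOn C (M a)) : PosOn C (∑ a ∈ s, M a) :=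
  Finset.sum_induction _ _ (fun _ _ => hC.posOn_add) hC.posOn_zero hM

theorem posOn_smul {ι : Type*} {M : Matrix ι ι V} {r : ℝ} (hr : 0 ≤ r) (hM : PosOn C M) :
    PosOn C ((r : ℂ) • M) := fun n f => hC.smul_mem r hr (hM n f)

theorem posOn_conj {ι κ : Type*} [Fintype ι] (X : Matrix ι κ ℂ) {M : Matrix ι ι V}
    (hM : PosOn C M) : PosOn C (scalarConj X M) := by
  intro n f
  have := hC.conj_mem (X.submatrix (Fintype.equivFin ι).symm f) (hM _ (Fintype.equivFin ι).symm)
  convert this using 1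
  ext i j
  simp only [Matrix.submatrix_apply, scalarConj_apply]
  rw [← (Fintype.equivFin ι).symm.sum_comp]
  exact Finset.sum_congr rfl fun k _ => ((Fintype.equivFin ι).symm.sum_comp _).symm

theorem posOn_isHermitian {ι : Type*} {M : Matrix ι ι V} (hM : PosOn C M) : M.IsHermitian := by
  ext i j
  have := hC.isHermitian (hM 2 ![i, j])
  exact congrFun (congrFun this 0) 1

theorem star_unit : star e = e := by
  obtain ⟨r, hr, h⟩ := hC.exists_bound 0
  have h1 := congrFun (congrFun (hC.isHermitian h) 0) 0
  have h2 : (r : ℂ) • star e = (r : ℂ) • e := by simpa using h1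
  exact smul_right_injective V (by exact_mod_cast hr.ne') h2

theorem posOn_unit : PosOn C (Matrix.of fun _ _ : Unit => e) := by
  obtain ⟨r, hr, h⟩ := hC.exists_bound 0
  have h1 := hC.posOn_smul (inv_nonneg.mpr hr.le) (hC.posOn_iff.mpr h)
  intro n f
  have h2 := h1 n (fun _ => 0)
  convert h2 using 1
  ext i j
  have hr' : (r : ℂ) ≠ 0 := by exact_mod_cast hr.ne'
  simp only [Matrix.of_apply, Matrix.submatrix_apply, Matrix.smul_apply, Matrix.cons_val',
    Matrix.cons_val_zero, Matrix.cons_val_fin_one, smul_smul, Complex.ofReal_inv]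
  rw [inv_mul_cancel₀ hr', one_smul]

theorem posOn_conj_unit {κ : Type*} (c : κ → ℂ) :
    PosOn C (Matrix.of fun i j => (star (c i) * c j) • e) := by
  have := hC.posOn_conj (Matrix.of fun (_ : Unit) j => c j) hC.posOn_unit
  convert this using 1
  ext i j
  simp [scalarConj_apply]

theorem posOn_single_unit {κ : Type*} [DecidableEq κ] (i : κ) :
    PosOn C (Matrix.single i i e) := by
  convert hC.posOn_conj_unit (fun j => if j = i then 1 else 0) using 1
  ext a b
  by_cases ha : a = i <;> by_cases hb : b = i <;> simp [ha, hb, Matrix.single, Ne.symm]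

theorem posOn_diagonal {κ : Type*} [Fintype κ] [DecidableEq κ] (s : κ → ℝ) (hs : ∀ i, 0 ≤ s i) :
    PosOn C (Matrix.diagonal fun i => (s i : ℂ) • e) := by
  have : Matrix.diagonal (fun i => (s i : ℂ) • e) = ∑ i, (s i : ℂ) • Matrix.single i i e := by
    ext a b
    by_cases h : a = b
    · subst h; simp [Matrix.sum_apply, Matrix.single]
    · simp only [Matrix.diagonal_apply, h, Matrix.sum_apply, Matrix.smul_apply, Matrix.single]
      refine (Finset.sum_eq_zero fun i _ => ?_).symm
      rw [Matrix.of_apply, if_neg (fun hh => h (hh.1.symm.trans hh.2)), smul_zero]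
  rw [this]
  exact hC.posOn_sum _ fun i _ => hC.posOn_smul (hs i) (hC.posOn_single_unit i)

/-- The diagonal matrix with entries `e` dominates every hermitian matrix up to a scalar. -/
theorem exists_posOn_add {κ : Type*} [Fintype κ] [DecidableEq κ] (M : Matrix κ κ V)
    (hM : M.IsHermitian) :
    ∃ r : ℝ, 0 < r ∧ PosOn C ((r : ℂ) • Matrix.diagonal (fun _ => e) + M) := by
  classical
  have key : ∀ i j : κ, ∀ y : V, ∃ r : ℝ, 0 ≤ r ∧
      PosOn C ((r : ℂ) • Matrix.diagonal (fun _ => e) +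
        (Matrix.single i j y + Matrix.single j i (star y))) := by
    intro i j y
    obtain ⟨r, hr, h⟩ := hC.exists_bound y
    -- For `i = j` both diagonal entries of the 2 × 2 block land on the same position, hence `2r`;
    -- the diagonal matrix `h2` fills whatever the block leaves uncovered.
    refine ⟨r + r, by positivity, ?_⟩
    have h1 := hC.posOn_conj
      (Matrix.of ![fun k => if k = i then (1 : ℂ) else 0, fun k => if k = j then (1 : ℂ) else 0])
      (hC.posOn_iff.mpr h)
    have h2 := hC.posOn_diagonal (fun k => (r + r) - ((if k = i then r else 0) + (if k = j then r else 0)))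
      (fun k => by split_ifs <;> linarith)
    convert hC.posOn_add h1 h2 using 1
    ext a b
    simp only [Matrix.add_apply, Matrix.smul_apply, Matrix.diagonal_apply, Matrix.single,
      Matrix.of_apply, scalarConj_apply, Fin.sum_univ_two, Matrix.cons_val_zero,
      Matrix.cons_val_one]
    by_cases h1 : a = i <;> by_cases h2 : b = i <;> by_cases h3 : a = j <;> by_cases h4 : b = j <;>
      by_cases h5 : a = b <;> simp_all [eq_comm] <;> module
  choose R hR0 hR using key
  -- A hermitian `M` is the sum over all entries of half the entry plus the adjoint of that half.
  -- The extra `1` keeps the constant positive when `κ` is empty.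
  refine ⟨(∑ i, ∑ j, R i j ((2⁻¹ : ℂ) • M i j)) + 1,
    add_pos_of_nonneg_of_pos (Finset.sum_nonneg fun i _ => Finset.sum_nonneg fun j _ => hR0 _ _ _)
      one_pos, ?_⟩
  have h1 := hC.posOn_sum Finset.univ fun i _ => hC.posOn_sum Finset.univ fun j _ =>
    hR i j ((2⁻¹ : ℂ) • M i j)
  have h2 := hC.posOn_diagonal (κ := κ) (fun _ => 1) (fun _ => zero_le_one)
  convert hC.posOn_add h1 h2 using 1
  have e1 : ∑ i, ∑ j, (Matrix.single i j ((2⁻¹ : ℂ) • M i j)) = (2⁻¹ : ℂ) • M := by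
    conv_rhs => rw [Matrix.matrix_eq_sum_single M]
    simp [Finset.smul_sum, Matrix.smul_single]
  have e2 : ∑ i, ∑ j, (Matrix.single j i (star ((2⁻¹ : ℂ) • M i j))) = (2⁻¹ : ℂ) • M := by
    conv_rhs => rw [Matrix.matrix_eq_sum_single M]
    rw [Finset.sum_comm]
    simp only [Finset.smul_sum, Matrix.smul_single, star_smul]
    refine Finset.sum_congr rfl fun i _ => Finset.sum_congr rfl fun j _ => ?_
    have : star (M j i) = M i j := congrFun (congrFun hM i) j
    rw [this]; simp
  have e3 : M = (2⁻¹ : ℂ) • M + (2⁻¹ : ℂ) • M := by module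
  simp only [Finset.sum_add_distrib, e1, e2, ← e3]
  have e4 : ∑ i, ∑ j, (R i j ((2⁻¹ : ℂ) • M i j) : ℂ) • Matrix.diagonal (fun _ : κ => e)
      = ((∑ i, ∑ j, R i j ((2⁻¹ : ℂ) • M i j) : ℝ) : ℂ) • Matrix.diagonal (fun _ : κ => e) := by
    push_cast
    simp only [Finset.sum_smul]
  rw [e4]
  have e5 : Matrix.diagonal (fun _ : κ => ((1 : ℝ) : ℂ) • e) = Matrix.diagonal (fun _ => e) := by simp
  rw [e5]
  push_cast
  module

end IsMatrixOrder

/-- A kernel on `β` with values in the functionals on `V` is positive for the matrix order `C`. -/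
def IsPosKernel (C : (n : ℕ) → Set (Matrix (Fin n) (Fin n) V)) {β : Type*}
    (k : β → β → V →ₗ[ℂ] ℂ) : Prop :=
  ∀ (m : ℕ) (b : Fin m → β) (Q : Matrix (Fin m) (Fin m) V), Q ∈ C m →
    0 ≤ ∑ p, ∑ q, k (b p) (b q) (Q p q)

theorem IsMatrixOrder.comap {e : V} {C : (n : ℕ) → Set (Matrix (Fin n) (Fin n) V)}
    (hC : IsMatrixOrder e C) {X : Type*} [AddCommGroup X] [Module ℂ X] [StarAddMonoid X]
    [StarModule ℂ X] (j : X →ₗ[ℂ] V) (hj : Function.Injective j)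
    (hjstar : ∀ x, j (star x) = star (j x)) (eX : X) (hje : j eX = e) :
    IsMatrixOrder eX fun n => {Q : Matrix (Fin n) (Fin n) X | Q.map j ∈ C n} where
  isHermitian {n Q} hQ := by
    ext p q
    refine hj ?_
    rw [Matrix.conjTranspose_apply, hjstar]
    exact congrFun (congrFun (hC.isHermitian hQ) p) q
  zero_mem n := by
    have : (0 : Matrix (Fin n) (Fin n) X).map j = 0 := by ext; simp
    simpa [this] using hC.zero_mem n
  add_mem {n M N} hM hN := by
    have : (M + N).map j = M.map j + N.map j := by ext; simp
    simpa [this] using hC.add_mem hM hN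
  smul_mem {n M} r hr hM := by
    have : ((r : ℂ) • M).map j = (r : ℂ) • M.map j := by ext; simp
    change ((r : ℂ) • M).map j ∈ C n
    rw [this]
    exact hC.smul_mem r hr hM
  conj_mem {n m M} X hM := by
    change (scalarConj X M).map j ∈ C m
    rw [scalarConj_map]
    exact hC.conj_mem X hM
  exists_bound y := by
    obtain ⟨r, hr, h⟩ := hC.exists_bound (j y)
    refine ⟨r, hr, ?_⟩
    change Matrix.map _ j ∈ C 2
    convert h using 1
    ext p q; fin_cases p <;> fin_cases q <;> simp [hje, hjstar]

namespace IsPosKernel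

variable {e : V} {C : (n : ℕ) → Set (Matrix (Fin n) (Fin n) V)} {β : Type*}
  {k : β → β → V →ₗ[ℂ] ℂ} (hk : IsPosKernel C k) (hC : IsMatrixOrder e C)
include hk hC

theorem sum_nonneg {ι : Type*} [Fintype ι] (b : ι → β) {Q : Matrix ι ι V} (hQ : PosOn C Q) :
    0 ≤ ∑ p, ∑ q, k (b p) (b q) (Q p q) := by
  let E := (Fintype.equivFin ι).symm
  have h := hk _ (b ∘ E) _ (hQ _ E)
  rw [← E.sum_comp]
  refine h.trans_eq (Finset.sum_congr rfl fun p _ => ?_)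
  exact E.sum_comp fun q => k (b (E p)) (b q) (Q (E p) q)

theorem apply_self_nonneg (b : β) : 0 ≤ k b b e := by
  simpa using hk.sum_nonneg hC (fun _ : Unit => b) hC.posOn_unit

theorem exists_bound (y : V) : ∃ r : ℝ, 0 < r ∧ ∀ b b', 0 ≤ r * k b b e + k b b' y +
    k b' b (star y) + r * k b' b' e := by
  obtain ⟨r, hr, h⟩ := hC.exists_bound y
  refine ⟨r, hr, fun b b' => ?_⟩
  have h1 := hk 2 ![b, b'] _ h
  simpa [Fin.sum_univ_two, add_assoc, Complex.real_smul] using h1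

/-- The value of the kernel on a 2 × 2 bound is real, so the imaginary parts of the two off-diagonal
terms cancel. The same for `I • y` compares the real parts. -/
theorem apply_star (b b' : β) (y : V) : k b' b (star y) = star (k b b' y) := by
  have him : ∀ y, (k b b' y).im + (k b' b (star y)).im = 0 := by
    intro y
    obtain ⟨r, hr, h⟩ := hk.exists_bound hC y
    have h1 := (Complex.nonneg_iff.mp (h b b')).2
    have h2 := (Complex.nonneg_iff.mp (hk.apply_self_nonneg hC b)).2
    have h3 := (Complex.nonneg_iff.mp (hk.apply_self_nonneg hC b')).2
    simp only [Complex.add_im, Complex.im_ofReal_mul, ← h2, ← h3] at h1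
    linarith
  have h1 := him y
  have h2 := him (Complex.I • y)
  rw [star_smul] at h2
  simp only [map_smul, smul_eq_mul, Complex.mul_im, Complex.I_re, Complex.I_im, RCLike.star_def,
    Complex.conj_I, Complex.neg_re, Complex.neg_im] at h2
  apply Complex.ext
  · change _ = (k b b' y).re
    linarith
  · change _ = -(k b b' y).im
    linarith

end IsPosKernel

end MatrixOrder

/-! ### Extension of positive functionals and kernels -/

section Extension

/-- Complex form of the M. Riesz extension theorem: a hermitian functional on a self-adjoint,
cofinal subspace that is nonnegative on the cone extends to a functional nonnegative on the cone. -/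
theorem exists_extension_nonneg_of_cofinal {W X : Type*} [AddCommGroup W] [Module ℂ W]
    [AddCommGroup X] [Module ℂ X] (σ : W →ₗ⋆[ℂ] W) (hσ : ∀ w, σ (σ w) = w) (C : Set W)
    (hC0 : (0 : W) ∈ C) (hCadd : ∀ v ∈ C, ∀ w ∈ C, v + w ∈ C)
    (hCsmul : ∀ r : ℝ, 0 ≤ r → ∀ w ∈ C, (r : ℂ) • w ∈ C) (hCσ : ∀ w ∈ C, σ w = w)
    (i : X →ₗ[ℂ] W) (hi : Function.Injective i) (τ : X → X) (hiτ : ∀ x, i (τ x) = σ (i x))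
    (F : X →ₗ[ℂ] ℂ) (hFτ : ∀ x, F (τ x) = star (F x))
    (hF : ∀ x, τ x = x → i x ∈ C → 0 ≤ (F x).re)
    (hcof : ∀ w, σ w = w → ∃ x, τ x = x ∧ i x + w ∈ C) :
    ∃ G : W →ₗ[ℂ] ℂ, (∀ x, G (i x) = F x) ∧ ∀ w ∈ C, 0 ≤ G w := by
  -- Membership is tested on the hermitian part only. Skew elements then lie in both `s` and `-s`,
  -- so a real functional nonnegative on `s` kills them, and its complexification is real on `C`.
  let s : PointedCone ℝ W :=
    { carrier := {w | w + σ w ∈ C}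
      add_mem' := fun {v w} hv hw => by
        have := hCadd _ hv _ hw
        simp only [Set.mem_ofPred_eq, map_add]
        convert this using 1
        abel
      zero_mem' := by simpa using hC0
      smul_mem' := fun r w hw => by
        have := hCsmul r r.2 _ hw
        have e : r • w = ((r : ℝ) : ℂ) • w := (Complex.coe_smul (r : ℝ) w).symm
        simp only [Set.mem_ofPred_eq, e, map_smulₛₗ, Complex.conj_ofReal, ← smul_add]
        exact this }
  let iR : X →ₗ[ℝ] W := i.restrictScalars ℝ
  let E : X ≃ₗ[ℝ] LinearMap.range iR := LinearEquiv.ofInjective iR hi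
  let f : W →ₗ.[ℝ] ℝ :=
    ⟨LinearMap.range iR, Complex.reLm ∘ₗ (F.restrictScalars ℝ) ∘ₗ E.symm.toLinearMap⟩
  have hfE : ∀ x : X, f (E x) = (F x).re := fun x => by
    change (F (E.symm (E x))).re = _
    rw [LinearEquiv.symm_apply_apply]
  obtain ⟨g, hgf, hg⟩ := riesz_extension s f (fun y hy => by
      obtain ⟨x, rfl⟩ := E.surjective y
      rw [hfE]
      have h1 : i x + σ (i x) ∈ C := hy
      have h2 : i (x + τ x) ∈ C := by rwa [map_add, hiτ]
      have h3 : τ (x + τ x) = x + τ x := hi (by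
        simp only [map_add, hiτ, hσ]; abel)
      have h4 := hF _ h3 h2
      rw [map_add, hFτ, Complex.add_re] at h4
      have h5 : (star (F x)).re = (F x).re := rfl
      linarith) (fun y => by
      obtain ⟨x, hx, hxC⟩ := hcof (y + σ y) (by rw [map_add, hσ, add_comm])
      refine ⟨E ((2⁻¹ : ℂ) • x), ?_⟩
      change (i ((2⁻¹ : ℂ) • x) + y) + σ (i ((2⁻¹ : ℂ) • x) + y) ∈ C
      convert hxC using 1
      have : σ (i x) = i x := by rw [← hiτ, hx]
      simp only [map_add, map_smul, map_smulₛₗ, this, map_inv₀, map_ofNat]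
      module)
  have hg0 : ∀ w, σ w = -w → g w = 0 := fun w hw => by
    have h1 := hg w (by change w + σ w ∈ C; rw [hw, add_neg_cancel]; exact hC0)
    have h2 := hg (-w) (by change -w + σ (-w) ∈ C; rw [map_neg, hw, add_neg_cancel]; exact hC0)
    rw [map_neg] at h2
    linarith
  have hgi : ∀ x, g (i x) = (F x).re := fun x => by
    have := hgf (E x)
    rw [hfE] at this
    exact this
  refine ⟨Module.Dual.extendRCLike (𝕜 := ℂ) g, fun x => ?_, fun w hw => ?_⟩
  · rw [Module.Dual.extendRCLike_apply]
    have h1 : g ((RCLike.I : ℂ) • i x) = -(F x).im := by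
      rw [← map_smul, hgi]; simp
    rw [h1, hgi]
    apply Complex.ext <;> simp
  · rw [Module.Dual.extendRCLike_apply]
    have h1 : g ((RCLike.I : ℂ) • w) = 0 := hg0 _ (by
      rw [map_smulₛₗ, hCσ w hw]; simp)
    have h2 : 0 ≤ g w := hg w (by
      change w + σ w ∈ C; rw [hCσ w hw]; exact hCadd _ hw _ hw)
    rw [h1]
    simpa using h2

variable {V : Type*} [AddCommGroup V] [Module ℂ V] [StarAddMonoid V] [StarModule ℂ V]

/-- The adjoint of square matrices as a conjugate-linear map. -/
def conjTransposeₛₗ (n : ℕ) :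
    Matrix (Fin n) (Fin n) V →ₗ⋆[ℂ] Matrix (Fin n) (Fin n) V where
  toFun M := M.conjTranspose
  map_add' := Matrix.conjTranspose_add
  map_smul' c M := Matrix.conjTranspose_smul c M

/-- A hermitian matrix outside the cone is separated from it by a positive functional. -/
theorem IsMatrixOrder.exists_separating {e : V} {C : (n : ℕ) → Set (Matrix (Fin n) (Fin n) V)}
    (hC : IsMatrixOrder e C) {n : ℕ} {v : Matrix (Fin n) (Fin n) V} (hv : v.IsHermitian)
    (hvC : v ∉ C n) :
    ∃ s : Matrix (Fin n) (Fin n) V →ₗ[ℂ] ℂ, (∀ M ∈ C n, 0 ≤ s M) ∧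
      s (Matrix.diagonal fun _ => e) = 1 ∧ s v ≤ 0 := by
  let U : Matrix (Fin n) (Fin n) V := Matrix.diagonal fun _ => e
  have hU : U.IsHermitian := by
    have := hC.star_unit
    ext i j
    by_cases h : i = j
    · subst h; simp [U, this]
    · simp [U, h, Ne.symm h]
  obtain ⟨r, hr, hrv⟩ := hC.exists_posOn_add v hv
  rw [hC.posOn_iff] at hrv
  -- A negative multiple of the unit in the cone would cancel the `r • U` in `r • U + v` and put `v`
  -- into the cone.
  have hneg : ∀ a : ℝ, a < 0 → (a : ℂ) • U ∉ C n := fun a ha h => by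
    apply hvC
    have := hC.add_mem (hC.smul_mem (r / -a) (div_nonneg hr.le (by linarith)) h) hrv
    convert this using 1
    have ha' : (a : ℂ) ≠ 0 := by exact_mod_cast ha.ne
    rw [smul_smul, ← add_assoc, ← add_smul]
    have : ((r / -a : ℝ) : ℂ) * a + r = 0 := by
      push_cast; field_simp; ring
    rw [this]; simp
  -- The identity functional on the line through `U` is extended relative to the cone generated by
  -- `C n` and `-v`; nonnegativity at `-v` is the separation.
  obtain ⟨G, hG1, hG2⟩ := exists_extension_nonneg_of_cofinal (X := ℂ) (conjTransposeₛₗ n)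
    (fun w => Matrix.conjTranspose_conjTranspose w)
    {w | ∃ c ∈ C n, ∃ t : ℝ, 0 ≤ t ∧ w = c - (t : ℂ) • v}
    ⟨0, hC.zero_mem n, 0, le_rfl, by simp⟩
    (by
      rintro _ ⟨c, hc, t, ht, rfl⟩ _ ⟨c', hc', t', ht', rfl⟩
      exact ⟨c + c', hC.add_mem hc hc', t + t', add_nonneg ht ht', by push_cast; module⟩)
    (by
      rintro r hr _ ⟨c, hc, t, ht, rfl⟩
      exact ⟨(r : ℂ) • c, hC.smul_mem r hr hc, r * t, mul_nonneg hr ht, by push_cast; module⟩)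
    (by
      rintro _ ⟨c, hc, t, ht, rfl⟩
      rw [map_sub, map_smulₛₗ, Complex.conj_ofReal]
      congr 1
      · exact hC.isHermitian hc
      · congr 1)
    (LinearMap.toSpanSingleton ℂ _ U)
    (by
      refine LinearMap.ker_eq_bot.mp (LinearMap.ker_toSpanSingleton ℂ ?_)
      intro h
      refine hneg (-1) (by norm_num) ?_
      rw [h, smul_zero]
      exact hC.zero_mem n)
    star
    (fun c => by
      rw [LinearMap.toSpanSingleton_apply, LinearMap.toSpanSingleton_apply, map_smulₛₗ]
      congr 1
      exact hU.symm)
    LinearMap.id (fun _ => rfl)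
    (by
      rintro c hc ⟨M, hM, t, ht, h⟩
      rw [LinearMap.toSpanSingleton_apply] at h
      by_contra hlt
      push Not at hlt
      have hcr : ((c.re : ℝ) : ℂ) = c := Complex.conj_eq_iff_re.mp hc
      simp only [LinearMap.id_coe, id_eq] at hlt
      rcases ht.eq_or_lt with rfl | htpos
      · refine hneg c.re hlt ?_
        rw [hcr, h]
        simpa using hM
      · apply hvC
        have hM' : (t : ℂ) • v = M + ((-c.re : ℝ) : ℂ) • U := by
          rw [Complex.ofReal_neg, hcr, neg_smul, h]; abel
        have hUC : U ∈ C n := by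
          have := hC.posOn_diagonal (κ := Fin n) (fun _ => 1) (fun _ => zero_le_one)
          rw [hC.posOn_iff] at this
          simpa using this
        have h1 := hC.smul_mem t⁻¹ (inv_nonneg.mpr ht)
          (hC.add_mem hM (hC.smul_mem (-c.re) (by linarith) hUC))
        rw [← hM', smul_smul] at h1
        have ht' : (t : ℂ) ≠ 0 := by exact_mod_cast htpos.ne'
        rwa [Complex.ofReal_inv, inv_mul_cancel₀ ht', one_smul] at h1)
    (by
      intro w hw
      obtain ⟨r, hr, h⟩ := hC.exists_posOn_add w hw
      rw [hC.posOn_iff] at h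
      exact ⟨(r : ℂ), Complex.conj_ofReal r, _, h, 0, le_rfl, by simp [U]⟩)
  refine ⟨G, fun M hM => hG2 M ⟨M, hM, 0, le_rfl, by simp⟩, ?_, ?_⟩
  · have := hG1 1
    simpa [U] using this
  · have := hG2 (-v) ⟨0, hC.zero_mem n, 1, zero_le_one, by simp⟩
    rw [map_neg] at this
    exact neg_nonneg.mp this

/-- The adjoint of finitely supported matrices as a conjugate-linear map. -/
def finsuppConjTranspose (β V : Type*) [AddCommGroup V] [Module ℂ V] [StarAddMonoid V]
    [StarModule ℂ V] : (β × β →₀ V) →ₗ⋆[ℂ] (β × β →₀ V) where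
  toFun w := (w.mapRange star (star_zero V)).equivMapDomain (Equiv.prodComm β β)
  map_add' v w := by ext p; simp [Finsupp.equivMapDomain_apply]
  map_smul' c w := by ext p; simp [Finsupp.equivMapDomain_apply]

theorem finsuppConjTranspose_apply {β : Type*} (w : β × β →₀ V) (b b' : β) :
    finsuppConjTranspose β V w (b, b') = star (w (b', b)) := rfl

theorem finsuppConjTranspose_single {β : Type*} (b b' : β) (y : V) :
    finsuppConjTranspose β V (Finsupp.single (b, b') y) = Finsupp.single (b', b) (star y) := by
  simp [finsuppConjTranspose, Finsupp.equivMapDomain_single]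

theorem finsupp_sum_eq_sum_sum {β X : Type*} [AddCommGroup X] (w : β × β →₀ X)
    (F : Finset β) (hF : ∀ p ∈ w.support, p.1 ∈ F ∧ p.2 ∈ F) (k : β → β → X → ℂ)
    (hk : ∀ b b', k b b' 0 = 0) :
    (w.sum fun p x => k p.1 p.2 x) = ∑ a : F, ∑ a' : F, k a a' (w (a, a')) := by
  rw [Finsupp.sum_of_support_subset w (s := F ×ˢ F) (fun p hp => by simpa using hF p hp) _
    (fun p _ => hk _ _), Finset.sum_product]
  rw [← Finset.sum_coe_sort]
  exact Finset.sum_congr rfl fun a _ => (Finset.sum_coe_sort F _).symm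

/-- Positive kernels extend from a cofinal self-adjoint subspace. -/
theorem IsMatrixOrder.exists_kernel_extension {e : V}
    {C : (n : ℕ) → Set (Matrix (Fin n) (Fin n) V)} (hC : IsMatrixOrder e C)
    {X : Type*} [AddCommGroup X] [Module ℂ X] [StarAddMonoid X] [StarModule ℂ X]
    (j : X →ₗ[ℂ] V) (hj : Function.Injective j) (hjstar : ∀ x, j (star x) = star (j x))
    (eX : X) (hje : j eX = e) {β : Type*} (k : β → β → X →ₗ[ℂ] ℂ)
    (hk : ∀ (m : ℕ) (b : Fin m → β) (Q : Matrix (Fin m) (Fin m) X), Q.map j ∈ C m →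
      0 ≤ ∑ p, ∑ q, k (b p) (b q) (Q p q)) :
    ∃ k' : β → β → V →ₗ[ℂ] ℂ, IsPosKernel C k' ∧ ∀ b b' x, k' b b' (j x) = k b b' x := by
  classical
  have hkstar : ∀ b b' x, k b' b (star x) = star (k b b' x) :=
    IsPosKernel.apply_star hk (hC.comap j hj hjstar eX hje)
  -- The whole kernel is encoded as one functional on finitely supported `β × β` matrices, so a
  -- single scalar extension extends all entries at once.
  let F : (β × β →₀ X) →ₗ[ℂ] ℂ := Finsupp.lsum ℂ fun p => k p.1 p.2
  have hF : ∀ w, F w = w.sum fun p x => k p.1 p.2 x := fun w => rfl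
  let i : (β × β →₀ X) →ₗ[ℂ] (β × β →₀ V) := Finsupp.mapRange.linearMap j
  let mat : (β × β →₀ V) → Matrix β β V := fun w => Matrix.of fun b b' => w (b, b')
  obtain ⟨G, hG1, hG2⟩ := exists_extension_nonneg_of_cofinal (finsuppConjTranspose β V)
    (fun w => by ext ⟨b, b'⟩; simp [finsuppConjTranspose_apply])
    {w | PosOn C (mat w)} hC.posOn_zero (fun v hv w hw => hC.posOn_add hv hw)
    (fun r hr w hw => hC.posOn_smul hr hw)
    (fun w hw => by
      ext ⟨b, b'⟩
      exact congrFun (congrFun (hC.posOn_isHermitian hw) b) b')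
    i (Finsupp.mapRange_injective j (map_zero j) hj) (finsuppConjTranspose β X)
    (fun w => by
      ext ⟨b, b'⟩
      simp [finsuppConjTranspose_apply, i, hjstar])
    F
    (fun w => by
      induction w using Finsupp.induction_linear with
      | zero => simp
      | add v w hv hw => rw [map_add, map_add, map_add, hv, hw, star_add]
      | single p x =>
        obtain ⟨b, b'⟩ := p
        rw [finsuppConjTranspose_single]
        simp [F, hkstar])
    (fun w _ hw => by
      let A : Finset β := w.support.image Prod.fst ∪ w.support.image Prod.snd
      have hA : ∀ p ∈ w.support, p.1 ∈ A ∧ p.2 ∈ A := fun p hp =>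
        ⟨Finset.mem_union_left _ (Finset.mem_image_of_mem _ hp),
          Finset.mem_union_right _ (Finset.mem_image_of_mem _ hp)⟩
      rw [hF, finsupp_sum_eq_sum_sum w A hA (fun b b' x => k b b' x) (fun _ _ => map_zero _)]
      let E := (Fintype.equivFin A).symm
      have h1 := hk _ (fun p => (E p : β)) (Matrix.of fun p q => w (E p, E q)) (by
        have := hw _ (fun p => (E p : β))
        convert this using 1
        ext p q
        simp [mat, i])
      rw [← E.sum_comp]
      have h2 : ∀ p, ∑ a' : A, k (E p) a' (w (E p, a')) = ∑ q, k (E p) (E q) (w (E p, E q)) :=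
        fun p => (E.sum_comp _).symm
      simp only [h2]
      exact (Complex.nonneg_iff.mp h1).1)
    (fun w hw => by
      let A : Finset β := w.support.image Prod.fst ∪ w.support.image Prod.snd
      have hA : ∀ p ∈ w.support, p.1 ∈ A ∧ p.2 ∈ A := fun p hp =>
        ⟨Finset.mem_union_left _ (Finset.mem_image_of_mem _ hp),
          Finset.mem_union_right _ (Finset.mem_image_of_mem _ hp)⟩
      obtain ⟨r, hr, h⟩ := hC.exists_posOn_add (Matrix.of fun a a' : A => w (a, a')) (by
        ext a a'
        exact DFunLike.congr_fun hw ((a : β), (a' : β)))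
      -- Cofinality: a multiple of the unit on the diagonal over the finite set of indices that
      -- occur in `w` dominates `w`.
      refine ⟨∑ a ∈ A, Finsupp.single (a, a) ((r : ℂ) • eX), ?_, ?_⟩
      · have heX : star eX = eX := hj (by rw [hjstar, hje, hC.star_unit])
        rw [map_sum]
        refine Finset.sum_congr rfl fun a _ => ?_
        rw [finsuppConjTranspose_single, star_smul, heX]
        simp
      · have h2 := hC.posOn_conj (Matrix.of fun (a : A) (b : β) => if (a : β) = b then (1 : ℂ) else 0) h
        change PosOn C (mat _)
        convert h2 using 1
        ext b b'
        have e1 : ∀ M : Matrix A A V, scalarConj (Matrix.of fun (a : A) (b : β) =>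
            if (a : β) = b then (1 : ℂ) else 0) M b b' =
            if h : b ∈ A ∧ b' ∈ A then M ⟨b, h.1⟩ ⟨b', h.2⟩ else 0 := by
          intro M
          rw [scalarConj_apply]
          split_ifs with h
          · rw [Finset.sum_eq_single ⟨b, h.1⟩, Finset.sum_eq_single ⟨b', h.2⟩]
            · simp
            · intro a _ ha
              have : (a : β) ≠ b' := fun hh => ha (Subtype.ext hh)
              simp [this]
            · simp
            · intro a _ ha
              have : (a : β) ≠ b := fun hh => ha (Subtype.ext hh)
              simp [this]
            · simp
          · refine Finset.sum_eq_zero fun a _ => Finset.sum_eq_zero fun a' _ => ?_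
            have : ¬ ((a : β) = b ∧ (a' : β) = b') := fun hh => h ⟨hh.1 ▸ a.2, hh.2 ▸ a'.2⟩
            by_cases h1 : (a : β) = b
            · have h2 : (a' : β) ≠ b' := fun hh => this ⟨h1, hh⟩
              simp [h2]
            · simp [h1]
        rw [e1]
        have e2 : i (∑ a ∈ A, Finsupp.single (a, a) ((r : ℂ) • eX)) (b, b')
            = if b = b' ∧ b ∈ A then (r : ℂ) • e else 0 := by
          simp only [map_sum, i, Finsupp.mapRange.linearMap_apply, Finsupp.mapRange_single,
            map_smul, hje, Finsupp.coe_finsetSum, Finset.sum_apply, Finsupp.single_apply,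
            Prod.mk.injEq]
          by_cases hb : b = b'
          · subst hb; simp
          · have : ∀ a, ¬ (a = b ∧ a = b') := fun a ha => hb (ha.1.symm.trans ha.2)
            simp [this, hb]
        change i _ (b, b') + w (b, b') = _
        rw [e2]
        by_cases hbA : b ∈ A ∧ b' ∈ A
        · by_cases hb : b = b'
          · subst hb; simp [hbA.1]
          · simp [hb, hbA]
        · rw [dif_neg hbA]
          have h3 : w (b, b') = 0 := by
            by_contra hne
            exact hbA (hA _ (Finsupp.mem_support_iff.mpr hne))
          have h4 : ¬ (b = b' ∧ b ∈ A) := fun hh => hbA ⟨hh.2, hh.1 ▸ hh.2⟩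
          rw [h3, if_neg h4, add_zero])
  refine ⟨fun b b' => G ∘ₗ Finsupp.lsingle (b, b'), fun m b Q hQ => ?_, fun b b' x => ?_⟩
  · have h1 := hG2 (∑ p, ∑ q, Finsupp.single (b p, b q) (Q p q)) (by
      have h2 := hC.posOn_conj (Matrix.of fun (p : Fin m) (x : β) => if b p = x then (1 : ℂ) else 0)
        (hC.posOn_iff.mpr hQ)
      change PosOn C (mat _)
      convert h2 using 1
      ext x y
      simp only [mat, Matrix.of_apply, scalarConj_apply, Finsupp.coe_finsetSum, Finset.sum_apply,
        Finsupp.single_apply, Prod.mk.injEq]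
      refine Finset.sum_congr rfl fun p _ => Finset.sum_congr rfl fun q _ => ?_
      by_cases hp : b p = x <;> by_cases hq : b q = y <;> simp [hp, hq])
    simpa [map_sum] using h1
  · have := hG1 (Finsupp.single (b, b') x)
    simpa [i, F] using this

end Extension

/-! ### Positive operator matrices -/

section Operators

variable {H : Type*} [NormedAddCommGroup H] [InnerProductSpace ℂ H] [CompleteSpace H]

theorem complex_inner_self_nonneg {H : Type*} [SeminormedAddCommGroup H] [InnerProductSpace ℂ H]
    (x : H) : (0 : ℂ) ≤ inner ℂ x x :=
  Complex.nonneg_iff.mpr ⟨inner_self_nonneg (𝕜 := ℂ), (inner_self_im (𝕜 := ℂ) x).symm⟩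

theorem sum_inner_star_mul_self {n : ℕ} (N : Matrix (Fin n) (Fin n) (H →L[ℂ] H)) (v w : Fin n → H) :
    ∑ p, ∑ q, inner ℂ (v p) ((∑ r, star (N r p) * N r q) (w q)) =
      ∑ r, inner ℂ (∑ p, N r p (v p)) (∑ q, N r q (w q)) := by
  simp only [sum_inner, inner_sum, sum_apply, mul_apply_eq_comp,
    ContinuousLinearMap.star_eq_adjoint, ContinuousLinearMap.adjoint_inner_right]
  calc ∑ p, ∑ q, ∑ r, inner ℂ (N r p (v p)) (N r q (w q))
      = ∑ p, ∑ r, ∑ q, inner ℂ (N r p (v p)) (N r q (w q)) :=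
        Finset.sum_congr rfl fun p _ => Finset.sum_comm
    _ = ∑ r, ∑ p, ∑ q, inner ℂ (N r p (v p)) (N r q (w q)) := Finset.sum_comm
    _ = _ := Finset.sum_congr rfl fun p _ => Finset.sum_comm

/-- The square root is given by functional calculus, so it commutes with everything that `b`
commutes with. -/
theorem exists_star_mul_self_commute {B : Type*} [CStarAlgebra B] [PartialOrder B]
    [StarOrderedRing B] {b : B} (hb : 0 ≤ b) :
    ∃ c, b = star c * c ∧ ∀ d, Commute b d → Commute c d := by
  refine ⟨CFC.sqrt b, ?_, fun d hd => hd.cfcₙ_nnreal _⟩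
  rw [(IsSelfAdjoint.of_nonneg (CFC.sqrt_nonneg b)).star_eq, CFC.sqrt_mul_sqrt_self b]

/-- Take the negative part of `a`: it annihilates the positive part, and its cube vanishes only if
it vanishes itself. Positivity of `a` is thus tested on one compression. -/
theorem exists_negPart {B : Type*} [CStarAlgebra B] [PartialOrder B]
    [StarOrderedRing B] {a : B} (ha : IsSelfAdjoint a) :
    ∃ b, 0 ≤ b ∧ b * a * b = -(b * b * b) ∧ (b * b * b = 0 → 0 ≤ a) := by
  have hb : 0 ≤ a⁻ := CFC.negPart_nonneg a
  refine ⟨a⁻, hb, ?_, fun h => ?_⟩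
  · nth_rewrite 2 [← CFC.posPart_sub_negPart a]
    rw [mul_sub, CFC.negPart_mul_posPart, zero_sub, neg_mul]
  · rw [← CFC.negPart_eq_zero_iff a]
    have hs : star a⁻ = a⁻ := IsSelfAdjoint.of_nonneg hb
    have h1 : star (a⁻ * a⁻) * (a⁻ * a⁻) = 0 := by
      rw [star_mul, hs, ← mul_assoc, h, zero_mul]
    have h2 : star a⁻ * a⁻ = 0 := by
      rw [hs]; exact CStarRing.star_mul_self_eq_zero_iff _ |>.mp h1
    exact CStarRing.star_mul_self_eq_zero_iff _ |>.mp h2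

/-- The square root in `M_n(A)` commutes with the diagonal matrix of `c` whenever `M` does, and
entrywise this says that the entries of the root commute with `c`. -/
theorem cone_exists_star_mul {A : Type*} [CStarAlgebra A] [PartialOrder A] [StarOrderedRing A]
    {n : ℕ} {M : Matrix (Fin n) (Fin n) A} (hM : M ∈ OperatorSystem.cone n) :
    ∃ R : Matrix (Fin n) (Fin n) A, (∀ p q, M p q = ∑ r, star (R r p) * R r q) ∧
      ∀ c : A, (∀ p q, Commute (M p q) c) → ∀ p q, Commute (R p q) c := by
  have hM' : 0 ≤ CStarMatrix.ofMatrix M := hM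
  obtain ⟨N, hN, hNc⟩ := exists_star_mul_self_commute hM'
  refine ⟨CStarMatrix.ofMatrix.symm N, fun p q => ?_, fun c hc p q => ?_⟩
  · have h4 := congrFun (congrFun hN p) q
    rw [CStarMatrix.mul_apply] at h4
    simpa [CStarMatrix.star_apply] using h4
  · let D : CStarMatrix (Fin n) (Fin n) A := CStarMatrix.ofMatrix (Matrix.diagonal fun _ => c)
    have hD : Commute (CStarMatrix.ofMatrix M) D := by
      ext i j
      simp only [CStarMatrix.mul_apply, D, CStarMatrix.ofMatrix_apply, Matrix.diagonal_apply]
      simpa using (hc i j).eq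
    have h2 := congrFun (congrFun (hNc D hD) p) q
    simp only [CStarMatrix.mul_apply, D, CStarMatrix.ofMatrix_apply, Matrix.diagonal_apply] at h2
    simpa [Commute, SemiconjBy] using h2

/-- `R` may be rectangular: each of its rows, padded by zeros to a square matrix, contributes one
term `star P * P`. -/
theorem mem_cone_of_star_mul {A : Type*} [CStarAlgebra A] [PartialOrder A] [StarOrderedRing A]
    {n : ℕ} {ι : Type*} [Fintype ι] (R : Matrix ι (Fin n) A) :
    (Matrix.of fun p q => ∑ r, star (R r p) * R r q) ∈ OperatorSystem.cone n := by
  rcases n with _ | n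
  · convert OperatorSystem.zero_mem (V := A) 0
    ext i
    exact i.elim0
  let P : ι → CStarMatrix (Fin (n + 1)) (Fin (n + 1)) A := fun k =>
    CStarMatrix.ofMatrix (Matrix.of fun i j => if i = 0 then R k j else 0)
  have h : (Matrix.of fun p q => ∑ r, star (R r p) * R r q)
      = ∑ r, CStarMatrix.ofMatrix.symm (star (P r) * P r) := by
    ext i j
    rw [Matrix.sum_apply]
    refine Finset.sum_congr rfl fun r _ => ?_
    rw [CStarMatrix.ofMatrix_symm_apply, CStarMatrix.mul_apply]
    simp [P, CStarMatrix.star_apply]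
  rw [h]
  refine Finset.sum_induction _ (· ∈ OperatorSystem.cone (V := A) (n + 1))
    (fun _ _ => OperatorSystem.add_mem) (OperatorSystem.zero_mem _) fun r _ => ?_
  exact star_mul_self_nonneg (P r)

theorem sum_inner_nonneg_of_mem_cone {n : ℕ} {M : Matrix (Fin n) (Fin n) (H →L[ℂ] H)}
    (hM : M ∈ OperatorSystem.cone n) (v : Fin n → H) :
    0 ≤ ∑ p, ∑ q, inner ℂ (v p) (M p q (v q)) := by
  obtain ⟨R, hR, -⟩ := cone_exists_star_mul hM
  simp only [hR]
  rw [sum_inner_star_mul_self]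
  exact Finset.sum_nonneg fun r _ => complex_inner_self_nonneg _

/-- Positivity of operator matrices in terms of the quadratic form. -/
theorem mem_cone_iff_sum_inner_nonneg {n : ℕ} {M : Matrix (Fin n) (Fin n) (H →L[ℂ] H)} :
    M ∈ OperatorSystem.cone n ↔ ∀ v : Fin n → H, 0 ≤ ∑ p, ∑ q, inner ℂ (v p) (M p q (v q)) := by
  refine ⟨sum_inner_nonneg_of_mem_cone, fun h => ?_⟩
  -- `T` serves only to obtain hermiticity of `M`: a complex operator with real quadratic form is
  -- symmetric.
  let T : PiLp 2 (fun _ : Fin n => H) →ₗ[ℂ] PiLp 2 (fun _ : Fin n => H) :=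
    { toFun := fun v => WithLp.toLp 2 fun p => ∑ q, M p q (v q)
      map_add' := fun v w => by ext p; simp [Finset.sum_add_distrib]
      map_smul' := fun c v => by ext p; simp [Finset.smul_sum] }
  have hTv : ∀ v w, inner ℂ v (T w) = ∑ p, ∑ q, inner ℂ (v p) (M p q (w q)) := fun v w => by
    rw [PiLp.inner_apply]
    simp [T, inner_sum]
  have hT : T.IsSymmetric := by
    refine LinearMap.IsPositive.isSymmetric ((LinearMap.isPositive_iff_complex T).mpr fun v => ?_)
    have h1 := h v
    rw [← hTv, ← inner_conj_symm] at h1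
    have h2 : 0 ≤ inner ℂ (T v) v := by simpa using star_nonneg_iff.mpr h1
    rw [Complex.nonneg_iff] at h2
    exact ⟨Complex.ext rfl (by simpa using h2.2), h2.1⟩
  have hM : M.IsHermitian := by
    refine Matrix.ext fun p q => ?_
    change star (M q p) = M p q
    ext x
    refine ext_inner_left ℂ fun y => ?_
    have h1 := hT (WithLp.toLp 2 (Pi.single p y)) (WithLp.toLp 2 (Pi.single q x))
    rw [← inner_conj_symm, hTv, hTv, Finset.sum_eq_single q, Finset.sum_eq_single p,
      Finset.sum_eq_single p, Finset.sum_eq_single q] at h1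
    · rw [ContinuousLinearMap.star_eq_adjoint, ContinuousLinearMap.adjoint_inner_right, ← inner_conj_symm]
      simpa using h1
    all_goals simp +contextual [Pi.single_apply]
  obtain ⟨b, hb, hbab, hb0⟩ := exists_negPart (a := CStarMatrix.ofMatrix M) hM
  refine hb0 ?_
  have hbs : star b = b := IsSelfAdjoint.of_nonneg hb
  have hbbb : 0 ≤ b * b * b := by
    have := star_left_conjugate_nonneg hb b
    rwa [hbs] at this
  obtain ⟨c, hc, -⟩ := exists_star_mul_self_commute hbbb
  have hbe : ∀ p q, star (b p q) = b q p := fun p q => by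
    have := congrFun (congrFun hbs q) p
    rwa [CStarMatrix.star_apply] at this
  have hform : ∀ v : Fin n → H, ∑ p, ∑ q, inner ℂ (v p) ((b * CStarMatrix.ofMatrix M * b) p q (v q))
      = ∑ r, ∑ s, inner ℂ (∑ p, b r p (v p)) (M r s (∑ q, b s q (v q))) := fun v => by
    have h1 : ∀ p q, inner ℂ (v p) ((b * CStarMatrix.ofMatrix M * b) p q (v q)) =
        ∑ r, ∑ s, inner ℂ (b r p (v p)) (M r s (b s q (v q))) := fun p q => by
      simp only [CStarMatrix.mul_apply, sum_apply, mul_apply_eq_comp, inner_sum,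
        CStarMatrix.ofMatrix_apply]
      rw [Finset.sum_comm]
      refine Finset.sum_congr rfl fun r _ => Finset.sum_congr rfl fun s _ => ?_
      exact (hbe r p) ▸ ContinuousLinearMap.adjoint_inner_right (b r p) _ _
    simp only [h1, map_sum, sum_inner, inner_sum]
    calc _ = ∑ p, ∑ r, ∑ q, ∑ s, inner ℂ (b r p (v p)) (M r s (b s q (v q))) :=
          Finset.sum_congr rfl fun p _ => Finset.sum_comm
      _ = ∑ r, ∑ p, ∑ q, ∑ s, inner ℂ (b r p (v p)) (M r s (b s q (v q))) := Finset.sum_comm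
      _ = ∑ r, ∑ p, ∑ s, ∑ q, inner ℂ (b r p (v p)) (M r s (b s q (v q))) :=
          Finset.sum_congr rfl fun r _ => Finset.sum_congr rfl fun p _ => Finset.sum_comm
      _ = ∑ r, ∑ s, ∑ p, ∑ q, inner ℂ (b r p (v p)) (M r s (b s q (v q))) :=
          Finset.sum_congr rfl fun r _ => Finset.sum_comm
      _ = _ := Finset.sum_congr rfl fun r _ => Finset.sum_congr rfl fun s _ => Finset.sum_comm
  -- The form of `b M b = -b³` is nonnegative since that of `M` is, and nonpositive since `b³` is
  -- positive. It vanishes, and `c` is a root of `b³`.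
  have hcv : ∀ (v : Fin n → H) r, ∑ p, c r p (v p) = 0 := fun v => by
    have h1 := sum_inner_star_mul_self (CStarMatrix.ofMatrix.symm c) v v
    have h2 : ∀ p q, ∑ r, star (c r p) * c r q = (b * b * b) p q := fun p q => by
      rw [hc, CStarMatrix.mul_apply]; simp [CStarMatrix.star_apply]
    have h3 : (b * b * b) = -(b * CStarMatrix.ofMatrix M * b) := by rw [hbab, neg_neg]
    simp only [CStarMatrix.ofMatrix_symm_apply, h2, h3, CStarMatrix.neg_apply, neg_apply,
      inner_neg_right, Finset.sum_neg_distrib, hform] at h1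
    have h4 := h fun r => ∑ p, b r p (v p)
    have h5 : ∀ r, (0 : ℂ) ≤ inner ℂ (∑ p, c r p (v p)) (∑ q, c r q (v q)) := fun r =>
      complex_inner_self_nonneg _
    have h6 : ∑ r, inner ℂ (∑ p, c r p (v p)) (∑ q, c r q (v q)) = 0 :=
      le_antisymm (h1 ▸ neg_nonpos.mpr h4) (Finset.sum_nonneg fun r _ => h5 r)
    intro r
    have h7 := (Finset.sum_eq_zero_iff_of_nonneg fun r _ => h5 r).mp h6 r (Finset.mem_univ r)
    exact inner_self_eq_zero.mp h7
  have hc0 : c = 0 := by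
    ext r p x
    have := hcv (Pi.single p x) r
    rw [Finset.sum_eq_single p] at this
    · simpa using this
    all_goals simp +contextual
  rw [hc, hc0, mul_zero]

end Operators

/-! ### Kolmogorov decomposition and simultaneous dilation -/

section Dilation

theorem eq_of_forall_inner_denseRange {E K : Type*} [NormedAddCommGroup K] [InnerProductSpace ℂ K]
    {J : E → K} (hJ : DenseRange J) {x y : K} (h : ∀ v, inner ℂ (J v) x = inner ℂ (J v) y) :
    x = y := by
  refine ext_inner_left ℂ fun w => ?_
  have : (fun w : K => inner ℂ w x) = fun w => inner ℂ w y :=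
    hJ.equalizer (by fun_prop) (by fun_prop) (funext h)
  exact congrFun this w

/-- A sesquilinear form on a dense subspace that is bounded in norm comes from an operator. -/
theorem exists_clm_of_form {E K : Type*} [AddCommGroup E] [Module ℂ E] [NormedAddCommGroup K]
    [InnerProductSpace ℂ K] [CompleteSpace K] (J : E →ₗ[ℂ] K) (hJ : DenseRange J)
    (B : E →ₗ⋆[ℂ] E →ₗ[ℂ] ℂ) (c : ℝ) (hc : 0 ≤ c) (hB : ∀ x y, ‖B x y‖ ≤ c * ‖J x‖ * ‖J y‖) :
    ∃ T : K →L[ℂ] K, ∀ x y, inner ℂ (J x) (T (J y)) = B x y := by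
  have key : ∀ y, ∃ u : K, (∀ x, inner ℂ (J x) u = B x y) ∧ ‖u‖ ≤ c * ‖J y‖ := by
    intro y
    let f : E →ₗ[ℂ] ℂ :=
      { toFun := fun x => star (B x y)
        map_add' := fun x x' => by simp
        map_smul' := fun a x => by simp }
    have hf : ∀ x, ‖f x‖ ≤ (c * ‖J y‖) * ‖J x‖ := fun x => by
      have := hB x y
      change ‖star (B x y)‖ ≤ _
      rw [norm_star]; linarith
    refine ⟨(InnerProductSpace.toDual ℂ K).symm (f.extendOfNorm J), fun x => ?_, ?_⟩
    · rw [← inner_conj_symm, InnerProductSpace.toDual_symm_apply,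
        LinearMap.extendOfNorm_eq hJ ⟨_, hf⟩]
      exact star_star (B x y)
    · rw [LinearIsometryEquiv.norm_map]
      exact LinearMap.opNorm_extendOfNorm_le hJ (by positivity) hf
  choose U hU hUn using key
  let Ul : E →ₗ[ℂ] K :=
    { toFun := U
      map_add' := fun y y' => eq_of_forall_inner_denseRange hJ fun x => by
        rw [inner_add_right, hU, hU, hU, map_add]
      map_smul' := fun a y => eq_of_forall_inner_denseRange hJ fun x => by
        rw [RingHom.id_apply, inner_smul_right, hU, hU, map_smul, smul_eq_mul] }
  refine ⟨Ul.extendOfNorm J, fun x y => ?_⟩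
  rw [LinearMap.extendOfNorm_eq hJ ⟨c, hUn⟩]
  exact hU y x

/-- Hausdorff completion of a positive semidefinite sesquilinear form. -/
theorem exists_completion_of_form {E : Type u} [AddCommGroup E] [Module ℂ E]
    (B : E →ₗ⋆[ℂ] E →ₗ[ℂ] ℂ) (hBs : ∀ x y, B y x = star (B x y)) (hB : ∀ x, 0 ≤ B x x) :
    ∃ (K : Type u) (_ : NormedAddCommGroup K) (_ : InnerProductSpace ℂ K) (_ : CompleteSpace K)
      (J : E →ₗ[ℂ] K), DenseRange J ∧ ∀ x y, inner ℂ (J x) (J y) = B x y := by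
  let c : PreInnerProductSpace.Core ℂ E :=
    { inner := fun x y => B x y
      conj_inner_symm := fun x y => by rw [hBs x y]; exact star_star _
      re_inner_nonneg := fun x => (Complex.nonneg_iff.mp (hB x)).1
      add_left := fun x y z => by simp
      smul_left := fun x y r => by simp }
  let : SeminormedAddCommGroup E := InnerProductSpace.Core.toSeminormedAddCommGroup (c := c)
  let : InnerProductSpace ℂ E := InnerProductSpace.ofCore c
  refine ⟨UniformSpace.Completion E, inferInstance, inferInstance, inferInstance,
    (UniformSpace.Completion.toComplL (𝕜 := ℂ) (E := E)).toLinearMap,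
    UniformSpace.Completion.denseRange_coe, fun x y => ?_⟩
  exact UniformSpace.Completion.inner_coe x y

/-- A Cauchy–Schwarz argument: along `c = -t * star z` the hypothesis is a real quadratic in `t`,
whose discriminant is nonpositive. -/
theorem norm_le_of_forall_quadratic_nonneg {z : ℂ} {r a b : ℝ} (hr : 0 ≤ r) (ha : 0 ≤ a)
    (hb : 0 ≤ b) (h : ∀ c : ℂ, 0 ≤ r * a ^ 2 + 2 * (c * z).re + r * (‖c‖ ^ 2 * b ^ 2)) :
    ‖z‖ ≤ r * a * b := by
  by_cases hz : z = 0
  · subst hz; simp; positivity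
  have hz' : 0 < ‖z‖ := norm_pos_iff.mpr hz
  have key : ∀ t : ℝ, 0 ≤ (r * b ^ 2 * ‖z‖ ^ 2) * (t * t) + (-2 * ‖z‖ ^ 2) * t + r * a ^ 2 := by
    intro t
    have h1 := h (-t * star z)
    have h2 : ((-t * star z) * z : ℂ) = ((-t * ‖z‖ ^ 2 : ℝ) : ℂ) := by
      rw [mul_assoc, RCLike.star_def, Complex.conj_mul']; push_cast; ring
    have h3 : ‖(-t * star z : ℂ)‖ ^ 2 = t ^ 2 * ‖z‖ ^ 2 := by
      rw [norm_mul, mul_pow, norm_star, norm_neg, Complex.norm_real, Real.norm_eq_abs, sq_abs]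
    rw [h2, h3, Complex.ofReal_re] at h1
    nlinarith
  have h4 := discrim_le_zero key
  rw [discrim] at h4
  have h5 : ‖z‖ ^ 2 * (‖z‖ ^ 2 - (r * a * b) ^ 2) ≤ 0 := by nlinarith
  have h6 : ‖z‖ ^ 2 ≤ (r * a * b) ^ 2 := by
    have : 0 < ‖z‖ ^ 2 := by positivity
    nlinarith
  exact (sq_le_sq₀ hz'.le (by positivity)).mp h6

variable {T : Type*} [AddCommGroup T] [Module ℂ T] [StarAddMonoid T] [StarModule ℂ T]

/-- A linear map into an operator system sends the given matrix cones to positive matrices. -/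
def IsMatrixPositive (C : (n : ℕ) → Set (Matrix (Fin n) (Fin n) T)) {W : Type*} [AddCommGroup W]
    [Module ℂ W] [StarAddMonoid W] [StarModule ℂ W] [OperatorSystem W] (φ : T →ₗ[ℂ] W) : Prop :=
  ∀ (n : ℕ) (M : Matrix (Fin n) (Fin n) T), M ∈ C n → M.map φ ∈ OperatorSystem.cone n

/-- Kolmogorov decomposition of a completely positive family of sesquilinear forms. -/
theorem IsMatrixOrder.exists_kolmogorov {e : T} {C : (n : ℕ) → Set (Matrix (Fin n) (Fin n) T)}
    (hC : IsMatrixOrder e C) {E : Type u} [AddCommGroup E] [Module ℂ E]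
    (L : E →ₗ⋆[ℂ] E →ₗ[ℂ] T →ₗ[ℂ] ℂ) (hL : IsPosKernel C fun x y => L x y) :
    ∃ (K : Type u) (_ : NormedAddCommGroup K) (_ : InnerProductSpace ℂ K) (_ : CompleteSpace K)
      (J : E →ₗ[ℂ] K) (ψ : T →ₗ[ℂ] (K →L[ℂ] K)), DenseRange J ∧ ψ e = 1 ∧
      IsMatrixPositive C ψ ∧
      ∀ x y t, inner ℂ (J x) (ψ t (J y)) = L x y t := by
  let B : T → E →ₗ⋆[ℂ] E →ₗ[ℂ] ℂ := fun t =>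
    LinearMap.mk₂'ₛₗ (starRingEnd ℂ) (RingHom.id ℂ) (fun x y => L x y t) (by simp) (by simp)
      (by simp) (by simp)
  have hB : ∀ t x y, B t x y = L x y t := fun _ _ _ => rfl
  obtain ⟨K, _, _, _, J, hJ, hJB⟩ := exists_completion_of_form (B e)
    (fun x y => by
      rw [hB, hB, ← hL.apply_star hC x y e, hC.star_unit])
    (fun x => hL.apply_self_nonneg hC x)
  have hnorm : ∀ x, L x x e = ((‖J x‖ ^ 2 : ℝ) : ℂ) := fun x => by
    rw [← hB, ← hJB, inner_self_eq_norm_sq_to_K]; simp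
  have hbd : ∀ t, ∃ r : ℝ, 0 ≤ r ∧ ∀ x y, ‖B t x y‖ ≤ r * ‖J x‖ * ‖J y‖ := fun t => by
    obtain ⟨r, hr, h⟩ := hL.exists_bound hC t
    refine ⟨r, hr.le, fun x y => norm_le_of_forall_quadratic_nonneg hr.le (norm_nonneg _)
      (norm_nonneg _) fun c => ?_⟩
    have h1 := h x (c • y)
    rw [hL.apply_star hC x (c • y) t, hnorm, hnorm, map_smul J, norm_smul, map_smul,
      LinearMap.smul_apply, smul_eq_mul] at h1
    have h2 := (Complex.nonneg_iff.mp h1).1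
    have h3 : (star (c * L x y t)).re = (c * L x y t).re := rfl
    simp only [Complex.add_re, h3, Complex.re_ofReal_mul, Complex.ofReal_re] at h2
    rw [hB]
    linarith
  choose r hr hbd using hbd
  choose ψ hψ using fun t => exists_clm_of_form J hJ (B t) (r t) (hr t) (hbd t)
  have hext : ∀ {S S' : K →L[ℂ] K}, (∀ x y, inner ℂ (J x) (S (J y)) = inner ℂ (J x) (S' (J y))) →
      S = S' := fun {S S'} h => by
    have h1 : (fun v : K => S v) = fun v => S' v :=
      hJ.equalizer S.continuous S'.continuous
        (funext fun y => eq_of_forall_inner_denseRange hJ fun x => h x y)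
    exact ContinuousLinearMap.ext (congrFun h1)
  let ψl : T →ₗ[ℂ] (K →L[ℂ] K) :=
    { toFun := ψ
      map_add' := fun s t => hext fun x y => by
        rw [add_apply, inner_add_right, hψ, hψ, hψ, hB, hB, hB, map_add]
      map_smul' := fun c t => hext fun x y => by
        rw [RingHom.id_apply, smul_apply, inner_smul_right, hψ, hψ, hB, hB,
          map_smul, smul_eq_mul] }
  refine ⟨K, inferInstance, inferInstance, inferInstance, J, ψl, hJ, ?_, ?_, fun x y t => hψ t x y⟩
  · refine hext fun x y => ?_
    rw [one_apply_eq_self, hJB]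
    exact hψ e x y
  · intro n M hM
    rw [mem_cone_iff_sum_inner_nonneg]
    intro v
    -- On vectors from the dense range the quadratic form is the value of the kernel `L`;
    -- nonnegativity is a closed condition.
    have hd : DenseRange fun (x : Fin n → E) (p : Fin n) => J (x p) :=
      DenseRange.piMap fun _ => hJ
    refine hd.induction_on (p := fun v : Fin n → K =>
      (0 : ℂ) ≤ ∑ p, ∑ q, inner ℂ (v p) (M.map ψl p q (v q))) v ?_ fun x => ?_
    · exact isClosed_le (by fun_prop) (by fun_prop)
    · have := hL n x M hM
      convert this using 1
      exact Finset.sum_congr rfl fun p _ => Finset.sum_congr rfl fun q _ => hψ _ _ _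

section Module

variable {A : Type*} [Ring A] [StarRing A] [Algebra ℂ A] [StarModule ℂ A] {β : Type*}

/-- The sesquilinear extension of a kernel to finitely supported `A`-valued functions. -/
def kernelForm (k : β → β → A →ₗ[ℂ] T →ₗ[ℂ] ℂ) : (β →₀ A) →ₗ⋆[ℂ] (β →₀ A) →ₗ[ℂ] T →ₗ[ℂ] ℂ :=
  LinearMap.mk₂'ₛₗ (starRingEnd ℂ) (RingHom.id ℂ)
    (fun v w => v.sum fun b a => w.sum fun b' a' => k b b' (star a * a'))
    (fun v v' w => by
      rw [Finsupp.sum_add_index']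
      · simp
      · intro b a a'
        simp only [star_add, add_mul, map_add, Finsupp.sum_add])
    (fun c v w => by
      rw [Finsupp.sum_smul_index' (by simp), Finsupp.smul_sum]
      refine Finsupp.sum_congr fun b _ => ?_
      rw [Finsupp.smul_sum]
      refine Finsupp.sum_congr fun b' _ => ?_
      rw [star_smul, smul_mul_assoc, map_smul]
      rfl)
    (fun v w w' => by
      rw [← Finsupp.sum_add]
      refine Finsupp.sum_congr fun b _ => ?_
      rw [Finsupp.sum_add_index'] <;> simp [mul_add])
    (fun c v w => by
      rw [Finsupp.smul_sum]
      refine Finsupp.sum_congr fun b _ => ?_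
      rw [Finsupp.sum_smul_index' (by simp), Finsupp.smul_sum]
      refine Finsupp.sum_congr fun b' _ => ?_
      rw [mul_smul_comm, map_smul]
      rfl)

theorem kernelForm_apply (k : β → β → A →ₗ[ℂ] T →ₗ[ℂ] ℂ) (v w : β →₀ A) :
    kernelForm k v w = v.sum fun b a => w.sum fun b' a' => k b b' (star a * a') := rfl

theorem kernelForm_single (k : β → β → A →ₗ[ℂ] T →ₗ[ℂ] ℂ) (b b' : β) (a a' : A) :
    kernelForm k (Finsupp.single b a) (Finsupp.single b' a') = k b b' (star a * a') := by
  simp [kernelForm_apply]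

/-- Left multiplication on finitely supported `A`-valued functions. -/
def finsuppMulLeft (β : Type*) (c : A) : (β →₀ A) →ₗ[ℂ] (β →₀ A) :=
  Finsupp.mapRange.linearMap (LinearMap.mulLeft ℂ c)

theorem finsuppMulLeft_apply (c : A) (v : β →₀ A) (b : β) : finsuppMulLeft β c v b = c * v b := by
  simp [finsuppMulLeft]

theorem finsuppMulLeft_single (c : A) (b : β) (a : A) :
    finsuppMulLeft β c (Finsupp.single b a) = Finsupp.single b (c * a) := by
  simp [finsuppMulLeft]

/-- The kernel sees `a` and `a'` only through `star a * a'`. This identity makes left multiplication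
a `*`-representation and makes it commute with the action of `T`. -/
theorem kernelForm_mulLeft (k : β → β → A →ₗ[ℂ] T →ₗ[ℂ] ℂ) (c : A) (v w : β →₀ A) :
    kernelForm k (finsuppMulLeft β (star c) v) w = kernelForm k v (finsuppMulLeft β c w) := by
  induction v using Finsupp.induction_linear with
  | zero => simp
  | add v v' hv hv' => simp only [map_add, LinearMap.add_apply, hv, hv']
  | single b a =>
    induction w using Finsupp.induction_linear with
    | zero => simp
    | add w w' hw hw' => simp only [map_add, hw, hw']
    | single b' a' =>
      simp only [finsuppMulLeft_single, kernelForm_single, star_mul, star_star, mul_assoc]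

/-- Expanding the finitely supported functions over a common finite support `F` gives the hypothesis
for index set `Fin m × F` and the matrix `Q` repeated in blocks. -/
theorem isPosKernel_kernelForm {e : T} {C : (n : ℕ) → Set (Matrix (Fin n) (Fin n) T)}
    (hC : IsMatrixOrder e C) (k : β → β → A →ₗ[ℂ] T →ₗ[ℂ] ℂ)
    (hk : IsPosKernel C fun x y : β × A => k x.1 y.1 (star x.2 * y.2)) :
    IsPosKernel C fun v w => kernelForm k v w := by
  classical
  intro m v Q hQ
  let F : Finset β := Finset.univ.biUnion fun p => (v p).support
  have hF : ∀ p, (v p).support ⊆ F := fun p =>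
    Finset.subset_biUnion_of_mem (fun p => (v p).support) (Finset.mem_univ p)
  have h1 : ∀ p q, kernelForm k (v p) (v q) (Q p q)
      = ∑ b : F, ∑ b' : F, k b b' (star (v p b) * v q b') (Q p q) := fun p q => by
    rw [kernelForm_apply, Finsupp.sum_of_support_subset _ (hF p) _ (by simp), ← Finset.sum_coe_sort,
      LinearMap.sum_apply]
    refine Finset.sum_congr rfl fun b _ => ?_
    rw [Finsupp.sum_of_support_subset _ (hF q) _ (by simp), ← Finset.sum_coe_sort,
      LinearMap.sum_apply]
  have h2 := hk.sum_nonneg hC (ι := Fin m × F) (fun x => ((x.2 : β), v x.1 x.2))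
    (Q := Q.submatrix Prod.fst Prod.fst) (fun n f => hC.posOn_iff.mpr hQ n (Prod.fst ∘ f))
  simp only [h1]
  convert h2 using 1
  simp only [Fintype.sum_prod_type, Matrix.submatrix_apply]
  exact Finset.sum_congr rfl fun p _ => Finset.sum_comm

end Module

/-- Simultaneous dilation: a positive kernel on `A × T`, with `A` a `*`-algebra and `T` a matrix
ordered space, comes from a `*`-representation of `A` and a unital completely positive map of `T`
with commuting ranges. -/
theorem IsMatrixOrder.exists_dilation {e : T} {C : (n : ℕ) → Set (Matrix (Fin n) (Fin n) T)}
    (hC : IsMatrixOrder e C) {A : Type v} [Ring A] [StarRing A] [Algebra ℂ A] [StarModule ℂ A]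
    (hA : ∀ c : A, ∃ (R : ℝ) (d : A), star c * c + star d * d = (R : ℂ) • 1) {β : Type w}
    (k : β → β → A →ₗ[ℂ] T →ₗ[ℂ] ℂ)
    (hk : IsPosKernel C fun x y : β × A => k x.1 y.1 (star x.2 * y.2)) :
    ∃ (K : Type (max v w)) (_ : NormedAddCommGroup K) (_ : InnerProductSpace ℂ K)
      (_ : CompleteSpace K) (π : A →⋆ₐ[ℂ] (K →L[ℂ] K)) (ψ : T →ₗ[ℂ] (K →L[ℂ] K)) (V : β → K),
      ψ e = 1 ∧ IsMatrixPositive C ψ ∧ (∀ a t, Commute (π a) (ψ t)) ∧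
      ∀ b b' a t, inner ℂ (V b) (π a (ψ t (V b'))) = k b b' a t := by
  have hL := isPosKernel_kernelForm hC k hk
  obtain ⟨K, _, _, _, J, ψ, hJ, hψe, hψ, hψL⟩ := hC.exists_kolmogorov (kernelForm k) hL
  have hJJ : ∀ x y, inner ℂ (J x) (J y) = kernelForm k x y e := fun x y => by
    rw [← hψL, hψe, one_apply_eq_self]
  have hnorm : ∀ x, kernelForm k x x e = ((‖J x‖ ^ 2 : ℝ) : ℂ) := fun x => by
    rw [← hJJ, inner_self_eq_norm_sq_to_K]; simp
  have hbd : ∀ c : A, ∃ r : ℝ, ∀ x, ‖J (finsuppMulLeft β c x)‖ ≤ r * ‖J x‖ := by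
    intro c
    -- The relation gives `‖c x‖² + ‖d x‖² = R ‖x‖²` in the new Hilbert space, so left
    -- multiplication by `c` is bounded although `A` carries no norm.
    obtain ⟨R, d, hd⟩ := hA c
    have h1 : ∀ x, ‖J (finsuppMulLeft β c x)‖ ^ 2 + ‖J (finsuppMulLeft β d x)‖ ^ 2
        = R * ‖J x‖ ^ 2 := fun x => by
      have h2 : ∀ c : A, kernelForm k (finsuppMulLeft β c x) (finsuppMulLeft β c x)
          = kernelForm k x (finsuppMulLeft β (star c * c) x) := fun c => by
        rw [← star_star c, kernelForm_mulLeft, star_star]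
        congr 1
        ext b
        simp [finsuppMulLeft_apply, mul_assoc]
      have h3 : finsuppMulLeft β (star c * c) x + finsuppMulLeft β (star d * d) x = (R : ℂ) • x := by
        ext b
        rw [Finsupp.add_apply, finsuppMulLeft_apply, finsuppMulLeft_apply, ← add_mul, hd]
        simp
      have h4 := hnorm (finsuppMulLeft β c x)
      have h5 := hnorm (finsuppMulLeft β d x)
      have h6 : ((‖J (finsuppMulLeft β c x)‖ ^ 2 + ‖J (finsuppMulLeft β d x)‖ ^ 2 : ℝ) : ℂ)
          = ((R * ‖J x‖ ^ 2 : ℝ) : ℂ) := by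
        rw [Complex.ofReal_add, ← h4, ← h5, h2, h2, ← LinearMap.add_apply, ← map_add, h3, map_smul,
          LinearMap.smul_apply, hnorm]
        simp
      exact_mod_cast h6
    refine ⟨√R, fun x => ?_⟩
    by_cases hR : 0 ≤ R
    · refine (sq_le_sq₀ (norm_nonneg _) (by positivity)).mp ?_
      rw [mul_pow, Real.sq_sqrt hR]
      nlinarith [h1 x, sq_nonneg ‖J (finsuppMulLeft β d x)‖]
    · have h7 : ‖J (finsuppMulLeft β c x)‖ ^ 2 ≤ 0 := by
        nlinarith [h1 x, sq_nonneg ‖J (finsuppMulLeft β d x)‖, sq_nonneg ‖J x‖]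
      have h8 : ‖J (finsuppMulLeft β c x)‖ = 0 := by
        have := sq_nonneg ‖J (finsuppMulLeft β c x)‖
        exact pow_eq_zero_iff (two_ne_zero) |>.mp (le_antisymm h7 this)
      rw [h8]; positivity
  let P : A → K →L[ℂ] K := fun c => (J ∘ₗ finsuppMulLeft β c).extendOfNorm J
  have hP : ∀ c x, P c (J x) = J (finsuppMulLeft β c x) := fun c x =>
    LinearMap.extendOfNorm_eq hJ (hbd c) x
  have hext : ∀ {S S' : K →L[ℂ] K}, (∀ y, S (J y) = S' (J y)) → S = S' := fun {S S'} h =>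
    ContinuousLinearMap.ext (congrFun (hJ.equalizer S.continuous S'.continuous (funext h)))
  let π : A →⋆ₐ[ℂ] (K →L[ℂ] K) :=
    { toFun := P
      map_one' := hext fun y => by
        rw [hP, one_apply_eq_self]; congr 1; ext b; simp [finsuppMulLeft_apply]
      map_mul' := fun a a' => hext fun y => by
        rw [hP, mul_apply_eq_comp, hP, hP]; congr 1; ext b; simp [finsuppMulLeft_apply, mul_assoc]
      map_zero' := hext fun y => by
        rw [hP, zero_apply, ← map_zero J]; congr 1; ext b; simp [finsuppMulLeft_apply]
      map_add' := fun a a' => hext fun y => by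
        rw [hP, add_apply, hP, hP, ← map_add]
        congr 1; ext b; simp [finsuppMulLeft_apply, add_mul]
      commutes' := fun c => hext fun y => by
        rw [hP, Algebra.algebraMap_eq_smul_one, Algebra.algebraMap_eq_smul_one,
          smul_apply, one_apply_eq_self, ← map_smul]
        congr 1; ext b; simp [finsuppMulLeft_apply]
      map_star' := fun a => hext fun y => eq_of_forall_inner_denseRange hJ fun x => by
        rw [hP, ContinuousLinearMap.star_eq_adjoint, ContinuousLinearMap.adjoint_inner_right, hP,
          hJJ, hJJ, ← kernelForm_mulLeft, star_star] }
  have hπ : ∀ c x, π c (J x) = J (finsuppMulLeft β c x) := hP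
  refine ⟨K, inferInstance, inferInstance, inferInstance, π, ψ, fun b => J (Finsupp.single b 1),
    hψe, hψ, fun a t => hext fun y => eq_of_forall_inner_denseRange hJ fun x => ?_,
    fun b b' a t => ?_⟩
  · rw [mul_apply_eq_comp, mul_apply_eq_comp, hπ, hψL, ← kernelForm_mulLeft, ← hψL, ← hπ, map_star,
      ContinuousLinearMap.star_eq_adjoint, ContinuousLinearMap.adjoint_inner_left]
  · rw [← ContinuousLinearMap.adjoint_inner_left, ← ContinuousLinearMap.star_eq_adjoint, ← map_star,
      hπ, hψL, finsuppMulLeft_single, kernelForm_single]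
    simp

end Dilation

/-! ### Completely positive maps and inclusions -/

section MapLemmas

variable {S T R : Type*}
  [AddCommGroup S] [Module ℂ S] [StarAddMonoid S] [StarModule ℂ S] [OperatorSystem S]
  [AddCommGroup T] [Module ℂ T] [StarAddMonoid T] [StarModule ℂ T] [OperatorSystem T]
  [AddCommGroup R] [Module ℂ R] [StarAddMonoid R] [StarModule ℂ R] [OperatorSystem R]

theorem IsMatrixPositive.map_star {V : Type*} [AddCommGroup V] [Module ℂ V] [StarAddMonoid V]
    [StarModule ℂ V] {e : V} {C : (n : ℕ) → Set (Matrix (Fin n) (Fin n) V)}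
    (hC : IsMatrixOrder e C) {φ : V →ₗ[ℂ] T} (hφ : IsMatrixPositive C φ) (x : V) :
    φ (star x) = star (φ x) := by
  obtain ⟨r, -, h⟩ := hC.exists_bound x
  have h1 := OperatorSystem.isHermitian_of_mem (hφ 2 _ h)
  have h2 := congrFun (congrFun h1 1) 0
  simpa using h2.symm

theorem IsCompletelyPositive.map_star {φ : S →ₗ[ℂ] T} (hφ : IsCompletelyPositive φ) (x : S) :
    φ (star x) = star (φ x) :=
  IsMatrixPositive.map_star (OperatorSystem.isMatrixOrder S) hφ x

theorem IsCompletelyPositive.comp {ψ : T →ₗ[ℂ] R} {φ : S →ₗ[ℂ] T} (hψ : IsCompletelyPositive ψ)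
    (hφ : IsCompletelyPositive φ) : IsCompletelyPositive (ψ ∘ₗ φ) := fun n M hM => by
  have := hψ n _ (hφ n M hM)
  rwa [Matrix.map_map] at this

theorem IsInclusion.isCompletelyPositive {φ : S →ₗ[ℂ] T} (hφ : IsInclusion φ) :
    IsCompletelyPositive φ := fun n M => (hφ.mem_cone_iff n M).mpr

theorem IsInclusion.comp {ψ : T →ₗ[ℂ] R} {φ : S →ₗ[ℂ] T} (hψ : IsInclusion ψ)
    (hφ : IsInclusion φ) : IsInclusion (ψ ∘ₗ φ) where
  injective := hψ.injective.comp hφ.injective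
  map_unit := by rw [LinearMap.comp_apply, hφ.map_unit, hψ.map_unit]
  mem_cone_iff n M := by
    rw [← hφ.mem_cone_iff, ← hψ.mem_cone_iff, Matrix.map_map]; rfl

/-- Injectivity is automatic: if `φ x = 0`, then `x` and `-x` are both positive, and the cones are
proper. -/
theorem isInclusion_of_mem_cone_iff {φ : S →ₗ[ℂ] T} (h1 : φ OperatorSystem.unit = OperatorSystem.unit)
    (h2 : ∀ (n : ℕ) (M : Matrix (Fin n) (Fin n) S),
      M.map φ ∈ OperatorSystem.cone n ↔ M ∈ OperatorSystem.cone n) : IsInclusion φ := by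
  refine ⟨(injective_iff_map_eq_zero φ).mpr fun x hx => ?_, h1, h2⟩
  have h3 : ∀ y, φ y = 0 → (Matrix.of fun _ _ => y : Matrix (Fin 1) (Fin 1) S) ∈
      OperatorSystem.cone 1 := fun y hy => by
    rw [← h2]
    convert OperatorSystem.zero_mem (V := T) 1
    ext i j; simp [hy]
  have h4 := OperatorSystem.eq_zero_of_mem_of_neg_mem (h3 x hx) (by
    convert h3 (-x) (by rw [map_neg, hx, neg_zero]) using 1
    rfl)
  exact congrFun (congrFun h4 0) 0

theorem isCompletelyPositive_starAlgHom {A B : Type*} [CStarAlgebra A] [PartialOrder A]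
    [StarOrderedRing A] [CStarAlgebra B] [PartialOrder B] [StarOrderedRing B] (π : A →⋆ₐ[ℂ] B) :
    IsCompletelyPositive π.toLinearMap := fun n M hM => by
  obtain ⟨N, hN, -⟩ := cone_exists_star_mul hM
  convert mem_cone_of_star_mul (N.map π) using 1
  ext p q
  change π (M p q) = ∑ r, star (π (N r p)) * π (N r q)
  simp only [hN, map_sum, map_mul, map_star]

end MapLemmas

/-! ### Arveson's extension theorem -/

section Arveson

variable {V : Type*} [AddCommGroup V] [Module ℂ V] [StarAddMonoid V] [StarModule ℂ V]
  {e : V} {C : (n : ℕ) → Set (Matrix (Fin n) (Fin n) V)}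

/-- The simultaneous dilation with `A = ℂ`: the scalars attached to the points of `β` are absorbed
into `Q` by conjugating with a diagonal matrix. -/
theorem IsMatrixOrder.exists_dilation_of_isPosKernel (hC : IsMatrixOrder e C) {β : Type w}
    (k : β → β → V →ₗ[ℂ] ℂ) (hk : IsPosKernel C k) :
    ∃ (K : Type w) (_ : NormedAddCommGroup K) (_ : InnerProductSpace ℂ K)
      (_ : CompleteSpace K) (ψ : V →ₗ[ℂ] (K →L[ℂ] K)) (v : β → K),
      ψ e = 1 ∧ IsMatrixPositive C ψ ∧ ∀ b b' t, inner ℂ (v b) (ψ t (v b')) = k b b' t := by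
  obtain ⟨K, _, _, _, π, ψ, v, h1, h2, -, h3⟩ := hC.exists_dilation (A := ℂ)
    (fun c => ⟨‖c‖ ^ 2, 0, by simp [RCLike.star_def, Complex.conj_mul']⟩)
    (fun b b' => LinearMap.toSpanSingleton ℂ _ (k b b')) (by
      intro m b Q hQ
      have h := hk m (fun p => (b p).1) _ (hC.conj_mem (Matrix.diagonal fun p => (b p).2) hQ)
      convert h using 1
      refine Finset.sum_congr rfl fun p _ => Finset.sum_congr rfl fun q _ => ?_
      have : scalarConj (Matrix.diagonal fun p => (b p).2) Q p q =
          (star (b p).2 * (b q).2) • Q p q := by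
        rw [scalarConj_apply, Finset.sum_eq_single p, Finset.sum_eq_single q]
        · simp
        all_goals simp +contextual
      rw [this, map_smul]
      simp)
  refine ⟨K, inferInstance, inferInstance, inferInstance, ψ, v, h1, h2, fun b b' t => ?_⟩
  have := h3 b b' 1 t
  simpa using this

variable {H : Type*} [NormedAddCommGroup H] [InnerProductSpace ℂ H] [CompleteSpace H]

/-- Arveson's extension theorem, for a target matrix order that need not be proper. -/
theorem IsMatrixOrder.exists_extension (hC : IsMatrixOrder e C) {X : Type*} [AddCommGroup X]
    [Module ℂ X] [StarAddMonoid X] [StarModule ℂ X] (j : X →ₗ[ℂ] V) (hj : Function.Injective j)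
    (hjstar : ∀ x, j (star x) = star (j x)) (eX : X) (hje : j eX = e)
    (f : X →ₗ[ℂ] (H →L[ℂ] H))
    (hf : IsMatrixPositive (fun n => {Q : Matrix (Fin n) (Fin n) X | Q.map j ∈ C n}) f) :
    ∃ g : V →ₗ[ℂ] (H →L[ℂ] H), IsMatrixPositive C g ∧ ∀ x, g (j x) = f x := by
  let k : H → H → X →ₗ[ℂ] ℂ := fun ξ η =>
    { toFun := fun x => inner ℂ ξ (f x η)
      map_add' := fun x y => by rw [map_add, add_apply, inner_add_right]
      map_smul' := fun c x => by rw [map_smul, smul_apply, inner_smul_right]; rfl }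
  obtain ⟨k', hk', hkk⟩ := hC.exists_kernel_extension j hj hjstar eX hje k
    (fun m b Q hQ => sum_inner_nonneg_of_mem_cone (hf m Q hQ) b)
  obtain ⟨K, _, _, _, ψ, v, hψe, hψ, hv⟩ := hC.exists_dilation_of_isPosKernel k' hk'
  have hvv : ∀ ξ η, inner ℂ (v ξ) (v η) = inner ℂ ξ (f eX η) := fun ξ η => by
    have := hv ξ η e
    rw [hψe, one_apply_eq_self] at this
    rw [this, ← hje, hkk]; rfl
  -- Linearity of `v` follows because the defect vectors are orthogonal to the range of `v`, hence
  -- to themselves. Compressing `ψ` by this operator gives the extension.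
  let W : H →ₗ[ℂ] K :=
    { toFun := v
      map_add' := fun ξ η => by
        rw [← sub_eq_zero]
        have h : ∀ ζ, inner ℂ (v ζ) (v (ξ + η) - (v ξ + v η)) = 0 := fun ζ => by
          rw [inner_sub_right, inner_add_right, hvv, hvv, hvv, map_add, inner_add_right, sub_self]
        rw [← inner_self_eq_zero (𝕜 := ℂ)]
        nth_rewrite 1 [inner_sub_left, inner_add_left]
        rw [h, h, h]; simp
      map_smul' := fun c ξ => by
        rw [RingHom.id_apply, ← sub_eq_zero]
        have h : ∀ ζ, inner ℂ (v ζ) (v (c • ξ) - c • v ξ) = 0 := fun ζ => by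
          rw [inner_sub_right, inner_smul_right, hvv, hvv, map_smul, inner_smul_right, sub_self]
        rw [← inner_self_eq_zero (𝕜 := ℂ)]
        nth_rewrite 1 [inner_sub_left, inner_smul_left]
        rw [h, h]; simp }
  let Wc : H →L[ℂ] K := W.mkContinuous (√‖f eX‖) fun ξ => by
    refine (sq_le_sq₀ (norm_nonneg _) (by positivity)).mp ?_
    rw [mul_pow, Real.sq_sqrt (norm_nonneg _)]
    have h1 : ((‖v ξ‖ ^ 2 : ℝ) : ℂ) = inner ℂ ξ (f eX ξ) := by
      rw [← hvv, inner_self_eq_norm_sq_to_K]; simp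
    have h2 : ‖v ξ‖ ^ 2 = ‖(inner ℂ ξ (f eX ξ) : ℂ)‖ := by
      rw [← h1, Complex.norm_real, Real.norm_of_nonneg (sq_nonneg _)]
    change ‖v ξ‖ ^ 2 ≤ _
    rw [h2]
    calc _ ≤ ‖ξ‖ * ‖f eX ξ‖ := norm_inner_le_norm _ _
      _ ≤ ‖ξ‖ * (‖f eX‖ * ‖ξ‖) := by gcongr; exact (f eX).le_opNorm ξ
      _ = _ := by ring
  have hW : ∀ ξ, Wc ξ = v ξ := fun ξ => rfl
  let g : V →ₗ[ℂ] (H →L[ℂ] H) :=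
    { toFun := fun y => (ContinuousLinearMap.adjoint Wc) ∘L (ψ y) ∘L Wc
      map_add' := fun x y => by ext ξ; simp
      map_smul' := fun c x => by ext ξ; simp }
  have hg : ∀ y ξ η, inner ℂ ξ (g y η) = inner ℂ (v ξ) (ψ y (v η)) := fun y ξ η => by
    change inner ℂ ξ (ContinuousLinearMap.adjoint Wc (ψ y (Wc η))) = _
    rw [ContinuousLinearMap.adjoint_inner_right, hW, hW]
  refine ⟨g, fun n M hM => ?_, fun x => ?_⟩
  · rw [mem_cone_iff_sum_inner_nonneg]
    intro ξ
    have := sum_inner_nonneg_of_mem_cone (hψ n M hM) fun p => v (ξ p)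
    convert this using 1
    exact Finset.sum_congr rfl fun p _ => Finset.sum_congr rfl fun q _ => hg _ _ _
  · ext η
    refine ext_inner_left ℂ fun ξ => ?_
    rw [hg, hv, hkk]; rfl

theorem isInjectiveSystem_clm (H : Type u) [NormedAddCommGroup H] [InnerProductSpace ℂ H]
    [CompleteSpace H] : IsInjectiveSystem (H →L[ℂ] H) := by
  intro X Y _ _ _ _ _ _ _ _ _ _ j f hj hf
  exact (OperatorSystem.isMatrixOrder Y).exists_extension j hj.injective
    hj.isCompletelyPositive.map_star OperatorSystem.unit hj.map_unit f
    fun n M hM => hf n M ((hj.mem_cone_iff n M).mp hM)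

end Arveson

/-! ### Representation of operator systems on Hilbert space -/

section ChoiEffros

variable {V : Type*} [AddCommGroup V] [Module ℂ V] [StarAddMonoid V] [StarModule ℂ V]
  {e : V} {C : (n : ℕ) → Set (Matrix (Fin n) (Fin n) V)}

/-- The direct sum of all positive kernels indexed by `ℕ` is positive. -/
theorem IsMatrixOrder.isPosKernel_directSum (hC : IsMatrixOrder e C) :
    IsPosKernel C (fun x y : {k : ℕ → ℕ → V →ₗ[ℂ] ℂ // IsPosKernel C k} × ℕ =>
      open Classical in if x.1 = y.1 then x.1.1 x.2 y.2 else 0) := by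
  classical
  intro m b Q hQ
  have h1 : ∀ i : {k : ℕ → ℕ → V →ₗ[ℂ] ℂ // IsPosKernel C k}, 0 ≤ ∑ p, ∑ q,
      (if (b p).1 = i ∧ (b q).1 = i then i.1 (b p).2 (b q).2 (Q p q) else 0) := fun i => by
    have h := i.2 m (fun p => (b p).2) _
      (hC.conj_mem (Matrix.diagonal fun p => if (b p).1 = i then (1 : ℂ) else 0) hQ)
    convert h using 1
    refine Finset.sum_congr rfl fun p _ => Finset.sum_congr rfl fun q _ => ?_
    rw [scalarConj_apply, Finset.sum_eq_single p, Finset.sum_eq_single q]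
    · by_cases hp : (b p).1 = i <;> by_cases hq : (b q).1 = i <;> simp [hp, hq]
    all_goals simp +contextual
  have h2 : 0 ≤ ∑ i ∈ Finset.univ.image fun p => (b p).1, ∑ p, ∑ q,
      (if (b p).1 = i ∧ (b q).1 = i then i.1 (b p).2 (b q).2 (Q p q) else 0) :=
    Finset.sum_nonneg fun i _ => h1 i
  convert h2 using 1
  refine (Finset.sum_comm.trans (Finset.sum_congr rfl fun p _ =>
    Finset.sum_comm.trans (Finset.sum_congr rfl fun q _ => ?_))).symm
  rw [Finset.sum_eq_single (b p).1]
  · by_cases h : (b p).1 = (b q).1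
    · simp [h]
    · simp [h, Ne.symm h]
  · intro i _ hi
    simp [hi.symm]
  · intro h
    exact absurd (Finset.mem_image_of_mem _ (Finset.mem_univ p)) h

/-- The kernel on `ℕ` attached to a functional on `M_n(V)`. -/
def kernelOfFunctional {n : ℕ} (s : Matrix (Fin n) (Fin n) V →ₗ[ℂ] ℂ) (p q : ℕ) : V →ₗ[ℂ] ℂ where
  toFun x := s (Matrix.of fun i j => if (i : ℕ) = p ∧ (j : ℕ) = q then x else 0)
  map_add' x y := by
    rw [← map_add]; congr 1; ext i j; by_cases h : (i : ℕ) = p ∧ (j : ℕ) = q <;> simp [h]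
  map_smul' c x := by
    rw [RingHom.id_apply, ← map_smul]
    congr 1; ext i j; by_cases h : (i : ℕ) = p ∧ (j : ℕ) = q <;> simp [h]

theorem sum_kernelOfFunctional {n m : ℕ} (s : Matrix (Fin n) (Fin n) V →ₗ[ℂ] ℂ)
    (b : Fin m → ℕ) (Q : Matrix (Fin m) (Fin m) V) :
    ∑ p, ∑ q, kernelOfFunctional s (b p) (b q) (Q p q) =
      s (scalarConj (Matrix.of fun p (i : Fin n) => if (i : ℕ) = b p then (1 : ℂ) else 0) Q) := by
  have h : ∀ p q, kernelOfFunctional s (b p) (b q) (Q p q) =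
      s (Matrix.of fun i j => if (i : ℕ) = b p ∧ (j : ℕ) = b q then Q p q else 0) :=
    fun _ _ => rfl
  simp only [h, ← map_sum]
  congr 1
  ext i j
  simp only [Matrix.sum_apply, scalarConj_apply, Matrix.of_apply]
  refine Finset.sum_congr rfl fun p _ => Finset.sum_congr rfl fun q _ => ?_
  by_cases hp : (i : ℕ) = b p <;> by_cases hq : (j : ℕ) = b q <;> simp [hp, hq]

theorem sum_kernelOfFunctional_val {n : ℕ} (s : Matrix (Fin n) (Fin n) V →ₗ[ℂ] ℂ)
    (Q : Matrix (Fin n) (Fin n) V) :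
    ∑ p : Fin n, ∑ q : Fin n, kernelOfFunctional s p q (Q p q) = s Q := by
  rw [sum_kernelOfFunctional s (fun p => (p : ℕ)) Q]
  congr 1
  have := submatrix_eq_scalarConj (id : Fin n → Fin n) Q
  rw [Matrix.submatrix_id_id] at this
  conv_rhs => rw [this]
  congr 1
  ext p i
  simp [Fin.val_inj]

theorem IsMatrixOrder.isPosKernel_kernelOfFunctional (hC : IsMatrixOrder e C) {n : ℕ}
    (s : Matrix (Fin n) (Fin n) V →ₗ[ℂ] ℂ) (hs : ∀ M ∈ C n, 0 ≤ s M) :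
    IsPosKernel C (kernelOfFunctional s) := fun m b Q hQ => by
  rw [sum_kernelOfFunctional]
  exact hs _ (hC.conj_mem _ hQ)

/-- Every operator system is included in some `B(H)`. -/
theorem exists_isInclusion_clm (S : Type u) [AddCommGroup S] [Module ℂ S] [StarAddMonoid S]
    [StarModule ℂ S] [OperatorSystem S] :
    ∃ (H : Type u) (_ : NormedAddCommGroup H) (_ : InnerProductSpace ℂ H) (_ : CompleteSpace H)
      (ι : S →ₗ[ℂ] (H →L[ℂ] H)), IsInclusion ι := by
  classical
  have hC := OperatorSystem.isMatrixOrder S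
  -- One Hilbert space carries all positive kernels on `ℕ`, which encode the positive functionals on
  -- every `M_n(S)`; it stays in universe `u`.
  obtain ⟨H, _, _, _, ι, v, h1, h2, h3⟩ :=
    hC.exists_dilation_of_isPosKernel _ hC.isPosKernel_directSum
  have hι : IsCompletelyPositive ι := h2
  -- Separation needs `M` hermitian, so that case comes first. It gives injectivity of `ι`, which in
  -- turn makes every `M` with positive image hermitian.
  have hherm : ∀ (n : ℕ) (M : Matrix (Fin n) (Fin n) S), M.IsHermitian →
      M.map ι ∈ OperatorSystem.cone n → M ∈ OperatorSystem.cone n := by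
    intro n M hM hMι
    refine OperatorSystem.archimedean M fun r hr => ?_
    by_contra hr'
    obtain ⟨s, hs, hs1, hsM⟩ := hC.exists_separating (by
      refine Matrix.IsHermitian.add ?_ hM
      ext i j
      by_cases h : i = j
      · subst h; simp [OperatorSystem.star_unit]
      · simp [h, Ne.symm h]) hr'
    -- The form of `M.map ι` at the vectors of the kernel of `s` is `s M`, so `s M ≥ 0`, against `r
    -- + s M ≤ 0`.
    have h4 := sum_inner_nonneg_of_mem_cone hMι
      fun p => v (⟨_, hC.isPosKernel_kernelOfFunctional s hs⟩, (p : ℕ))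
    simp only [Matrix.map_apply, h3, if_true, sum_kernelOfFunctional_val] at h4
    rw [map_add, map_smul, hs1] at hsM
    have h5 := (Complex.le_def.mp hsM).1
    have h6 := (Complex.le_def.mp h4).1
    simp at h5 h6
    linarith
  have hzero : ∀ x : S, star x = x → ι x = 0 → x = 0 := fun x hx hx0 => by
    have h3 : ∀ y, star y = y → ι y = 0 → (Matrix.of fun _ _ => y : Matrix (Fin 1) (Fin 1) S) ∈
        OperatorSystem.cone 1 := fun y hys hy => by
      refine hherm 1 _ (by ext i j; simpa using hys) ?_
      convert OperatorSystem.zero_mem (V := H →L[ℂ] H) 1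
      ext i j; simp [hy]
    have h4 := OperatorSystem.eq_zero_of_mem_of_neg_mem (h3 x hx hx0) (by
      convert h3 (-x) (by rw [star_neg, hx]) (by rw [map_neg, hx0, neg_zero]) using 1
      rfl)
    exact congrFun (congrFun h4 0) 0
  have hinj : ∀ x : S, ι x = 0 → x = 0 := fun x hx => by
    have hxs : ι (star x) = 0 := by rw [hι.map_star, hx, star_zero]
    have ha := hzero (x + star x) (by rw [star_add, star_star, add_comm])
      (by rw [map_add, hx, hxs, add_zero])
    have hb := hzero (Complex.I • (x - star x)) (by
        rw [star_smul, star_sub, star_star, RCLike.star_def, Complex.conj_I]; module)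
      (by rw [map_smul, map_sub, hx, hxs, sub_zero, smul_zero])
    have hb' : x - star x = 0 := (smul_eq_zero.mp hb).resolve_left Complex.I_ne_zero
    have : x = (2⁻¹ : ℂ) • ((x + star x) + (x - star x)) := by module
    rw [this, ha, hb', add_zero, smul_zero]
  refine ⟨H, inferInstance, inferInstance, inferInstance, ι,
    isInclusion_of_mem_cone_iff h1 fun n M => ⟨fun hM => hherm n M ?_ hM, hι n M⟩⟩
  ext p q
  rw [← sub_eq_zero]
  refine hinj _ ?_
  rw [map_sub, Matrix.conjTranspose_apply, hι.map_star, sub_eq_zero]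
  exact congrFun (congrFun (OperatorSystem.isHermitian_of_mem hM) p) q

end ChoiEffros

/-! ### Operator subsystems -/

section Subsystem

variable (V : Type*) [AddCommGroup V] [Module ℂ V] [StarAddMonoid V] [StarModule ℂ V]
  [OperatorSystem V]

/-- A self-adjoint subspace of an operator system containing the unit. -/
structure OperatorSubsystem extends Submodule ℂ V where
  star_mem' : ∀ x ∈ carrier, star x ∈ carrier
  unit_mem' : OperatorSystem.unit ∈ carrier

namespace OperatorSubsystem

variable {V} (W : OperatorSubsystem V)

instance : StarAddMonoid W.toSubmodule where
  star x := ⟨star x.1, W.star_mem' x.1 x.2⟩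
  star_involutive x := Subtype.ext (star_star x.1)
  star_add x y := Subtype.ext (star_add x.1 y.1)

instance : StarModule ℂ W.toSubmodule where
  star_smul c x := Subtype.ext (star_smul c x.1)

theorem coe_star (x : W.toSubmodule) : ((star x : W.toSubmodule) : V) = star (x : V) := rfl

instance : OperatorSystem W.toSubmodule where
  cone n := {M | M.map W.toSubmodule.subtype ∈ OperatorSystem.cone n}
  unit := ⟨OperatorSystem.unit, W.unit_mem'⟩
  isHermitian_of_mem {n M} h :=
    ((OperatorSystem.isMatrixOrder V).comap W.toSubmodule.subtype Subtype.val_injective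
      (fun _ => rfl) ⟨OperatorSystem.unit, W.unit_mem'⟩ rfl).isHermitian h
  zero_mem := ((OperatorSystem.isMatrixOrder V).comap W.toSubmodule.subtype Subtype.val_injective
      (fun _ => rfl) ⟨OperatorSystem.unit, W.unit_mem'⟩ rfl).zero_mem
  add_mem := ((OperatorSystem.isMatrixOrder V).comap W.toSubmodule.subtype Subtype.val_injective
      (fun _ => rfl) ⟨OperatorSystem.unit, W.unit_mem'⟩ rfl).add_mem
  smul_mem := ((OperatorSystem.isMatrixOrder V).comap W.toSubmodule.subtype Subtype.val_injective
      (fun _ => rfl) ⟨OperatorSystem.unit, W.unit_mem'⟩ rfl).smul_mem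
  eq_zero_of_mem_of_neg_mem {n M} h1 h2 := by
    have h2' : (-M).map W.toSubmodule.subtype ∈ OperatorSystem.cone n := h2
    have h3 := OperatorSystem.eq_zero_of_mem_of_neg_mem h1 (by
      convert h2' using 1
      ext i j; simp)
    ext i j
    exact congrFun (congrFun h3 i) j
  conj_mem := ((OperatorSystem.isMatrixOrder V).comap W.toSubmodule.subtype Subtype.val_injective
      (fun _ => rfl) ⟨OperatorSystem.unit, W.unit_mem'⟩ rfl).conj_mem
  star_unit := Subtype.ext OperatorSystem.star_unit
  order_unit {n} M hM := by
    obtain ⟨r, hr, h⟩ := OperatorSystem.order_unit (M.map W.toSubmodule.subtype) (by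
      ext i j
      exact congrArg Subtype.val (congrFun (congrFun hM i) j))
    refine ⟨r, hr, ?_⟩
    change Matrix.map _ _ ∈ OperatorSystem.cone n
    convert h using 1
    ext i j
    by_cases h : i = j <;> simp [h]
  archimedean {n} M hM := by
    refine OperatorSystem.archimedean _ fun r hr => ?_
    have h : Matrix.map _ _ ∈ OperatorSystem.cone n := hM r hr
    convert h using 1
    ext i j
    by_cases h : i = j <;> simp [h]

theorem mem_cone_iff {n : ℕ} {M : Matrix (Fin n) (Fin n) W.toSubmodule} :
    M ∈ OperatorSystem.cone n ↔ M.map W.toSubmodule.subtype ∈ OperatorSystem.cone n := Iff.rfl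

theorem isInclusion_subtype : IsInclusion W.toSubmodule.subtype :=
  ⟨Subtype.val_injective, rfl, fun _ _ => Iff.rfl⟩

end OperatorSubsystem

end Subsystem

/-! ### Existence of the injective envelope -/

section Envelope

variable {V : Type*} [AddCommGroup V] [Module ℂ V] [StarAddMonoid V] [StarModule ℂ V]

theorem isHermitian_scalarConj {ι κ : Type*} [Fintype ι] (X : Matrix ι κ ℂ) {M : Matrix ι ι V}
    (hM : M.IsHermitian) : (scalarConj X M).IsHermitian := by
  ext i j
  rw [Matrix.conjTranspose_apply, scalarConj_apply, scalarConj_apply, star_sum, Finset.sum_comm]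
  simp only [star_sum, star_smul]
  refine Finset.sum_congr rfl fun k _ => ?_
  refine Finset.sum_congr rfl fun l _ => ?_
  have : star (M k l) = M l k := congrFun (congrFun hM l) k
  rw [this, star_mul', star_star, mul_comm]

theorem isHermitian_of_one {x : V} (hx : star x = x) :
    (Matrix.of fun _ _ => x : Matrix (Fin 1) (Fin 1) V).IsHermitian := by
  ext i j; simpa using hx

theorem of_forall_isSelfAdjoint {p : V → Prop} (hadd : ∀ x y, p x → p y → p (x + y))
    (hsmul : ∀ (c : ℂ) x, p x → p (c • x)) (h : ∀ x, star x = x → p x) (x : V) : p x := by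
  have hx : x = (2⁻¹ : ℂ) • (x + star x) + (-(2⁻¹ * Complex.I)) • (Complex.I • (x - star x)) := by
    rw [smul_smul]
    have : -(2⁻¹ * Complex.I) * Complex.I = 2⁻¹ := by
      rw [neg_mul, mul_assoc, Complex.I_mul_I]; ring
    rw [this]; module
  rw [hx]
  refine hadd _ _ (hsmul _ _ (h _ ?_)) (hsmul _ _ (h _ ?_))
  · rw [star_add, star_star, add_comm]
  · rw [star_smul, star_sub, star_star, RCLike.star_def, Complex.conj_I]; module

variable [OperatorSystem V]

theorem isCompletelyPositive_pow {φ : Module.End ℂ V} (hφ : IsCompletelyPositive φ) (i : ℕ) :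
    IsCompletelyPositive (φ ^ i) := by
  induction i with
  | zero => intro n M hM; simpa [pow_zero, Module.End.one_eq_id] using hM
  | succ i ih => rw [pow_succ]; exact ih.comp hφ

/-- The order `M ↦ φ(M) ≥ 0` on hermitian matrices induced by a completely positive map. -/
theorem isMatrixOrder_of_isCompletelyPositive {φ : V →ₗ[ℂ] V} (hφ : IsCompletelyPositive φ) :
    IsMatrixOrder (OperatorSystem.unit : V) fun n =>
      {M : Matrix (Fin n) (Fin n) V | M.IsHermitian ∧ M.map φ ∈ OperatorSystem.cone n} where
  isHermitian h := h.1
  zero_mem n := ⟨Matrix.isHermitian_zero, by simpa using OperatorSystem.zero_mem n⟩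
  add_mem {n M N} hM hN := ⟨hM.1.add hN.1, by
    have : (M + N).map φ = M.map φ + N.map φ := by ext; simp
    rw [this]
    exact OperatorSystem.add_mem hM.2 hN.2⟩
  smul_mem {n M} r hr hM := ⟨by
      ext i j
      have : star (M j i) = M i j := congrFun (congrFun hM.1 i) j
      simp [this], by
    have : ((r : ℂ) • M).map φ = (r : ℂ) • M.map φ := by ext; simp
    rw [this]
    exact OperatorSystem.smul_mem r hr hM.2⟩
  conj_mem X hM := ⟨isHermitian_scalarConj X hM.1, by
    rw [scalarConj_map]
    exact OperatorSystem.conj_mem X hM.2⟩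
  exists_bound y := by
    obtain ⟨r, hr, h⟩ := (OperatorSystem.isMatrixOrder V).exists_bound y
    exact ⟨r, hr, OperatorSystem.isHermitian_of_mem h, hφ _ _ h⟩

/-- Among the completely positive maps on `B(H)` fixing `S` there is one whose induced matrix order
is maximal. -/
theorem exists_maximal_order {S : Type*} [AddCommGroup S] [Module ℂ S] [StarAddMonoid S]
    [StarModule ℂ S] [OperatorSystem S] {H : Type*} [NormedAddCommGroup H] [InnerProductSpace ℂ H]
    [CompleteSpace H] (ι : S →ₗ[ℂ] (H →L[ℂ] H)) (hι : IsInclusion ι) :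
    ∃ φ : (H →L[ℂ] H) →ₗ[ℂ] (H →L[ℂ] H), IsCompletelyPositive φ ∧ (∀ x, φ (ι x) = ι x) ∧
      ∀ φ' : (H →L[ℂ] H) →ₗ[ℂ] (H →L[ℂ] H), IsCompletelyPositive φ' → (∀ x, φ' (ι x) = ι x) →
        (∀ (n : ℕ) (M : Matrix (Fin n) (Fin n) (H →L[ℂ] H)), M.map φ ∈ OperatorSystem.cone n →
          M.map φ' ∈ OperatorSystem.cone n) →
        ∀ (n : ℕ) (M : Matrix (Fin n) (Fin n) (H →L[ℂ] H)), M.IsHermitian →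
          M.map φ' ∈ OperatorSystem.cone n → M.map φ ∈ OperatorSystem.cone n := by
  -- Matrix orders larger than the usual one that induce no new positive elements on `S`. They may
  -- fail to be proper.
  let P : Set ((n : ℕ) → Set (Matrix (Fin n) (Fin n) (H →L[ℂ] H))) :=
    {C | IsMatrixOrder (OperatorSystem.unit : H →L[ℂ] H) C ∧ OperatorSystem.cone ≤ C ∧
      ∀ (n : ℕ) (M : Matrix (Fin n) (Fin n) S), M.map ι ∈ C n → M ∈ OperatorSystem.cone n}
  obtain ⟨C, -, ⟨hCP, hCmax⟩⟩ := zorn_le_nonempty₀ P (fun c hcP hc C₀ hC₀ => by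
      have htotal : ∀ {n : ℕ} {M N : Matrix (Fin n) (Fin n) (H →L[ℂ] H)} {C D}, C ∈ c → D ∈ c →
          M ∈ C n → N ∈ D n → ∃ E ∈ c, M ∈ E n ∧ N ∈ E n := fun {n M N C D} hC hD hM hN => by
        rcases hc.total hC hD with h | h
        · exact ⟨D, hD, h n hM, hN⟩
        · exact ⟨C, hC, hM, h n hN⟩
      refine ⟨fun n => {M | ∃ C ∈ c, M ∈ C n}, ⟨⟨?_, ?_, ?_, ?_, ?_, ?_⟩, ?_, ?_⟩,
        fun C hC n M hM => ⟨C, hC, hM⟩⟩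
      · rintro n M ⟨C, hC, hM⟩
        exact (hcP hC).1.isHermitian hM
      · exact fun n => ⟨C₀, hC₀, (hcP hC₀).1.zero_mem n⟩
      · rintro n M N ⟨C, hC, hM⟩ ⟨D, hD, hN⟩
        obtain ⟨E, hE, hME, hNE⟩ := htotal hC hD hM hN
        exact ⟨E, hE, (hcP hE).1.add_mem hME hNE⟩
      · rintro n M r hr ⟨C, hC, hM⟩
        exact ⟨C, hC, (hcP hC).1.smul_mem r hr hM⟩
      · rintro n m M X ⟨C, hC, hM⟩
        exact ⟨C, hC, (hcP hC).1.conj_mem X hM⟩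
      · intro y
        obtain ⟨r, hr, h⟩ := (hcP hC₀).1.exists_bound y
        exact ⟨r, hr, C₀, hC₀, h⟩
      · exact fun n M hM => ⟨C₀, hC₀, (hcP hC₀).2.1 n hM⟩
      · rintro n M ⟨C, hC, hM⟩
        exact (hcP hC).2.2 n M hM)
    OperatorSystem.cone
    ⟨OperatorSystem.isMatrixOrder _, le_rfl, fun n M => (hι.mem_cone_iff n M).mp⟩
  obtain ⟨φ, hφ, hφι⟩ := hCP.1.exists_extension ι hι.injective hι.isCompletelyPositive.map_star
    OperatorSystem.unit hι.map_unit ι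
    (fun n M hM => hι.isCompletelyPositive n M (hCP.2.2 n M hM))
  have hφ' : IsCompletelyPositive φ := fun n M hM => hφ n M (hCP.2.1 n hM)
  refine ⟨φ, hφ', hφι, fun φ' hcp hfix hle n M hM hMφ' => ?_⟩
  -- The order induced by `φ'` belongs to `P` and contains the maximal `C`, hence equals it; and `φ`
  -- is positive on `C`.
  have h1 := hCmax (y := fun n => {M : Matrix (Fin n) (Fin n) (H →L[ℂ] H) |
      M.IsHermitian ∧ M.map φ' ∈ OperatorSystem.cone n})
    ⟨isMatrixOrder_of_isCompletelyPositive hcp,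
      fun n M hM => ⟨OperatorSystem.isHermitian_of_mem hM, hcp n M hM⟩,
      fun n M hM => by
        refine (hι.mem_cone_iff n M).mp ?_
        have h2 := hM.2
        rw [Matrix.map_map] at h2
        convert h2 using 1
        exact Matrix.ext fun i j => (hfix (M i j)).symm⟩
    (fun n M hM => ⟨hCP.1.isHermitian hM, hle n M (hφ n M hM)⟩)
  exact hφ n M (h1 n ⟨hM, hMφ'⟩)

section Positive

/-- Positivity of a single element of an operator system. -/
def IsPos (x : V) : Prop := (Matrix.of fun _ _ => x : Matrix (Fin 1) (Fin 1) V) ∈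
  OperatorSystem.cone 1

theorem IsPos.map {T : Type*} [AddCommGroup T] [Module ℂ T] [StarAddMonoid T] [StarModule ℂ T]
    [OperatorSystem T] {φ : V →ₗ[ℂ] T} (hφ : IsCompletelyPositive φ) {x : V} (hx : IsPos x) :
    IsPos (φ x) := hφ 1 _ hx

theorem isPos_zero : IsPos (0 : V) := OperatorSystem.zero_mem 1

theorem IsPos.add {x y : V} (hx : IsPos x) (hy : IsPos y) : IsPos (x + y) :=
  OperatorSystem.add_mem hx hy

theorem IsPos.smul {x : V} {r : ℝ} (hr : 0 ≤ r) (hx : IsPos x) : IsPos ((r : ℂ) • x) :=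
  OperatorSystem.smul_mem r hr hx

theorem IsPos.eq_zero {x : V} (hx : IsPos x) (hx' : IsPos (-x)) : x = 0 :=
  congrFun (congrFun (OperatorSystem.eq_zero_of_mem_of_neg_mem hx hx') 0) 0

theorem isPos_of_forall {x : V} (h : ∀ r : ℝ, 0 < r → IsPos ((r : ℂ) • OperatorSystem.unit + x)) :
    IsPos x := by
  refine OperatorSystem.archimedean _ fun r hr => ?_
  have h1 := h r hr
  unfold IsPos at h1
  convert h1 using 1
  ext i j; fin_cases i; fin_cases j; simp

theorem exists_isPos_sub {x : V} (hx : star x = x) :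
    ∃ r : ℝ, 0 < r ∧ IsPos ((r : ℂ) • OperatorSystem.unit - x) := by
  obtain ⟨r, hr, h⟩ := OperatorSystem.order_unit _ (isHermitian_of_one hx)
  refine ⟨r, hr, ?_⟩
  unfold IsPos
  convert h using 1
  ext i j; fin_cases i; fin_cases j; simp

end Positive

/-- The average of the first `k` positive powers of `φ`. -/
def powerAverage (φ : Module.End ℂ V) (k : ℕ) : Module.End ℂ V :=
  (k : ℂ)⁻¹ • ∑ i ∈ Finset.range k, φ ^ (i + 1)

theorem map_powerAverage_mem_cone {φ : Module.End ℂ V} {n : ℕ} {M : Matrix (Fin n) (Fin n) V}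
    (k : ℕ) (hM : ∀ i : ℕ, M.map (DFunLike.coe (φ ^ (i + 1))) ∈ OperatorSystem.cone n) :
    M.map (powerAverage φ k) ∈ OperatorSystem.cone n := by
  have h1 := OperatorSystem.smul_mem (k : ℝ)⁻¹ (by positivity)
    (Finset.sum_induction (fun i => M.map (DFunLike.coe (φ ^ (i + 1))))
      (· ∈ OperatorSystem.cone n) (fun _ _ => OperatorSystem.add_mem) (OperatorSystem.zero_mem n)
      (s := Finset.range k) fun i _ => hM i)
  convert h1 using 1
  refine Matrix.ext fun p q => ?_
  simp [Matrix.sum_apply, powerAverage]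

/-- The averages of the powers of `φ` force a map with maximal induced order to be idempotent. -/
theorem isIdempotent_of_maximal {φ : Module.End ℂ V} (hφ : IsCompletelyPositive φ)
    (hφ1 : φ OperatorSystem.unit = OperatorSystem.unit)
    (hmax : ∀ k : ℕ, 0 < k → ∀ x, star x = x →
      IsPos (powerAverage φ k x) → IsPos (φ x))
    (x : V) : φ (φ x) = φ x := by
  have hstar := hφ.map_star
  have hpow1 : ∀ i, (φ ^ i) OperatorSystem.unit = OperatorSystem.unit := fun i => by
    induction i with
    | zero => simp
    | succ i ih => rw [pow_succ, Module.End.mul_apply, hφ1, ih]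
  have key : ∀ x, star x = x → IsPos (φ x - φ (φ x)) := by
    intro x hx
    obtain ⟨r₁, hr₁, h₁⟩ := exists_isPos_sub hx
    obtain ⟨r₂, hr₂, h₂⟩ := exists_isPos_sub (x := -x) (by rw [star_neg, hx])
    refine isPos_of_forall fun ε hε => ?_
    obtain ⟨k, hk⟩ := exists_nat_gt ((r₁ + r₂) / ε)
    have hk0 : (0 : ℝ) < k := lt_of_le_of_lt (by positivity) hk
    have hkε : 0 ≤ k * ε - (r₁ + r₂) := by
      have := (div_lt_iff₀ hε).mp hk
      linarith
    have hkC : (k : ℂ) ≠ 0 := by exact_mod_cast hk0.ne'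
    -- On `x - φ x` the sum telescopes to `φ x - φ ^ (k + 1) x`, which is at least `-(r₁ + r₂)`
    -- times the unit. After division by `k` this is absorbed by `ε`.
    have h3 := hmax k (by exact_mod_cast hk0) ((ε : ℂ) • OperatorSystem.unit + (x - φ x))
      (by rw [star_add, star_smul, star_sub, ← hstar, hx, OperatorSystem.star_unit]; simp) (by
        have h4 : (∑ i ∈ Finset.range k, φ ^ (i + 1) : Module.End ℂ V)
            ((ε : ℂ) • OperatorSystem.unit + (x - φ x)) =
            ((k * ε : ℝ) : ℂ) • OperatorSystem.unit + (φ x - (φ ^ (k + 1)) x) := by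
          rw [LinearMap.sum_apply]
          have h5 : ∀ i, (φ ^ (i + 1)) ((ε : ℂ) • OperatorSystem.unit + (x - φ x)) =
              (ε : ℂ) • OperatorSystem.unit + ((φ ^ (i + 1)) x - (φ ^ (i + 1 + 1)) x) := fun i => by
            rw [map_add, map_smul, hpow1, map_sub, pow_succ φ (i + 1), Module.End.mul_apply]
          simp only [h5, Finset.sum_add_distrib]
          rw [Finset.sum_range_sub' (fun i => (φ ^ (i + 1)) x), Finset.sum_const, Finset.card_range]
          simp only [zero_add, pow_one]
          congr 1
          rw [← Nat.cast_smul_eq_nsmul ℂ, smul_smul]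
          push_cast; rfl
        have h6 : IsPos (((k * ε : ℝ) : ℂ) • OperatorSystem.unit + (φ x - (φ ^ (k + 1)) x)) := by
          have h7 := (((h₂.map hφ).add (h₁.map (isCompletelyPositive_pow hφ (k + 1)))).add
            (IsPos.smul hkε (x := (OperatorSystem.unit : V)) (by
              have := (OperatorSystem.isMatrixOrder V).posOn_unit 1 (fun _ => ())
              exact this)))
          convert h7 using 1
          rw [map_sub, map_sub, map_smul, map_smul, hφ1, hpow1, map_neg]
          push_cast
          module
        rw [powerAverage, LinearMap.smul_apply, h4]
        have h8 := h6.smul (inv_nonneg.mpr hk0.le)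
        simpa using h8)
    rw [map_add, map_smul, hφ1, map_sub] at h3
    exact h3
  refine of_forall_isSelfAdjoint (p := fun x => φ (φ x) = φ x)
    (fun x y hx hy => by rw [map_add, map_add, hx, hy])
    (fun c x hx => by rw [map_smul, map_smul, hx]) (fun x hx => ?_) x
  have h1 := key x hx
  have h2 := key (-x) (by rw [star_neg, hx])
  rw [map_neg, map_neg] at h2
  have h3 := h1.eq_zero (by convert h2 using 1; abel)
  exact (sub_eq_zero.mp h3).symm

/-- Existence of the injective envelope. -/
theorem exists_isInjectiveEnvelope (S : Type u) [AddCommGroup S] [Module ℂ S] [StarAddMonoid S]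
    [StarModule ℂ S] [OperatorSystem S] :
    ∃ (I : Type u) (_ : AddCommGroup I) (_ : Module ℂ I) (_ : StarAddMonoid I)
      (_ : StarModule ℂ I) (_ : OperatorSystem I) (κ : S →ₗ[ℂ] I), IsInjectiveEnvelope κ := by
  obtain ⟨H, _, _, _, ι, hι⟩ := exists_isInclusion_clm S
  obtain ⟨φ, hφ, hφι, hmax⟩ := exists_maximal_order ι hι
  have hφ1 : φ OperatorSystem.unit = OperatorSystem.unit := by
    rw [← hι.map_unit, hφι]
  have hpowι : ∀ i x, ((φ : Module.End ℂ (H →L[ℂ] H)) ^ i) (ι x) = ι x := fun i x => by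
    induction i with
    | zero => simp
    | succ i ih => rw [pow_succ, Module.End.mul_apply, hφι, ih]
  have hidem : ∀ x, φ (φ x) = φ x := by
    refine isIdempotent_of_maximal hφ hφ1 fun k hk x hx hpos => ?_
    refine hmax (powerAverage φ k) (fun n M hM => map_powerAverage_mem_cone k fun i => isCompletelyPositive_pow hφ (i + 1) n M hM)
      (fun x => ?_) (fun n M hM => map_powerAverage_mem_cone k fun i => ?_) 1 _ (isHermitian_of_one hx) hpos
    · have hk' : (k : ℂ) ≠ 0 := by exact_mod_cast hk.ne'
      rw [powerAverage, LinearMap.smul_apply, LinearMap.sum_apply]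
      simp only [hpowι, Finset.sum_const, Finset.card_range]
      rw [← Nat.cast_smul_eq_nsmul ℂ, smul_smul, inv_mul_cancel₀ hk', one_smul]
    -- The averages begin with the first power, so each term factors through `φ` and is positive
    -- wherever `φ` is.
    · have := isCompletelyPositive_pow hφ i n _ hM
      rw [Matrix.map_map] at this
      rw [pow_succ]
      exact this
  obtain ⟨I, hImem⟩ : ∃ I : OperatorSubsystem (H →L[ℂ] H), I.toSubmodule = LinearMap.range φ :=
    ⟨{ LinearMap.range φ with
      star_mem' := by
        rintro _ ⟨x, rfl⟩
        exact ⟨star x, hφ.map_star x⟩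
      unit_mem' := ⟨_, hφ1⟩ }, rfl⟩
  have hφmem : ∀ x, φ x ∈ I.toSubmodule := fun x => hImem ▸ ⟨x, rfl⟩
  have hI : ∀ y : I.toSubmodule, φ y = y := fun y => by
    obtain ⟨x, hx⟩ : (y : H →L[ℂ] H) ∈ LinearMap.range φ := hImem ▸ y.2
    rw [← hx, hidem]
  let κ : S →ₗ[ℂ] I.toSubmodule := ι.codRestrict I.toSubmodule fun x => hφι x ▸ hφmem (ι x)
  let φI : (H →L[ℂ] H) →ₗ[ℂ] I.toSubmodule := φ.codRestrict I.toSubmodule hφmem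
  have hφI : IsCompletelyPositive φI := fun n M hM => hφ n M hM
  have hφI' : ∀ y : I.toSubmodule, φI y = y := fun y => Subtype.ext (hI y)
  refine ⟨I.toSubmodule, inferInstance, inferInstance, inferInstance, inferInstance, inferInstance,
    κ, ⟨isInclusion_of_mem_cone_iff (Subtype.ext hι.map_unit) fun n M => hι.mem_cone_iff n M,
      ?_, ?_⟩⟩
  · intro X Y _ _ _ _ _ _ _ _ _ _ j f hj hf
    obtain ⟨g, hg, hgj⟩ := isInjectiveSystem_clm H X Y j (I.toSubmodule.subtype ∘ₗ f) hj
      (I.isInclusion_subtype.isCompletelyPositive.comp hf)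
    refine ⟨φI ∘ₗ g, hφI.comp hg, fun x => ?_⟩
    rw [LinearMap.comp_apply, hgj]
    exact hφI' (f x)
  · intro W _ _ _ _ _ f g hW hf hg hgf y
    obtain ⟨h, hh, hhg⟩ := hW W I.toSubmodule g LinearMap.id hg (fun n M hM => by simpa using hM)
    have hhg' : ∀ x, h (g x) = x := hhg
    have hgκ : ∀ x, g (f x) = κ x := fun x => LinearMap.congr_fun hgf x
    -- `ψ` factors through `φ`, so by maximality both induce the same order and `ψ z = 0` forces `φ
    -- z = 0`. As `ψ` kills `y - g (h y)` and `φ` fixes `I`, it follows that `y = g (h y)`.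
    let ψ : (H →L[ℂ] H) →ₗ[ℂ] (H →L[ℂ] H) := I.toSubmodule.subtype ∘ₗ g ∘ₗ h ∘ₗ φI
    have hgh := I.isInclusion_subtype.isCompletelyPositive.comp (hg.isCompletelyPositive.comp hh)
    have hψcp : IsCompletelyPositive ψ := hgh.comp hφI
    have hψι : ∀ x, ψ (ι x) = ι x := fun x => by
      have h1 : φI (ι x) = κ x := hφI' (κ x)
      change (g (h (φI (ι x))) : H →L[ℂ] H) = _
      rw [h1, ← hgκ, hhg', hgκ]; rfl
    have hψmax := hmax ψ hψcp hψι fun n M hM => by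
      have h1 : M.map φI ∈ OperatorSystem.cone n := hM
      have h2 := hgh n _ h1
      rw [Matrix.map_map] at h2
      exact h2
    have hzero : ∀ z, star z = z → ψ z = 0 → φ z = 0 := fun z hz hψz => by
      have h1 : ∀ z, star z = z → ψ z = 0 → IsPos (φ z) := fun z hz hψz =>
        hψmax 1 _ (isHermitian_of_one hz) (by
          have : IsPos (ψ z) := by rw [hψz]; exact isPos_zero
          exact this)
      refine (h1 z hz hψz).eq_zero ?_
      rw [← map_neg]
      exact h1 (-z) (by rw [star_neg, hz]) (by rw [map_neg, hψz, neg_zero])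
    have hzero' : ∀ z, ψ z = 0 → φ z = 0 := fun z hz => by
      have hzs : ψ (star z) = 0 := by rw [hψcp.map_star, hz, star_zero]
      have ha := hzero (z + star z) (by rw [star_add, star_star, add_comm])
        (by rw [map_add, hz, hzs, add_zero])
      have hb := hzero (Complex.I • (z - star z)) (by
          rw [star_smul, star_sub, star_star, RCLike.star_def, Complex.conj_I]; module)
        (by rw [map_smul, map_sub, hz, hzs, sub_zero, smul_zero])
      rw [map_smul] at hb
      have hb' := (smul_eq_zero.mp hb).resolve_left Complex.I_ne_zero
      have : z = (2⁻¹ : ℂ) • ((z + star z) + (z - star z)) := by module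
      rw [this, map_smul, map_add, ha, hb', add_zero, smul_zero]
    have hψI : ∀ y : I.toSubmodule, ψ y = g (h y) := fun y => by
      change (g (h (φI y)) : H →L[ℂ] H) = _
      rw [hφI']
    have h1 := hzero' ((y : H →L[ℂ] H) - g (h y)) (by
      rw [map_sub, hψI, hψI, hhg', sub_self])
    rw [map_sub, hI, hI, sub_eq_zero] at h1
    exact ⟨h y, Subtype.ext h1.symm⟩

end Envelope

/-! ### Cones of the maximal tensor product -/

section TensorCones

variable {S T : Type u}
  [AddCommGroup S] [Module ℂ S] [StarAddMonoid S] [StarModule ℂ S] [OperatorSystem S]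
  [AddCommGroup T] [Module ℂ T] [StarAddMonoid T] [StarModule ℂ T] [OperatorSystem T]

theorem mem_preMaxCone_of_posOn {ι κ : Type*} [Fintype ι] [Fintype κ] {n : ℕ} {P : Matrix ι ι S}
    {Q : Matrix κ κ T} (hP : PosOn OperatorSystem.cone P) (hQ : PosOn OperatorSystem.cone Q)
    (X : Matrix (ι × κ) (Fin n) ℂ) :
    scalarConj X (Matrix.kroneckerMap (fun s t => s ⊗ₜ[ℂ] t) P Q) ∈ preMaxCone S T n := by
  let f := (Fintype.equivFin ι).symm
  let g := (Fintype.equivFin κ).symm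
  refine ⟨_, _, P.submatrix f f, Q.submatrix g g, X.submatrix (Prod.map f g) id, hP _ f, hQ _ g, ?_⟩
  ext i j
  simp only [scalarConj_apply]
  rw [← (f.prodCongr g).sum_comp]
  refine Finset.sum_congr rfl fun k _ => ?_
  rw [← (f.prodCongr g).sum_comp]
  rfl

theorem kroneckerMap_submatrix_mem_preMaxCone {k m n : ℕ} {P : Matrix (Fin k) (Fin k) S}
    {Q : Matrix (Fin m) (Fin m) T} (hP : P ∈ OperatorSystem.cone k) (hQ : Q ∈ OperatorSystem.cone m)
    (f : Fin n → Fin k × Fin m) :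
    (Matrix.kroneckerMap (fun s t => s ⊗ₜ[ℂ] t) P Q).submatrix f f ∈ preMaxCone S T n := by
  classical
  exact ⟨k, m, P, Q, _, hP, hQ, submatrix_eq_scalarConj f _⟩

theorem IsMatrixOrder.posOn_fromBlocks {V : Type*} [AddCommGroup V] [Module ℂ V] [StarAddMonoid V]
    [StarModule ℂ V] {e : V} {C : (n : ℕ) → Set (Matrix (Fin n) (Fin n) V)}
    (hC : IsMatrixOrder e C) {ι κ : Type*} [Fintype ι] [Fintype κ] {M : Matrix ι ι V}
    {N : Matrix κ κ V} (hM : PosOn C M) (hN : PosOn C N) : PosOn C (Matrix.fromBlocks M 0 0 N) := by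
  classical
  have h1 := hC.posOn_conj (Matrix.of fun (i : ι) (j : ι ⊕ κ) => if j = Sum.inl i then (1 : ℂ) else 0)
    hM
  have h2 := hC.posOn_conj (Matrix.of fun (i : κ) (j : ι ⊕ κ) => if j = Sum.inr i then (1 : ℂ) else 0)
    hN
  convert hC.posOn_add h1 h2 using 1
  ext (i | i) (j | j) <;> simp [scalarConj_apply, apply_ite]

/-- Use the direct sums `P ⊕ P'` and `Q ⊕ Q'`, with a scalar matrix vanishing on the mixed blocks.
-/
theorem preMaxCone_add_mem {n : ℕ} {M N : Matrix (Fin n) (Fin n) (S ⊗[ℂ] T)}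
    (hM : M ∈ preMaxCone S T n) (hN : N ∈ preMaxCone S T n) : M + N ∈ preMaxCone S T n := by
  obtain ⟨k, m, P, Q, X, hP, hQ, rfl⟩ := hM
  obtain ⟨k', m', P', Q', X', hP', hQ', rfl⟩ := hN
  have hS := OperatorSystem.isMatrixOrder S
  have hT := OperatorSystem.isMatrixOrder T
  have := mem_preMaxCone_of_posOn
    (hS.posOn_fromBlocks (hS.posOn_iff.mpr hP) (hS.posOn_iff.mpr hP'))
    (hT.posOn_fromBlocks (hT.posOn_iff.mpr hQ) (hT.posOn_iff.mpr hQ'))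
    (Matrix.of fun x i => match x with
      | (Sum.inl a, Sum.inl c) => X (a, c) i
      | (Sum.inr a, Sum.inr c) => X' (a, c) i
      | _ => 0)
  convert this using 1
  ext i j
  simp [scalarConj_apply, Fintype.sum_prod_type]

theorem preMaxCone_isMatrixOrder (S T : Type u)
    [AddCommGroup S] [Module ℂ S] [StarAddMonoid S] [StarModule ℂ S] [OperatorSystem S]
    [AddCommGroup T] [Module ℂ T] [StarAddMonoid T] [StarModule ℂ T] [OperatorSystem T] :
    IsMatrixOrder ((OperatorSystem.unit : S) ⊗ₜ[ℂ] (OperatorSystem.unit : T))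
      (preMaxCone S T) where
  isHermitian := by
    rintro n _ ⟨k, m, P, Q, X, hP, hQ, rfl⟩
    refine isHermitian_scalarConj X ?_
    ext ⟨a, c⟩ ⟨b, d⟩
    have h1 : star (P b a) = P a b :=
      congrFun (congrFun (OperatorSystem.isHermitian_of_mem hP) a) b
    have h2 : star (Q d c) = Q c d :=
      congrFun (congrFun (OperatorSystem.isHermitian_of_mem hQ) c) d
    simp [h1, h2]
  zero_mem n := ⟨0, 0, 0, 0, 0, OperatorSystem.zero_mem 0, OperatorSystem.zero_mem 0, by
    ext i j; simp [scalarConj_apply]⟩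
  add_mem := preMaxCone_add_mem
  smul_mem := by
    rintro n _ r hr ⟨k, m, P, Q, X, hP, hQ, rfl⟩
    refine ⟨k, m, (r : ℂ) • P, Q, X, OperatorSystem.smul_mem r hr hP, hQ, ?_⟩
    rw [← scalarConj_smul]
    congr 1
  conj_mem := by
    rintro n n' _ Y ⟨k, m, P, Q, X, hP, hQ, rfl⟩
    exact ⟨k, m, P, Q, X * Y, hP, hQ, scalarConj_scalarConj X Y _⟩
  exists_bound z := by
    have htmul : ∀ (s : S) (t : T), ∃ r : ℝ, 0 < r ∧
        !![(r : ℂ) • ((OperatorSystem.unit : S) ⊗ₜ[ℂ] (OperatorSystem.unit : T)), s ⊗ₜ[ℂ] t;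
          star (s ⊗ₜ[ℂ] t), (r : ℂ) • ((OperatorSystem.unit : S) ⊗ₜ[ℂ] (OperatorSystem.unit : T))] ∈
          preMaxCone S T 2 := fun s t => by
      obtain ⟨r, hr, h⟩ := (OperatorSystem.isMatrixOrder S).exists_bound s
      obtain ⟨r', hr', h'⟩ := (OperatorSystem.isMatrixOrder T).exists_bound t
      refine ⟨r * r', mul_pos hr hr', ?_⟩
      -- The diagonal compression of the Kronecker product of the two bounds is the bound for `s ⊗
      -- t`.
      have h1 := kroneckerMap_submatrix_mem_preMaxCone h h' fun i : Fin 2 => (i, i)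
      convert h1 using 1
      ext i j
      fin_cases i <;> fin_cases j <;>
        simp [-Complex.coe_smul, TensorProduct.smul_tmul', TensorProduct.tmul_smul, smul_smul,
          mul_comm]
    induction z using TensorProduct.induction_on with
    | zero => simpa using htmul 0 0
    | tmul s t => exact htmul s t
    | add y z hy hz =>
      obtain ⟨r, hr, h⟩ := hy
      obtain ⟨r', hr', h'⟩ := hz
      refine ⟨r + r', add_pos hr hr', ?_⟩
      convert preMaxCone_add_mem h h' using 1
      ext i j
      fin_cases i <;> fin_cases j <;> simp [add_smul]

theorem preMaxCone_map {S' : Type u} [AddCommGroup S'] [Module ℂ S'] [StarAddMonoid S']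
    [StarModule ℂ S'] [OperatorSystem S'] {g : S →ₗ[ℂ] S'} (hg : IsCompletelyPositive g) {n : ℕ}
    {u : Matrix (Fin n) (Fin n) (S ⊗[ℂ] T)} (hu : u ∈ preMaxCone S T n) :
    u.map (TensorProduct.map g (LinearMap.id : T →ₗ[ℂ] T)) ∈ preMaxCone S' T n := by
  obtain ⟨k, m, P, Q, X, hP, hQ, rfl⟩ := hu
  refine ⟨k, m, P.map g, Q, X, hg k P hP, hQ, ?_⟩
  rw [scalarConj_map]
  congr 1

theorem diagonal_unit_map {V W : Type*} [AddCommGroup V] [Module ℂ V] [AddCommGroup W] [Module ℂ W]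
    {n : ℕ} (r : ℂ) (e : V) (u : Matrix (Fin n) (Fin n) V) (f : V →ₗ[ℂ] W) :
    (r • Matrix.diagonal (fun _ => e) + u).map f = r • Matrix.diagonal (fun _ => f e) + u.map f := by
  ext i j
  by_cases h : i = j <;> simp [h]

theorem maxCone_map {S' : Type u} [AddCommGroup S'] [Module ℂ S'] [StarAddMonoid S']
    [StarModule ℂ S'] [OperatorSystem S'] {g : S →ₗ[ℂ] S'} (hg : IsCompletelyPositive g)
    (hg1 : g OperatorSystem.unit = OperatorSystem.unit) {n : ℕ}
    {u : Matrix (Fin n) (Fin n) (S ⊗[ℂ] T)} (hu : u ∈ maxCone S T n) :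
    u.map (TensorProduct.map g (LinearMap.id : T →ₗ[ℂ] T)) ∈ maxCone S' T n := fun r hr => by
  have h := preMaxCone_map hg (hu r hr)
  rw [diagonal_unit_map] at h
  simpa [hg1] using h

variable {H : Type*} [NormedAddCommGroup H] [InnerProductSpace ℂ H] [CompleteSpace H]

theorem posOn_of_sum_inner_nonneg {ι : Type*} [Fintype ι] {M : Matrix ι ι (H →L[ℂ] H)}
    (h : ∀ v : ι → H, 0 ≤ ∑ p, ∑ q, inner ℂ (v p) (M p q (v q))) :
    PosOn OperatorSystem.cone M := by
  let f := (Fintype.equivFin ι).symm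
  refine (OperatorSystem.isMatrixOrder (H →L[ℂ] H)).posOn_of_equiv f ?_
  rw [mem_cone_iff_sum_inner_nonneg]
  intro v
  have h1 := h (v ∘ f.symm)
  rw [← f.sum_comp] at h1
  refine h1.trans_eq (Finset.sum_congr rfl fun p _ => ?_)
  rw [← f.sum_comp]
  simp

/-- The product map `x ⊗ y ↦ φ(x) ψ(y)`. -/
abbrev productMap (φ : S →ₗ[ℂ] (H →L[ℂ] H)) (ψ : T →ₗ[ℂ] (H →L[ℂ] H)) :
    S ⊗[ℂ] T →ₗ[ℂ] (H →L[ℂ] H) :=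
  TensorProduct.lift ((LinearMap.mul ℂ (H →L[ℂ] H)).compl₁₂ φ ψ)

theorem productMap_tmul (φ : S →ₗ[ℂ] (H →L[ℂ] H)) (ψ : T →ₗ[ℂ] (H →L[ℂ] H)) (x : S) (y : T) :
    productMap φ ψ (x ⊗ₜ y) = φ x * ψ y := by
  simp [productMap]

/-- The root `R` of the matrix `φ(P)` has entries commuting with the range of `ψ`. Moving `star R`
to the left of the inner product leaves a sum of forms of the positive matrix `ψ(Q)`. -/
theorem isMatrixPositive_productMap {φ : S →ₗ[ℂ] (H →L[ℂ] H)} {ψ : T →ₗ[ℂ] (H →L[ℂ] H)}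
    (hφ : IsCompletelyPositive φ) (hψ : IsCompletelyPositive ψ)
    (hcomm : ∀ x y, Commute (φ x) (ψ y)) : IsMatrixPositive (preMaxCone S T) (productMap φ ψ) := by
  rintro n _ ⟨k, m, P, Q, X, hP, hQ, rfl⟩
  have hB := OperatorSystem.isMatrixOrder (H →L[ℂ] H)
  rw [scalarConj_map, ← hB.posOn_iff]
  refine hB.posOn_conj X (posOn_of_sum_inner_nonneg fun v => ?_)
  obtain ⟨R, hR, hRc⟩ := cone_exists_star_mul (hφ k P hP)
  have hRc' : ∀ r a y, Commute (R r a) (ψ y) := fun r a y =>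
    hRc (ψ y) (fun p q => hcomm _ _) r a
  have key : ∀ a b c d, inner ℂ (v (a, c)) (((Matrix.kroneckerMap (fun s t => s ⊗ₜ[ℂ] t) P Q).map
      (productMap φ ψ)) (a, c) (b, d) (v (b, d))) =
      ∑ r, inner ℂ (R r a (v (a, c))) (ψ (Q c d) (R r b (v (b, d)))) := fun a b c d => by
    have h1 : φ (P a b) = ∑ r, star (R r a) * R r b := hR a b
    rw [Matrix.map_apply, Matrix.kroneckerMap_apply, productMap_tmul, h1, Finset.sum_mul, sum_apply,
      inner_sum]
    refine Finset.sum_congr rfl fun r _ => ?_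
    rw [mul_assoc, (hRc' r b (Q c d)).eq, mul_apply_eq_comp, mul_apply_eq_comp,
      ContinuousLinearMap.star_eq_adjoint, ContinuousLinearMap.adjoint_inner_right]
  have h2 : ∀ r, 0 ≤ ∑ c, ∑ d, inner ℂ (∑ a, R r a (v (a, c)))
      (ψ (Q c d) (∑ b, R r b (v (b, d)))) := fun r =>
    sum_inner_nonneg_of_mem_cone (hψ m Q hQ) fun c => ∑ a, R r a (v (a, c))
  have h3 := Finset.sum_nonneg fun r (_ : r ∈ Finset.univ) => h2 r
  refine h3.trans_eq ?_
  simp only [Fintype.sum_prod_type, key, map_sum, sum_inner, inner_sum]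
  calc _ = ∑ c, ∑ r, ∑ d, ∑ b, ∑ a, inner ℂ (R r a (v (a, c))) (ψ (Q c d) (R r b (v (b, d)))) :=
        Finset.sum_comm
    _ = ∑ c, ∑ r, ∑ d, ∑ a, ∑ b, inner ℂ (R r a (v (a, c))) (ψ (Q c d) (R r b (v (b, d)))) :=
        Finset.sum_congr rfl fun c _ => Finset.sum_congr rfl fun r _ =>
          Finset.sum_congr rfl fun d _ => Finset.sum_comm
    _ = ∑ c, ∑ r, ∑ a, ∑ d, ∑ b, inner ℂ (R r a (v (a, c))) (ψ (Q c d) (R r b (v (b, d)))) :=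
        Finset.sum_congr rfl fun c _ => Finset.sum_congr rfl fun r _ => Finset.sum_comm
    _ = ∑ c, ∑ a, ∑ r, ∑ d, ∑ b, inner ℂ (R r a (v (a, c))) (ψ (Q c d) (R r b (v (b, d)))) :=
        Finset.sum_congr rfl fun c _ => Finset.sum_comm
    _ = ∑ a, ∑ c, ∑ r, ∑ d, ∑ b, inner ℂ (R r a (v (a, c))) (ψ (Q c d) (R r b (v (b, d)))) :=
        Finset.sum_comm
    _ = _ := Finset.sum_congr rfl fun a _ => Finset.sum_congr rfl fun c _ => by
      calc _ = ∑ r, ∑ b, ∑ d, inner ℂ (R r a (v (a, c))) (ψ (Q c d) (R r b (v (b, d)))) :=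
            Finset.sum_congr rfl fun r _ => Finset.sum_comm
        _ = ∑ b, ∑ r, ∑ d, inner ℂ (R r a (v (a, c))) (ψ (Q c d) (R r b (v (b, d)))) :=
            Finset.sum_comm
        _ = _ := Finset.sum_congr rfl fun b _ => Finset.sum_comm

theorem map_productMap_mem_cone_of_mem_maxCone {φ : S →ₗ[ℂ] (H →L[ℂ] H)}
    {ψ : T →ₗ[ℂ] (H →L[ℂ] H)} (hφ : IsCompletelyPositive φ) (hψ : IsCompletelyPositive ψ)
    (hcomm : ∀ x y, Commute (φ x) (ψ y)) {n : ℕ} {u : Matrix (Fin n) (Fin n) (S ⊗[ℂ] T)}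
    (hu : u ∈ maxCone S T n) : u.map (productMap φ ψ) ∈ OperatorSystem.cone n := by
  rw [mem_cone_iff_sum_inner_nonneg]
  intro v
  let e := productMap φ ψ ((OperatorSystem.unit : S) ⊗ₜ (OperatorSystem.unit : T))
  let D : Matrix (Fin n) (Fin n) (H →L[ℂ] H) := Matrix.diagonal fun _ => e
  have h1 : ∀ r : ℝ, 0 < r → 0 ≤ (r : ℂ) * (∑ p, ∑ q, inner ℂ (v p) (D p q (v q))) +
      ∑ p, ∑ q, inner ℂ (v p) (u.map (productMap φ ψ) p q (v q)) := fun r hr => by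
    have h2 := isMatrixPositive_productMap hφ hψ hcomm n _ (hu r hr)
    rw [diagonal_unit_map] at h2
    have h3 := sum_inner_nonneg_of_mem_cone h2 v
    refine h3.trans_eq ?_
    simp only [Finset.mul_sum, ← Finset.sum_add_distrib]
    refine Finset.sum_congr rfl fun p _ => Finset.sum_congr rfl fun q _ => ?_
    rw [Matrix.add_apply, add_apply, inner_add_right, Matrix.smul_apply, smul_apply,
      inner_smul_right]
  have hc : Filter.Tendsto (fun r : ℝ => (r : ℂ) * (∑ p, ∑ q, inner ℂ (v p) (D p q (v q))) +
      ∑ p, ∑ q, inner ℂ (v p) (u.map (productMap φ ψ) p q (v q))) (nhdsWithin 0 (Set.Ioi 0))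
      (nhds (((0 : ℝ) : ℂ) * (∑ p, ∑ q, inner ℂ (v p) (D p q (v q))) +
      ∑ p, ∑ q, inner ℂ (v p) (u.map (productMap φ ψ) p q (v q)))) :=
    (Continuous.tendsto (by fun_prop) 0).mono_left nhdsWithin_le_nhds
  have h4 := ge_of_tendsto hc (Filter.eventually_of_mem self_mem_nhdsWithin fun r hr => h1 r hr)
  simpa using h4

end TensorCones

/-! ### Separation by product functionals -/

section SeparatingFunctionals

/-- The `G b` show that the slices of `z` by the `F a` vanish; the coordinates of `z` along a basis
of `W` are then killed by every `F a`. -/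
theorem eq_zero_of_forall_map_functional {V W : Type*} [AddCommGroup V] [Module ℂ V]
    [AddCommGroup W] [Module ℂ W] {α β : Type*} (F : α → V →ₗ[ℂ] ℂ) (G : β → W →ₗ[ℂ] ℂ)
    (hF : ∀ x, (∀ a, F a x = 0) → x = 0) (hG : ∀ y, (∀ b, G b y = 0) → y = 0) (z : V ⊗[ℂ] W)
    (hz : ∀ a b, TensorProduct.map (F a) (G b) z = 0) : z = 0 := by
  classical
  let B := Module.Free.chooseBasis ℂ W
  have h1 : ∀ a, TensorProduct.lid ℂ W (LinearMap.rTensor W (F a) z) = 0 := fun a => by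
    refine hG _ fun b => ?_
    have h2 : G b ∘ₗ (TensorProduct.lid ℂ W).toLinearMap ∘ₗ LinearMap.rTensor W (F a) =
        (TensorProduct.lid ℂ ℂ).toLinearMap ∘ₗ TensorProduct.map (F a) (G b) := by
      ext x y
      simp
    have h3 := LinearMap.congr_fun h2 z
    simpa [hz a b] using h3
  apply (TensorProduct.equivFinsuppOfBasisRight (M := V) B).injective
  rw [map_zero]
  ext i
  refine hF _ fun a => ?_
  have h4 : F a ∘ₗ Finsupp.lapply i ∘ₗ
      (TensorProduct.equivFinsuppOfBasisRight (M := V) B).toLinearMap =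
      B.coord i ∘ₗ (TensorProduct.lid ℂ W).toLinearMap ∘ₗ LinearMap.rTensor W (F a) := by
    ext x y
    simp [mul_comm]
  have h5 := LinearMap.congr_fun h4 z
  simpa [h1 a] using h5

theorem eq_zero_of_forall_inner_self {H : Type*} [NormedAddCommGroup H] [InnerProductSpace ℂ H]
    {a : H →L[ℂ] H} (h : ∀ ξ, inner ℂ ξ (a ξ) = 0) : a = 0 := by
  have h1 := (inner_map_self_eq_zero (a : H →ₗ[ℂ] H)).mp fun x => by
    rw [← inner_conj_symm]
    exact (congrArg _ (h x)).trans (map_zero _)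
  ext x
  exact LinearMap.congr_fun h1 x

end SeparatingFunctionals

/-! ### Commuting positivity implies `el`-positivity -/

section CommCone

variable {S T : Type u}
  [AddCommGroup S] [Module ℂ S] [StarAddMonoid S] [StarModule ℂ S] [OperatorSystem S]
  [AddCommGroup T] [Module ℂ T] [StarAddMonoid T] [StarModule ℂ T] [OperatorSystem T]
  {H : Type*} [NormedAddCommGroup H] [InnerProductSpace ℂ H] [CompleteSpace H]

/-- The functional `x ↦ ⟨ξ, φ(x) ξ⟩`. -/
def vectorFunctional (φ : S →ₗ[ℂ] (H →L[ℂ] H)) (ξ : H) : S →ₗ[ℂ] ℂ where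
  toFun x := inner ℂ ξ (φ x ξ)
  map_add' x y := by rw [map_add, add_apply, inner_add_right]
  map_smul' c x := by rw [map_smul, smul_apply, inner_smul_right]; rfl

theorem isCompletelyPositive_vectorFunctional {φ : S →ₗ[ℂ] (H →L[ℂ] H)}
    (hφ : IsCompletelyPositive φ) (ξ : H) :
    IsCompletelyPositive ((vectorFunctional φ ξ).smulRight
      (1 : EuclideanSpace ℂ PUnit.{u + 1} →L[ℂ] EuclideanSpace ℂ PUnit.{u + 1})) := by
  intro n M hM
  rw [mem_cone_iff_sum_inner_nonneg]
  intro v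
  refine (sum_inner_nonneg_of_mem_cone (hφ n M hM) fun p => v p PUnit.unit • ξ).trans_eq ?_
  refine Finset.sum_congr rfl fun p _ => Finset.sum_congr rfl fun q _ => ?_
  simp [PiLp.inner_apply, vectorFunctional]
  ring

/-- Vector functionals, viewed as maps into operators on a one-dimensional Hilbert space, commute
trivially, and their products separate points. -/
theorem isHermitian_of_mem_commCone {n : ℕ} {u : Matrix (Fin n) (Fin n) (S ⊗[ℂ] T)}
    (hu : u ∈ commCone S T n) : u.IsHermitian := by
  obtain ⟨H, _, _, _, ι, hι⟩ := exists_isInclusion_clm S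
  obtain ⟨K, _, _, _, θ, hθ⟩ := exists_isInclusion_clm T
  ext i j
  rw [Matrix.conjTranspose_apply, ← sub_eq_zero]
  refine eq_zero_of_forall_map_functional (vectorFunctional ι) (vectorFunctional θ)
    (fun x hx => hι.injective ?_) (fun y hy => hθ.injective ?_) _ fun ξ η => ?_
  · rw [map_zero]; exact eq_zero_of_forall_inner_self hx
  · rw [map_zero]; exact eq_zero_of_forall_inner_self hy
  have hφ := isCompletelyPositive_vectorFunctional hι.isCompletelyPositive ξ
  have hψ := isCompletelyPositive_vectorFunctional hθ.isCompletelyPositive η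
  have hcomm : ∀ x y, Commute ((vectorFunctional ι ξ).smulRight
      (1 : EuclideanSpace ℂ PUnit.{u + 1} →L[ℂ] EuclideanSpace ℂ PUnit.{u + 1}) x)
      ((vectorFunctional θ η).smulRight 1 y) := fun x y =>
    ((Commute.one_left _).smul_left _)
  have h1 := congrFun (congrFun
    (OperatorSystem.isHermitian_of_mem (hu _ _ _ hφ hψ hcomm)) i) j
  rw [Matrix.conjTranspose_apply, Matrix.map_apply, Matrix.map_apply,
    ← IsMatrixPositive.map_star (preMaxCone_isMatrixOrder S T)
      (isMatrixPositive_productMap hφ hψ hcomm), ← sub_eq_zero, ← map_sub] at h1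
  have h2 : productMap ((vectorFunctional ι ξ).smulRight
      (1 : EuclideanSpace ℂ PUnit.{u + 1} →L[ℂ] EuclideanSpace ℂ PUnit.{u + 1}))
      ((vectorFunctional θ η).smulRight 1) =
      ((TensorProduct.lid ℂ ℂ).toLinearMap ∘ₗ TensorProduct.map (vectorFunctional ι ξ)
        (vectorFunctional θ η)).smulRight 1 := by
    ext x y : 3
    simp [productMap, smul_smul, mul_comm]
  have h3 := (LinearMap.congr_fun h2 _).symm.trans h1
  rw [LinearMap.smulRight_apply, smul_eq_zero] at h3
  exact (TensorProduct.lid ℂ ℂ).map_eq_zero_iff.mp (h3.resolve_right one_ne_zero)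

theorem exists_star_mul_self_add_eq_smul_one {A : Type*} [CStarAlgebra A] [PartialOrder A]
    [StarOrderedRing A] (c : A) : ∃ (R : ℝ) (d : A), star c * c + star d * d = (R : ℂ) • 1 := by
  obtain ⟨r, -, hr⟩ := exists_smul_one_sub_nonneg (IsSelfAdjoint.star_mul_self c)
  obtain ⟨d, hd⟩ := exists_star_mul_self_of_nonneg hr
  exact ⟨r, d, by rw [← hd]; abel⟩

theorem scalarConj_ite_eq_sum_single {V : Type*} [AddCommGroup V] [Module ℂ V] {m n : ℕ}
    (f : Fin m → Fin n) (M : Matrix (Fin m) (Fin m) V) :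
    scalarConj (Matrix.of fun p i => if f p = i then (1 : ℂ) else 0) M =
      ∑ p, ∑ q, Matrix.single (f p) (f q) (M p q) := by
  ext i j
  simp only [scalarConj_apply, Matrix.sum_apply, Matrix.single, Matrix.of_apply]
  refine Finset.sum_congr rfl fun p _ => Finset.sum_congr rfl fun q _ => ?_
  by_cases h1 : f p = i <;> by_cases h2 : f q = j <;> simp [h1, h2]

/-- A functional `s` separating the image from `preMaxCone` is a positive kernel on `Fin n` for the
algebra `B(K)` and `T`. Its dilation gives commuting maps `π ∘ ι` and `ψ` whose form at the vectors
`V i` is `s`, and this contradicts positivity of `u` on commuting pairs. -/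
theorem map_mem_maxCone_of_mem_commCone {K : Type u} [NormedAddCommGroup K] [InnerProductSpace ℂ K]
    [CompleteSpace K] {ι : S →ₗ[ℂ] (K →L[ℂ] K)} (hι : IsCompletelyPositive ι) {n : ℕ}
    {u : Matrix (Fin n) (Fin n) (S ⊗[ℂ] T)} (hu : u ∈ commCone S T n) :
    u.map (TensorProduct.map ι (LinearMap.id : T →ₗ[ℂ] T)) ∈ maxCone (K →L[ℂ] K) T n := by
  intro r hr
  by_contra hr'
  have hmax := preMaxCone_isMatrixOrder (K →L[ℂ] K) T
  have hstar : ∀ z : S ⊗[ℂ] T, TensorProduct.map ι (LinearMap.id : T →ₗ[ℂ] T) (star z) =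
      star (TensorProduct.map ι (LinearMap.id : T →ₗ[ℂ] T) z) := fun z => by
    induction z using TensorProduct.induction_on with
    | zero => simp
    | tmul x y => simp [hι.map_star]
    | add y z hy hz => simp [hy, hz]
  obtain ⟨s, hs, hs1, hsu⟩ := hmax.exists_separating (by
    refine Matrix.IsHermitian.add ?_ ?_
    · ext i j
      by_cases h : i = j
      · subst h; simp [OperatorSystem.star_unit]
      · simp [h, Ne.symm h]
    · ext i j
      rw [Matrix.conjTranspose_apply, Matrix.map_apply, Matrix.map_apply, ← hstar]
      exact congrArg _ (congrFun (congrFun (isHermitian_of_mem_commCone hu) i) j)) hr'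
  obtain ⟨L, _, _, _, π, ψ, V, -, hψ, hcomm, hV⟩ :=
    (OperatorSystem.isMatrixOrder T).exists_dilation (A := K →L[ℂ] K)
      exists_star_mul_self_add_eq_smul_one
      (fun i j : Fin n => (TensorProduct.mk ℂ (K →L[ℂ] K) T).compr₂
        (s ∘ₗ Matrix.singleLinearMap ℂ i j)) (by
      intro m b Q hQ
      have hP := mem_cone_of_star_mul (Matrix.of fun (_ : Unit) (p : Fin m) => (b p).2)
      have h1 := hs _ (hmax.conj_mem
        (Matrix.of fun p i => if (b p).1 = i then (1 : ℂ) else 0)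
        (kroneckerMap_submatrix_mem_preMaxCone hP hQ fun p => (p, p)))
      rw [scalarConj_ite_eq_sum_single] at h1
      simpa using h1)
  have hφ : IsCompletelyPositive (π.toLinearMap ∘ₗ ι) := (isCompletelyPositive_starAlgHom π).comp hι
  have h2 := sum_inner_nonneg_of_mem_cone (hu L _ _ hφ hψ fun x y => hcomm (ι x) y) V
  have h3 : ∀ (i j : Fin n) (z : S ⊗[ℂ] T),
      inner ℂ (V i) (productMap (π.toLinearMap ∘ₗ ι) ψ z (V j)) =
      s (Matrix.single i j (TensorProduct.map ι (LinearMap.id : T →ₗ[ℂ] T) z)) := fun i j z => by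
    induction z using TensorProduct.induction_on with
    | zero => simp
    | tmul x y =>
      rw [productMap_tmul, mul_apply_eq_comp]
      simpa using hV i j (ι x) y
    | add y z hy hz =>
      rw [map_add, map_add, add_apply, inner_add_right, hy, hz, Matrix.single_add, map_add]
  simp only [Matrix.map_apply] at h2
  simp only [h3, ← map_sum] at h2
  have h4 := Matrix.matrix_eq_sum_single (u.map (TensorProduct.map ι (LinearMap.id : T →ₗ[ℂ] T)))
  simp only [Matrix.map_apply] at h4
  rw [← h4] at h2
  rw [map_add, map_smul, hs1] at hsu
  have h5 := (Complex.le_def.mp hsu).1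
  have h6 := (Complex.le_def.mp h2).1
  simp at h5 h6
  linarith

theorem commCone_subset_elCone {I : Type u} [AddCommGroup I] [Module ℂ I] [StarAddMonoid I]
    [StarModule ℂ I] [OperatorSystem I] {κ : S →ₗ[ℂ] I} (hκ : IsInclusion κ)
    (hI : IsInjectiveSystem I) (n : ℕ) : commCone S T n ⊆ elCone T κ n := by
  intro u hu
  obtain ⟨H, _, _, _, ι, hι⟩ := exists_isInclusion_clm S
  obtain ⟨g, hg, hgι⟩ := hI _ _ ι κ hι hκ.isCompletelyPositive
  have h := maxCone_map hg (by rw [← hι.map_unit, hgι, hκ.map_unit])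
    (map_mem_maxCone_of_mem_commCone hι.isCompletelyPositive hu)
  rw [Matrix.map_map] at h
  have h1 : TensorProduct.map g (LinearMap.id : T →ₗ[ℂ] T) ∘ₗ
      TensorProduct.map ι (LinearMap.id : T →ₗ[ℂ] T) = TensorProduct.map κ LinearMap.id := by
    ext x y
    simp [hgι]
  rw [← LinearMap.coe_comp, h1] at h
  exact h

end CommCone

/-! ### Multiplicative domains -/

section MultiplicativeDomain

variable {H : Type*} [NormedAddCommGroup H] [InnerProductSpace ℂ H] [CompleteSpace H]

theorem sum_apply_eq_zero_of_mem_cone {n : ℕ} {M : Matrix (Fin n) (Fin n) (H →L[ℂ] H)}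
    (hM : M ∈ OperatorSystem.cone n) {x : Fin n → H}
    (hx : ∑ p, ∑ q, inner ℂ (x p) (M p q (x q)) = 0) (p : Fin n) : ∑ q, M p q (x q) = 0 := by
  obtain ⟨R, hR, -⟩ := cone_exists_star_mul hM
  simp only [hR] at hx ⊢
  rw [sum_inner_star_mul_self,
    Finset.sum_eq_zero_iff_of_nonneg fun r _ => complex_inner_self_nonneg _] at hx
  have h1 : ∀ r, ∑ q, R r q (x q) = 0 := fun r =>
    inner_self_eq_zero.mp (hx r (Finset.mem_univ r))
  simp only [sum_apply, mul_apply_eq_comp]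
  rw [Finset.sum_comm]
  simp only [← map_sum, h1, map_zero, Finset.sum_const_zero]

/-- The upper left corner is the Gram matrix of the row `(star t, 1)`, so the form vanishes at `(v,
-star t v, 0)`. A positive matrix kills such a vector, and its last row says `Z' = Y' * star t`. -/
theorem eq_mul_of_mem_cone {t Z Y Z' Y' D : H →L[ℂ] H}
    (h : !![t * star t, t, Z; star t, 1, Y; Z', Y', D] ∈ OperatorSystem.cone 3) : Z = t * Y := by
  have hh := OperatorSystem.isHermitian_of_mem h
  have hZ : star Z' = Z := congrFun (congrFun hh 0) 2
  have hY : star Y' = Y := congrFun (congrFun hh 1) 2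
  have h1 : Z' = Y' * star t := by
    ext v
    have h2 := sum_apply_eq_zero_of_mem_cone h (x := ![v, -(star t v), 0])
      (by simp [Fin.sum_univ_three]) 2
    simp [Fin.sum_univ_three] at h2
    simpa [add_neg_eq_zero] using h2
  rw [← hZ, h1, star_mul, star_star, hY]

end MultiplicativeDomain

/-! ### Faithful representations of C*-algebras -/

section FaithfulRepresentation

/-- Embed `A` in some `B(H)` as an operator system and dilate, with `T = ℂ`. The embedding is a
compression of the resulting representation, which therefore reflects positivity as well. -/
theorem exists_isInclusion_starAlgHom (A : Type u) [CStarAlgebra A] [PartialOrder A]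
    [StarOrderedRing A] :
    ∃ (K : Type u) (_ : NormedAddCommGroup K) (_ : InnerProductSpace ℂ K) (_ : CompleteSpace K)
      (π : A →⋆ₐ[ℂ] (K →L[ℂ] K)), IsInclusion π.toLinearMap := by
  obtain ⟨H, _, _, _, θ, hθ⟩ := exists_isInclusion_clm A
  let f : H → H → A →ₗ[ℂ] ℂ := fun ξ η =>
    { toFun := fun x => inner ℂ ξ (θ x η)
      map_add' := fun x y => by rw [map_add, add_apply, inner_add_right]
      map_smul' := fun c x => by rw [map_smul, smul_apply, inner_smul_right]; rfl }
  have hf : ∀ ξ η x, f ξ η x = inner ℂ ξ (θ x η) := fun _ _ _ => rfl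
  obtain ⟨K, _, _, _, π, ψ, V, hψ1, -, -, hV⟩ :=
    (OperatorSystem.isMatrixOrder ℂ).exists_dilation (A := A)
      exists_star_mul_self_add_eq_smul_one
      (fun ξ η => (LinearMap.mul ℂ ℂ) ∘ₗ f ξ η) (by
      intro m b Q hQ
      obtain ⟨R, hR, -⟩ := cone_exists_star_mul hQ
      have hP := mem_cone_of_star_mul (Matrix.of fun (_ : Unit) (p : Fin m) => (b p).2)
      have h1 := Finset.sum_nonneg fun r (_ : r ∈ Finset.univ) => sum_inner_nonneg_of_mem_cone
        (hθ.isCompletelyPositive _ _ hP) fun p => R r p • (b p).1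
      refine h1.trans_eq ?_
      rw [Finset.sum_comm]
      refine Finset.sum_congr rfl fun p _ => ?_
      rw [Finset.sum_comm]
      refine Finset.sum_congr rfl fun q _ => ?_
      rw [hR]
      simp only [LinearMap.comp_apply, LinearMap.mul_apply', hf, Finset.mul_sum, Matrix.map_apply,
        Matrix.of_apply, Finset.univ_unique, Finset.sum_singleton, map_smul, inner_smul_left,
        inner_smul_right]
      refine Finset.sum_congr rfl fun r _ => ?_
      rw [RCLike.star_def]
      ring)
  refine ⟨K, inferInstance, inferInstance, inferInstance, π, isInclusion_of_mem_cone_iff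
    (map_one π) fun n M => ⟨fun hM => ?_, isCompletelyPositive_starAlgHom π n M⟩⟩
  rw [← hθ.mem_cone_iff, mem_cone_iff_sum_inner_nonneg]
  intro v
  refine (sum_inner_nonneg_of_mem_cone hM fun p => V (v p)).trans_eq ?_
  refine Finset.sum_congr rfl fun p _ => Finset.sum_congr rfl fun q _ => ?_
  have h2 := hV (v p) (v q) (M p q) OperatorSystem.unit
  rw [hψ1, one_apply_eq_self] at h2
  refine h2.trans ?_
  rw [LinearMap.comp_apply, LinearMap.mul_apply', hf]
  exact mul_one _

end FaithfulRepresentation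

/-! ### Transport of expectations -/

section DoubleCommutant

variable {S E : Type u}
  [AddCommGroup S] [Module ℂ S] [StarAddMonoid S] [StarModule ℂ S] [OperatorSystem S]
  [AddCommGroup E] [Module ℂ E] [StarAddMonoid E] [StarModule ℂ E] [OperatorSystem E]
  {A : Type u} [CStarAlgebra A] [PartialOrder A] [StarOrderedRing A]

/-- If `E` is injective, an expectation defined on `E` induces one on every operator system
containing `S`. -/
theorem HasDoubleCommutantExpectation.of_isInjectiveSystem {κ : S →ₗ[ℂ] E} {ι : S →ₗ[ℂ] A}
    (h : HasDoubleCommutantExpectation κ ι) (hE : IsInjectiveSystem E)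
    (hκ : IsCompletelyPositive κ) {F : Type u} [AddCommGroup F] [Module ℂ F] [StarAddMonoid F]
    [StarModule ℂ F] [OperatorSystem F] {j : S →ₗ[ℂ] F} (hj : IsInclusion j) :
    HasDoubleCommutantExpectation j ι := by
  obtain ⟨φ, hφ, hφ', hφκ⟩ := h
  obtain ⟨g, hg, hgj⟩ := hE _ _ j κ hj hκ
  exact ⟨φ ∘ₗ g, hφ.comp hg, fun a => hφ' (g a), fun x => by
    rw [LinearMap.comp_apply, hgj, hφκ]⟩

/-- A completely positive retraction of `B(K)` onto a C*-subalgebra is a left module map. -/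
theorem retraction_mul {K : Type u} [NormedAddCommGroup K] [InnerProductSpace ℂ K]
    [CompleteSpace K] {π : A →⋆ₐ[ℂ] (K →L[ℂ] K)} (hπ : IsInclusion π.toLinearMap)
    {F : (K →L[ℂ] K) →ₗ[ℂ] A} (hF : IsCompletelyPositive F) (hFπ : ∀ a, F (π a) = a)
    (b : A) (y : K →L[ℂ] K) : F (π b * y) = b * F y := by
  -- The image of this Gram matrix under `π ∘ F` has the shape required for the multiplicative
  -- domain, with `t = π b`.
  have h1 := mem_cone_of_star_mul (Matrix.of fun (_ : Unit) (p : Fin 3) => ![star (π b), 1, y] p)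
  have h2 := ((isCompletelyPositive_starAlgHom π).comp hF) 3 _ h1
  refine hπ.injective ?_
  change π (F (π b * y)) = π (b * F y)
  rw [map_mul π b]
  refine eq_mul_of_mem_cone (Z' := π (F (star y * star (π b)))) (Y' := π (F (star y)))
    (D := π (F (star y * y))) ?_
  convert h2 using 1
  have h3 : F 1 = 1 := by rw [← map_one π, hFπ]
  ext i j : 1
  fin_cases i <;> fin_cases j <;> simp [← map_star, ← map_mul, hFπ, h3]

/-- Compress the expectation on `B(K)` by a retraction `F` onto `A`. If `b` commutes with `S`, then
`π b` commutes with the values of `Φ`, and the bimodule property moves this relation through `F`. -/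
theorem hasDoubleCommutantExpectation_of_isInclusion {K : Type u} [NormedAddCommGroup K]
    [InnerProductSpace ℂ K] [CompleteSpace K] {π : A →⋆ₐ[ℂ] (K →L[ℂ] K)}
    (hπ : IsInclusion π.toLinearMap) (hA : IsInjectiveSystem A) {ι : S →ₗ[ℂ] A}
    (h : HasDoubleCommutantExpectation (π.toLinearMap ∘ₗ ι) (π.toLinearMap ∘ₗ ι)) :
    HasDoubleCommutantExpectation ι ι := by
  obtain ⟨Φ, hΦ, hΦ', hΦι⟩ := h
  obtain ⟨F, hF, hFπ⟩ := hA _ _ π.toLinearMap LinearMap.id hπ fun n M hM => hM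
  have hFπ' : ∀ a, F (π a) = a := hFπ
  have hr : ∀ (b : A) y, F (y * π b) = F y * b := fun b y => by
    have h1 := retraction_mul hπ hF hFπ' (star b) (star y)
    rw [map_star, ← star_mul, hF.map_star, hF.map_star, ← star_mul] at h1
    exact star_injective h1
  refine ⟨F ∘ₗ Φ ∘ₗ π.toLinearMap, hF.comp (hΦ.comp hπ.isCompletelyPositive), fun a => ?_,
    fun x => ?_⟩
  · rw [Set.mem_centralizer_iff]
    intro b hb
    have h2 := Set.mem_centralizer_iff.mp (hΦ' (π a)) (π b) (by
      rw [Set.mem_centralizer_iff] at hb ⊢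
      rintro _ ⟨x, rfl⟩
      change π (ι x) * π b = π b * π (ι x)
      rw [← map_mul, hb _ ⟨x, rfl⟩, map_mul])
    change b * F (Φ (π a)) = F (Φ (π a)) * b
    rw [← retraction_mul hπ hF hFπ', h2, hr]
  · exact (congrArg F (hΦι x)).trans (hFπ (ι x))

end DoubleCommutant

/-! ### Nuclearity gives expectations -/

section NuclearImpliesExpectation

variable {S I : Type u}
  [AddCommGroup S] [Module ℂ S] [StarAddMonoid S] [StarModule ℂ S] [OperatorSystem S]
  [AddCommGroup I] [Module ℂ I] [StarAddMonoid I] [StarModule ℂ I] [OperatorSystem I]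
  {H : Type u} [NormedAddCommGroup H] [InnerProductSpace ℂ H] [CompleteSpace H]

/-- The commutant of the range of a `*`-preserving map, as an operator subsystem. -/
def commutantSubsystem (ι : S →ₗ[ℂ] (H →L[ℂ] H)) (hι : ∀ x, ι (star x) = star (ι x)) :
    OperatorSubsystem (H →L[ℂ] H) where
  carrier := {t | ∀ x, Commute (ι x) t}
  add_mem' ha hb x := (ha x).add_right (hb x)
  zero_mem' x := Commute.zero_right _
  smul_mem' c _ ha x := (ha x).smul_right c
  star_mem' t ht x := by
    have := (ht (star x)).star_star
    rwa [hι, star_star] at this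
  unit_mem' x := Commute.one_right _

theorem mem_commutantSubsystem {ι : S →ₗ[ℂ] (H →L[ℂ] H)} {hι : ∀ x, ι (star x) = star (ι x)}
    {t : H →L[ℂ] H} : t ∈ (commutantSubsystem ι hι).toSubmodule ↔ ∀ x, Commute (ι x) t := Iff.rfl

theorem preMaxCone_subset_maxCone {S T : Type u}
    [AddCommGroup S] [Module ℂ S] [StarAddMonoid S] [StarModule ℂ S] [OperatorSystem S]
    [AddCommGroup T] [Module ℂ T] [StarAddMonoid T] [StarModule ℂ T] [OperatorSystem T] (n : ℕ) :
    preMaxCone S T n ⊆ maxCone S T n := fun u hu r hr => by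
  have h := preMaxCone_isMatrixOrder S T
  refine h.add_mem ?_ hu
  convert h.posOn_iff.mp (h.posOn_diagonal (fun _ : Fin n => r) fun _ => hr.le) using 1
  rw [← Matrix.diagonal_smul]
  rfl

theorem IsElCommNuclear.hasDoubleCommutantExpectation {κ : S →ₗ[ℂ] I} (h : IsElCommNuclear κ)
    (hκ : IsInclusion κ) {ι : S →ₗ[ℂ] (H →L[ℂ] H)} (hι : IsInclusion ι) :
    HasDoubleCommutantExpectation κ ι := by
  have hκs := hκ.isCompletelyPositive.map_star
  obtain ⟨W, hW⟩ : ∃ W : OperatorSubsystem (H →L[ℂ] H), ∀ t, t ∈ W.toSubmodule ↔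
      ∀ x, Commute (ι x) t :=
    ⟨commutantSubsystem ι hι.isCompletelyPositive.map_star, fun t => mem_commutantSubsystem⟩
  have hmax := preMaxCone_isMatrixOrder I W.toSubmodule
  -- `W` is the commutant of `S`. The embeddings of `S` and `W` commute, so nuclearity with `T = W`
  -- makes their product map positive for the order of `I ⊗ W`.
  have hι' : ∀ x (y : W.toSubmodule), Commute (ι x) (W.toSubmodule.subtype y) := fun x y =>
    (hW y).mp y.2 x
  obtain ⟨Ψ, hΨ, hΨι⟩ := hmax.exists_extension
    (TensorProduct.map κ (LinearMap.id : W.toSubmodule →ₗ[ℂ] W.toSubmodule))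
    (Module.Flat.rTensor_preserves_injective_linearMap κ hκ.injective)
    (fun z => by
      induction z using TensorProduct.induction_on with
      | zero => simp
      | tmul x y => simp [hκs]
      | add y z hy hz => simp [hy, hz])
    (OperatorSystem.unit ⊗ₜ OperatorSystem.unit) (by simp [hκ.map_unit])
    (productMap ι W.toSubmodule.subtype) (fun n Q hQ => by
      have h1 : Q ∈ elCone W.toSubmodule κ n := preMaxCone_subset_maxCone n hQ
      rw [h W.toSubmodule n] at h1
      exact h1 H _ _ hι.isCompletelyPositive W.isInclusion_subtype.isCompletelyPositive hι')
  have hΨκ : ∀ x (y : W.toSubmodule), Ψ (κ x ⊗ₜ y) = ι x * y := fun x y => by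
    have := hΨι (x ⊗ₜ y)
    rwa [TensorProduct.map_tmul, productMap_tmul] at this
  have hΨe : ∀ y : W.toSubmodule, Ψ ((OperatorSystem.unit : I) ⊗ₜ y) = y := fun y => by
    rw [← hκ.map_unit, hΨκ, hι.map_unit]
    exact one_mul _
  have hleft : ∀ (a : I) (y : W.toSubmodule),
      Ψ (a ⊗ₜ y) = y * Ψ (a ⊗ₜ OperatorSystem.unit) := fun a y => by
    obtain ⟨r, hr, hP⟩ := (OperatorSystem.isMatrixOrder I).exists_bound a
    have hyy : (y : H →L[ℂ] H) * star (y : H →L[ℂ] H) ∈ W.toSubmodule := (hW _).mpr fun x =>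
      ((hW _).mp y.2 x).mul_right ((hW _).mp (star y).2 x)
    have hQ : (!![⟨y * star (y : H →L[ℂ] H), hyy⟩, y; star y, OperatorSystem.unit] :
        Matrix (Fin 2) (Fin 2) W.toSubmodule) ∈ OperatorSystem.cone 2 := by
      rw [OperatorSubsystem.mem_cone_iff]
      convert mem_cone_of_star_mul
        (Matrix.of fun (_ : Unit) (p : Fin 2) => ![star (y : H →L[ℂ] H), 1] p) using 1
      ext i j : 1
      fin_cases i <;> fin_cases j <;> simp <;> rfl
    -- These indices select a 3 × 3 matrix that, after division by `r`, has the corner of `t = y`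
    -- and last column `Ψ (a ⊗ y)`, `Ψ (a ⊗ 1)`, both over `r`, and then `1`.
    have h1 := hΨ 3 _ (kroneckerMap_submatrix_mem_preMaxCone hP hQ ![(0, 0), (0, 1), (1, 1)])
    have h2 := OperatorSystem.smul_mem r⁻¹ (inv_nonneg.mpr hr.le) h1
    have hr0 : ((r⁻¹ : ℝ) : ℂ) ≠ 0 := by exact_mod_cast inv_ne_zero hr.ne'
    have hE : ∀ x : W.toSubmodule, ((r⁻¹ : ℝ) : ℂ) •
        Ψ (((r : ℂ) • (OperatorSystem.unit : I)) ⊗ₜ x) = x := fun x => by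
      rw [← TensorProduct.smul_tmul', map_smul, hΨe, smul_smul, ← Complex.ofReal_mul,
        inv_mul_cancel₀ hr.ne', Complex.ofReal_one, one_smul]
    have h3 : ((r⁻¹ : ℝ) : ℂ) • Ψ (a ⊗ₜ y) =
        y * (((r⁻¹ : ℝ) : ℂ) • Ψ (a ⊗ₜ OperatorSystem.unit)) := by
      refine eq_mul_of_mem_cone (Z' := ((r⁻¹ : ℝ) : ℂ) • Ψ (star a ⊗ₜ star y))
        (Y' := ((r⁻¹ : ℝ) : ℂ) • Ψ (star a ⊗ₜ OperatorSystem.unit)) (D := 1) ?_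
      convert h2 using 1
      ext i j : 1
      fin_cases i <;> fin_cases j
      exacts [(hE ⟨_, hyy⟩).symm, (hE y).symm, rfl, (hE (star y)).symm,
        (hE OperatorSystem.unit).symm, rfl, rfl, rfl, (hE OperatorSystem.unit).symm]
    rw [mul_smul_comm] at h3
    exact smul_right_injective _ hr0 h3
  have hright : ∀ (a : I) (y : W.toSubmodule),
      Ψ (a ⊗ₜ y) = Ψ (a ⊗ₜ OperatorSystem.unit) * y := fun a y => by
    have h1 := hleft (star a) (star y)
    have hs := IsMatrixPositive.map_star hmax hΨ
    have h2 := hs (a ⊗ₜ y)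
    have h3 := hs (a ⊗ₜ (OperatorSystem.unit : W.toSubmodule))
    rw [TensorProduct.star_tmul] at h2 h3
    rw [OperatorSystem.star_unit] at h3
    rw [h2, h3, OperatorSubsystem.coe_star, ← star_mul] at h1
    exact star_injective h1
  refine ⟨Ψ ∘ₗ (TensorProduct.mk ℂ I W.toSubmodule).flip OperatorSystem.unit, fun n M hM => ?_,
    fun a => ?_, fun x => ?_⟩
  · have hW1 : (Matrix.of fun _ _ => OperatorSystem.unit : Matrix (Fin 1) (Fin 1) W.toSubmodule) ∈
        OperatorSystem.cone 1 := (OperatorSystem.isMatrixOrder W.toSubmodule).posOn_unit 1 fun _ => ()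
    exact hΨ n _ (kroneckerMap_submatrix_mem_preMaxCone hM hW1 fun p => (p, 0))
  · rw [Set.mem_centralizer_iff]
    intro t ht
    have htW : t ∈ W.toSubmodule := (hW t).mpr fun x => ht _ ⟨x, rfl⟩
    exact (hleft a ⟨t, htW⟩).symm.trans (hright a ⟨t, htW⟩)
  · exact (hΨκ x OperatorSystem.unit).trans (mul_one _)

end NuclearImpliesExpectation

/-! ### Expectations give nuclearity -/

section ExpectationImpliesNuclear

variable {S T : Type u}
  [AddCommGroup S] [Module ℂ S] [StarAddMonoid S] [StarModule ℂ S] [OperatorSystem S]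
  [AddCommGroup T] [Module ℂ T] [StarAddMonoid T] [StarModule ℂ T] [OperatorSystem T]
  {H : Type u} [NormedAddCommGroup H] [InnerProductSpace ℂ H] [CompleteSpace H]

theorem exists_star_mul_self_add_eq_smul_one_centralizer_prod (s : Set (H →L[ℂ] H))
    (c : StarSubalgebra.centralizer ℂ s × ℂ) :
    ∃ (R : ℝ) (d : StarSubalgebra.centralizer ℂ s × ℂ),
      star c * c + star d * d = (R : ℂ) • 1 := by
  obtain ⟨b, z⟩ := c
  obtain ⟨r, hr, h⟩ := exists_smul_one_sub_nonneg (IsSelfAdjoint.star_mul_self (b : H →L[ℂ] H))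
  have h1 : 0 ≤ ((r + ‖z‖ ^ 2 : ℝ) : ℂ) • (1 : H →L[ℂ] H) - star (b : H →L[ℂ] H) * b := by
    have h2 : (0 : H →L[ℂ] H) ≤ ((‖z‖ ^ 2 : ℝ) : ℂ) • 1 := by
      rw [Complex.coe_smul]
      exact smul_nonneg (by positivity) zero_le_one
    refine (add_nonneg h h2).trans_eq ?_
    push_cast
    module
  obtain ⟨d, hd, hdc⟩ := exists_star_mul_self_commute h1
  have hdm : d ∈ StarSubalgebra.centralizer ℂ s := by
    have h3 := StarSubalgebra.mem_centralizer_iff ℂ |>.mp (star b * b).2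
    rw [StarSubalgebra.mem_centralizer_iff]
    have h4 : ∀ g, Commute g (star (b : H →L[ℂ] H) * b) → g * d = d * g := fun g hg =>
      (hdc g (((Commute.one_left g).smul_left _).sub_left hg.symm)).eq.symm
    exact fun g hg => ⟨h4 g (h3 g hg).1, h4 _ (h3 g hg).2⟩
  -- One constant must serve both factors; in the scalar factor the remainder is exactly `r`. The
  -- operator root `d` stays in the commutant by functional calculus.
  refine ⟨r + ‖z‖ ^ 2, (⟨d, hdm⟩, (Real.sqrt r : ℂ)), Prod.ext (Subtype.ext ?_) ?_⟩
  · change star (b : H →L[ℂ] H) * b + star d * d = ((r + ‖z‖ ^ 2 : ℝ) : ℂ) • (1 : H →L[ℂ] H)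
    rw [← hd]
    abel
  · change star z * z + star (Real.sqrt r : ℂ) * (Real.sqrt r : ℂ) = ((r + ‖z‖ ^ 2 : ℝ) : ℂ) • (1 : ℂ)
    rw [RCLike.star_def, Complex.conj_ofReal, Complex.conj_mul',
      ← Complex.ofReal_mul, Real.mul_self_sqrt hr.le]
    push_cast
    simp [add_comm]

/-- Commuting completely positive maps are compressions of commuting completely positive maps, the
first of which is an inclusion. -/
theorem exists_isInclusion_dilation {φ : S →ₗ[ℂ] (H →L[ℂ] H)} {ψ : T →ₗ[ℂ] (H →L[ℂ] H)}
    (hφ : IsCompletelyPositive φ) (hψ : IsCompletelyPositive ψ)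
    (hcomm : ∀ x y, Commute (φ x) (ψ y)) :
    ∃ (K : Type u) (_ : NormedAddCommGroup K) (_ : InnerProductSpace ℂ K) (_ : CompleteSpace K)
      (φ' : S →ₗ[ℂ] (K →L[ℂ] K)) (ψ' : T →ₗ[ℂ] (K →L[ℂ] K)) (V : H → K),
      IsInclusion φ' ∧ IsCompletelyPositive ψ' ∧ (∀ x y, Commute (φ' x) (ψ' y)) ∧
      ∀ ξ η x y, inner ℂ (V ξ) (φ' x (ψ' y (V η))) = inner ℂ ξ (φ x (ψ y η)) := by
  obtain ⟨L, _, _, _, ι, hι⟩ := exists_isInclusion_clm S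
  let B := StarSubalgebra.centralizer ℂ (Set.range φ)
  have hB : ∀ b : H →L[ℂ] H, (∀ x, Commute (φ x) b) → b ∈ B := fun b hb => by
    refine (StarSubalgebra.mem_centralizer_iff ℂ).mpr ?_
    rintro _ ⟨x, rfl⟩
    rw [← hφ.map_star]
    exact ⟨hb x, hb (star x)⟩
  have hBφ : ∀ (b : B) x, Commute (φ x) (b : H →L[ℂ] H) := fun b x =>
    ((StarSubalgebra.mem_centralizer_iff ℂ).mp b.2 _ ⟨x, rfl⟩).1
  let f : L → L → S →ₗ[ℂ] ℂ := fun ξ η =>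
    { toFun := fun x => inner ℂ ξ (ι x η)
      map_add' := fun x y => by rw [map_add, add_apply, inner_add_right]
      map_smul' := fun c x => by rw [map_smul, smul_apply, inner_smul_right]; rfl }
  let g : H → H → B →ₗ[ℂ] S →ₗ[ℂ] ℂ := fun ξ η =>
    LinearMap.mk₂ ℂ (fun b x => inner ℂ ξ ((b : H →L[ℂ] H) (φ x η)))
      (fun b b' x => by rw [B.coe_add, add_apply, inner_add_right])
      (fun c b x => by rw [B.coe_smul, smul_apply, inner_smul_right]; rfl)
      (fun b x y => by rw [map_add, add_apply, map_add, inner_add_right])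
      (fun c b x => by rw [map_smul, smul_apply, map_smul, inner_smul_right]; rfl)
  -- The roles are exchanged: the algebra is `φ(S)' × ℂ`, and `S` is the matrix ordered space. The
  -- summand `H` carries `φ`, and `L` carries a faithful `ι` that forces the dilated map to be an
  -- inclusion.
  let k : H ⊕ L → H ⊕ L → (B × ℂ) →ₗ[ℂ] S →ₗ[ℂ] ℂ
    | Sum.inl ξ, Sum.inl η => g ξ η ∘ₗ LinearMap.fst ℂ B ℂ
    | Sum.inr ξ, Sum.inr η => (LinearMap.toSpanSingleton ℂ _ (f ξ η)) ∘ₗ LinearMap.snd ℂ B ℂ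
    | _, _ => 0
  let X : (H ⊕ L) × (B × ℂ) → H
    | (Sum.inl ξ, a) => (a.1 : H →L[ℂ] H) ξ
    | (Sum.inr _, _) => 0
  let Y : (H ⊕ L) × (B × ℂ) → L
    | (Sum.inl _, _) => 0
    | (Sum.inr η, a) => a.2 • η
  have hk : ∀ (p q : (H ⊕ L) × (B × ℂ)) x, k p.1 q.1 (star p.2 * q.2) x =
      inner ℂ (X p) (φ x (X q)) + inner ℂ (Y p) (ι x (Y q)) := by
    rintro ⟨ξ | ξ, b, c⟩ ⟨η | η, b', c'⟩ x
    · change inner ℂ ξ ((star (b : H →L[ℂ] H) * (b' : H →L[ℂ] H)) (φ x η)) =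
        inner ℂ ((b : H →L[ℂ] H) ξ) (φ x ((b' : H →L[ℂ] H) η)) + inner ℂ (0 : L) (ι x 0)
      rw [inner_zero_left, add_zero, mul_apply_eq_comp, ContinuousLinearMap.star_eq_adjoint,
        ContinuousLinearMap.adjoint_inner_right]
      exact congrArg _ (DFunLike.congr_fun (hBφ b' x).eq η).symm
    · simp [k, X, Y]
    · simp [k, X, Y]
    · change (star c * c') * inner ℂ ξ (ι x η) =
        inner ℂ (0 : H) (φ x 0) + inner ℂ (c • ξ) (ι x (c' • η))
      rw [inner_zero_left, zero_add, map_smul, inner_smul_left, inner_smul_right,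
        RCLike.star_def, mul_assoc]
  obtain ⟨K, _, _, _, π, φ', V, hφ'1, hφ', hcomm', hV⟩ :=
    (OperatorSystem.isMatrixOrder S).exists_dilation (A := B × ℂ)
      (exists_star_mul_self_add_eq_smul_one_centralizer_prod _) k (by
      intro m b Q hQ
      simp only [hk, Finset.sum_add_distrib]
      exact add_nonneg (sum_inner_nonneg_of_mem_cone (hφ m Q hQ) fun p => X (b p))
        (sum_inner_nonneg_of_mem_cone (hι.isCompletelyPositive m Q hQ) fun p => Y (b p)))
  -- `ψ` acts on the `H` part alone; it need not be unital.
  let ρ : T →ₗ[ℂ] B × ℂ :=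
    { toFun := fun y => (⟨ψ y, hB _ fun x => hcomm x y⟩, 0)
      map_add' := fun x y => Prod.ext (Subtype.ext (map_add ψ x y)) (add_zero 0).symm
      map_smul' := fun c x => Prod.ext (Subtype.ext (map_smul ψ c x)) (smul_zero c).symm }
  refine ⟨K, inferInstance, inferInstance, inferInstance, φ', π.toLinearMap ∘ₗ ρ,
    fun ξ => V (Sum.inl ξ), isInclusion_of_mem_cone_iff hφ'1 fun n M => ⟨fun hM => ?_, hφ' n M⟩,
    fun n M hM => ?_, fun x y => (hcomm' (ρ y) x).symm, fun ξ η x y => ?_⟩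
  · rw [← hι.mem_cone_iff, mem_cone_iff_sum_inner_nonneg]
    intro v
    refine (sum_inner_nonneg_of_mem_cone hM fun p => V (Sum.inr (v p))).trans_eq ?_
    refine Finset.sum_congr rfl fun p _ => Finset.sum_congr rfl fun q _ => ?_
    have h := hV (Sum.inr (v p)) (Sum.inr (v q)) 1 (M p q)
    rw [map_one, one_apply_eq_self] at h
    exact h.trans (one_mul _)
  -- The root has entries in the commutant `B`, so `π` may be applied to it and turns the
  -- factorization into a Gram matrix.
  · obtain ⟨R, hR, hRc⟩ := cone_exists_star_mul (hψ n M hM)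
    have hRB : ∀ p q, R p q ∈ B := fun p q => hB _ fun x =>
      (hRc (φ x) (fun _ _ => (hcomm x _).symm) p q).symm
    convert mem_cone_of_star_mul (Matrix.of fun p q => π (⟨R p q, hRB p q⟩, 0)) using 1
    ext p q : 1
    simp only [Matrix.of_apply, ← map_star, ← map_mul, ← map_sum]
    refine congrArg π (Prod.ext (Subtype.ext ?_) ?_)
    · refine (hR p q).trans ?_
      simp [Prod.fst_sum]
    · simp [Prod.snd_sum, ρ]
  · have h := hV (Sum.inl ξ) (Sum.inl η) (ρ y) x
    have h1 : inner ℂ (V (Sum.inl ξ)) (φ' x (π (ρ y) (V (Sum.inl η)))) =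
        inner ℂ (V (Sum.inl ξ)) (π (ρ y) (φ' x (V (Sum.inl η)))) :=
      congrArg _ (DFunLike.congr_fun (hcomm' (ρ y) x).eq _).symm
    refine (h1.trans h).trans ?_
    exact congrArg _ (DFunLike.congr_fun (hcomm x y).eq η).symm

/-- Expectations are available only for inclusions, so the pair is dilated first. The extension of
`φ'` to `I` has values in the double commutant and still commutes with `ψ'`, which makes the product
map positive on `I ⊗_max T`. -/
theorem elCone_subset_commCone {I : Type u} [AddCommGroup I] [Module ℂ I] [StarAddMonoid I]
    [StarModule ℂ I] [OperatorSystem I] {κ : S →ₗ[ℂ] I}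
    (h : ∀ (H : Type u) [NormedAddCommGroup H] [InnerProductSpace ℂ H] [CompleteSpace H]
      (ι : S →ₗ[ℂ] (H →L[ℂ] H)), IsInclusion ι → HasDoubleCommutantExpectation κ ι) (n : ℕ) :
    elCone T κ n ⊆ commCone S T n := by
  intro u hu H _ _ _ φ ψ hφ hψ hcomm
  obtain ⟨K, _, _, _, φ', ψ', V, hφ', hψ', hcomm', hV⟩ := exists_isInclusion_dilation hφ hψ hcomm
  obtain ⟨Φ, hΦ, hΦ', hΦκ⟩ := h K φ' hφ'
  have h1 := map_productMap_mem_cone_of_mem_maxCone hΦ hψ' (fun a y =>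
    (Set.mem_centralizer_iff.mp (hΦ' a) (ψ' y) (by
      rintro _ ⟨x, rfl⟩
      exact hcomm' x y)).symm) hu
  have h2 : productMap Φ ψ' ∘ₗ TensorProduct.map κ (LinearMap.id : T →ₗ[ℂ] T) =
      productMap φ' ψ' := by
    ext x y : 3
    simp [productMap, hΦκ]
  rw [Matrix.map_map, ← LinearMap.coe_comp, h2] at h1
  rw [mem_cone_iff_sum_inner_nonneg]
  intro v
  refine (sum_inner_nonneg_of_mem_cone h1 fun p => V (v p)).trans_eq ?_
  refine Finset.sum_congr rfl fun p _ => Finset.sum_congr rfl fun q _ => ?_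
  rw [Matrix.map_apply, Matrix.map_apply]
  generalize u p q = z
  induction z using TensorProduct.induction_on with
  | zero => simp
  | tmul x y =>
    have h3 := hV (v p) (v q) x y
    rw [← mul_apply_eq_comp, ← mul_apply_eq_comp, ← productMap_tmul, ← productMap_tmul] at h3
    exact h3
  | add y z hy hz => rw [map_add, map_add, add_apply, add_apply, inner_add_right, inner_add_right,
      hy, hz]

end ExpectationImpliesNuclear

/-! ### The equivalence -/

theorem mainTheorem3 (S : Type u) [AddCommGroup S] [Module ℂ S] [StarAddMonoid S]
    [StarModule ℂ S] [OperatorSystem S] :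
    -- the injective envelope `I(S)` exists, and for any realization `κ : S → I` of it
    -- the five properties are equivalent
    (∃ (I : Type u) (_ : AddCommGroup I) (_ : Module ℂ I) (_ : StarAddMonoid I)
      (_ : StarModule ℂ I) (_ : OperatorSystem I) (κ : S →ₗ[ℂ] I), IsInjectiveEnvelope κ) ∧
    ∀ (I : Type u) [AddCommGroup I] [Module ℂ I] [StarAddMonoid I] [StarModule ℂ I]
      [OperatorSystem I] (κ : S →ₗ[ℂ] I), IsInjectiveEnvelope κ →
      List.TFAE [
        HasDCEP S,
        ∀ (H : Type u) [NormedAddCommGroup H] [InnerProductSpace ℂ H] [CompleteSpace H]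
          (ι : S →ₗ[ℂ] (H →L[ℂ] H)), IsInclusion ι → HasDoubleCommutantExpectation κ ι,
        ∃ (B : Type u) (_ : CStarAlgebra B) (_ : PartialOrder B) (_ : StarOrderedRing B)
          (j : S →ₗ[ℂ] B), IsInjectiveSystem B ∧ IsInclusion j ∧
          ∀ (H : Type u) [NormedAddCommGroup H] [InnerProductSpace ℂ H] [CompleteSpace H]
            (ι : S →ₗ[ℂ] (H →L[ℂ] H)), IsInclusion ι → HasDoubleCommutantExpectation j ι,
        ∀ (A : Type u) [CStarAlgebra A] [PartialOrder A] [StarOrderedRing A]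
          (ι : S →ₗ[ℂ] A), IsInjectiveSystem A → IsInclusion ι →
          HasDoubleCommutantExpectation ι ι,
        IsElCommNuclear κ] := by
  refine ⟨exists_isInjectiveEnvelope S, fun I _ _ _ _ _ κ hκ => ?_⟩
  tfae_have 1 → 2 := fun h H _ _ _ ι hι =>
    (h H ι hι).of_isInjectiveSystem (isInjectiveSystem_clm H) hι.isCompletelyPositive
      hκ.isInclusion
  tfae_have 2 → 3 := fun h => by
    obtain ⟨K, _, _, _, j, hj⟩ := exists_isInclusion_clm S
    exact ⟨K →L[ℂ] K, inferInstance, inferInstance, inferInstance, j, isInjectiveSystem_clm K, hj,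
      fun H _ _ _ ι hι => (h H ι hι).of_isInjectiveSystem hκ.isInjective
        hκ.isInclusion.isCompletelyPositive hj⟩
  tfae_have 3 → 1 := by
    rintro ⟨B, _, _, _, j, hB, hj, h⟩ H _ _ _ ι hι
    exact (h H ι hι).of_isInjectiveSystem hB hj.isCompletelyPositive hι
  tfae_have 1 → 4 := fun h A _ _ _ ι hA hι => by
    obtain ⟨K, _, _, _, π, hπ⟩ := exists_isInclusion_starAlgHom A
    exact hasDoubleCommutantExpectation_of_isInclusion hπ hA (h K _ (hπ.comp hι))
  tfae_have 4 → 1 := fun h H _ _ _ ι hι => h _ ι (isInjectiveSystem_clm H) hι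
  tfae_have 5 → 2 := fun h H _ _ _ ι hι => h.hasDoubleCommutantExpectation hκ.isInclusion hι
  tfae_have 2 → 5 := fun h T _ _ _ _ _ n => (elCone_subset_commCone h n).antisymm
    (commCone_subset_elCone hκ.isInclusion hκ.isInjective n)
  tfae_finish

end
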